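/- Let $n\ge 3$ and $\mathbb{R}^n_+=\{x\in\mathbb{R}^n: x_1>0\}$. A smooth domain is a nonempty connected open set $\Omega\subset\mathbb{R}^n$, not necessarily bounded, with $C^\infty$ boundary: for every $p\in\partial\Omega$ there is a $C^\infty$ diffeomorphism $\varphi:U\to V$ between open sets of $\mathbb{R}^n$ with $0\in U$, $\varphi(0)=p$, $\varphi(U\cap\{x_1>0\})=V\cap\Omega$ and $\varphi(U\cap\{x_1=0\})=V\cap\partial\Omega$. Let $D^{1,2}(\Omega)$ be the completion of $C_c^\infty(\Omega)$ for the norm $\|u\|^2=\int_\Omega|\nabla u|^2\,dx$ (a space of functions contained in $L^{2n/(n-2)}$), and define the Hardy constant $$\gamma_H(\Omega):=\inf\left\{\frac{\int_\Omega|\nabla u|^2\,dx}{\int_\Omega\frac{u^2}{|x|^2}\,dx}\;:\;u\in D^{1,2}(\Omega)\setminus\{0\}\right\}.$$ Then: 1. For every smooth domain $\Omega$ with $0\in\Omega$, $\gamma_H(\Omega)=\frac{(n-2)^2}{4}$. 2. For every smooth domain $\Omega$ with $0\in\partial\Omega$, $\frac{(n-2)^2}{4}\le\gamma_H(\Omega)\le\frac{n^2}{4}$;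 if moreover $\Omega$ is bounded, then $\frac{(n-2)^2}{4}<\gamma_H(\Omega)\le\frac{n^2}{4}$. 3. For every smooth domain $\Omega$ with $0\in\partial\Omega$ and $\Omega\subset\mathbb{R}^n_+$, $\gamma_H(\Omega)=\frac{n^2}{4}$. 4. If $\Omega$ is a bounded smooth domain with $0\in\partial\Omega$ and $\gamma_H(\Omega)<\frac{n^2}{4}$, then $\gamma_H(\Omega)$ is attained by some $u\in D^{1,2}(\Omega)\setminus\{0\}$. 5. The infimum of $\gamma_H(\Omega)$ over all smooth domains $\Omega$ with $0\in\partial\Omega$ equals $\frac{(n-2)^2}{4}$, and so does the infimum over the bounded ones. 6. For every $\epsilon>0$ there is a smooth domain $\Omega_\epsilon$ with $\mathbb{R}^n_+\subsetneq\Omega_\epsilon\subsetneq\mathbb{R}^n$, $0\in\partial\Omega_\epsilon$ and $\frac{n^2}{4}-\epsilon\le\gamma_H(\Omega_\epsilon)<\frac{n^2}{4}$. -/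

import Mathlib

open MeasureTheory Filter Topology
open scoped ENNReal ContDiff

/-- The open half-space `ℝⁿ₊ = {x ∈ ℝⁿ : x₁ > 0}`; the first coordinate has index `0`. -/
def halfSpace (n : ℕ) [NeZero n] : Set (EuclideanSpace ℝ (Fin n)) :=
  {x | 0 < x 0}

/-- A smooth domain: a nonempty connected open set whose boundary is, near each of its points `p`,
straightened by a smooth diffeomorphism `φ` between open sets with `φ 0 = p` that maps
`{x₁ > 0}` into the domain, `{x₁ = 0}` into its boundary, and `{x₁ < 0}` into the exterior.
Boundedness is not required. -/
structure IsSmoothDomain {n : ℕ} [NeZero n] (Ω : Set (EuclideanSpace ℝ (Fin n))) : Prop where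
  isOpen : IsOpen Ω
  isConnected : IsConnected Ω
  exists_chart : ∀ p ∈ frontier Ω,
    ∃ φ : OpenPartialHomeomorph (EuclideanSpace ℝ (Fin n)) (EuclideanSpace ℝ (Fin n)),
      0 ∈ φ.source ∧ φ 0 = p ∧
      ContDiffOn ℝ ∞ φ φ.source ∧ ContDiffOn ℝ ∞ φ.symm φ.target ∧
      ∀ x ∈ φ.source, (φ x ∈ Ω ↔ 0 < x 0) ∧ (φ x ∈ frontier Ω ↔ x 0 = 0)

/-- `φ ∈ C_c^∞(Ω)`, extended by zero to the whole space. -/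
def IsTestFunction {n : ℕ} (Ω : Set (EuclideanSpace ℝ (Fin n)))
    (φ : EuclideanSpace ℝ (Fin n) → ℝ) : Prop :=
  ContDiff ℝ ∞ φ ∧ HasCompactSupport φ ∧ tsupport φ ⊆ Ω

/-- The critical Sobolev exponent `2n / (n - 2)` (meaningful for `n ≥ 3`). -/
noncomputable def sobolevExponent (n : ℕ) : ℝ≥0∞ :=
  ENNReal.ofReal (2 * (n : ℝ) / ((n : ℝ) - 2))

/-- `u` belongs to `D^{1,2}(Ω)`, the completion of `C_c^∞(Ω)` for the norm `‖∇u‖_{L²}`, and `g` is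
its gradient (functions are extended by zero outside `Ω`). For `n ≥ 3` a sequence of test functions
that is Cauchy for this norm converges in `L^{2n/(n-2)}` by the Sobolev inequality, which realises
the completion as a space of functions: those `u` that are the limit in `L^{2n/(n-2)}` of test
functions whose gradients converge in `L²`; the limit of the gradients is the weak gradient of `u`,
so that `g` is determined by `u` up to a null set. -/
structure MemD12 {n : ℕ} (Ω : Set (EuclideanSpace ℝ (Fin n)))
    (u : EuclideanSpace ℝ (Fin n) → ℝ)
    (g : EuclideanSpace ℝ (Fin n) → EuclideanSpace ℝ (Fin n)) : Prop where
  memLp_fun : MemLp u (sobolevExponent n) volume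
  memLp_grad : MemLp g 2 volume
  exists_approx : ∃ φ : ℕ → EuclideanSpace ℝ (Fin n) → ℝ,
    (∀ k, IsTestFunction Ω (φ k)) ∧
    Tendsto (fun k => eLpNorm (φ k - u) (sobolevExponent n) volume) atTop (𝓝 0) ∧
    Tendsto (fun k => eLpNorm (gradient (φ k) - g) 2 volume) atTop (𝓝 0)

/-- The quotient `(∫_Ω |∇u|² dx) / (∫_Ω u²/|x|² dx)`, where `g` stands for the gradient of `u`. -/
noncomputable def hardyQuotient {n : ℕ} (Ω : Set (EuclideanSpace ℝ (Fin n)))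
    (u : EuclideanSpace ℝ (Fin n) → ℝ)
    (g : EuclideanSpace ℝ (Fin n) → EuclideanSpace ℝ (Fin n)) : ℝ≥0∞ :=
  (∫⁻ x in Ω, ‖g x‖ₑ ^ 2) / (∫⁻ x in Ω, ‖u x‖ₑ ^ 2 / ‖x‖ₑ ^ 2)

/-- The Hardy constant `γ_H(Ω)`: the infimum of the Hardy quotient over `D^{1,2}(Ω) \ {0}`, as an
element of `[0, ∞]`. -/
noncomputable def hardyConstant {n : ℕ} (Ω : Set (EuclideanSpace ℝ (Fin n))) : ℝ≥0∞ :=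
  sInf {r | ∃ u g, MemD12 Ω u g ∧ ¬ u =ᵐ[volume] 0 ∧ r = hardyQuotient Ω u g}

/-- The infimum in the definition of `γ_H(Ω)` is attained in `D^{1,2}(Ω) \ {0}`. -/
def HardyConstantAttained {n : ℕ} (Ω : Set (EuclideanSpace ℝ (Fin n))) : Prop :=
  ∃ u g, MemD12 Ω u g ∧ ¬ u =ᵐ[volume] 0 ∧ hardyQuotient Ω u g = hardyConstant Ω

/-! Everything rests on completing a square. Since φ²V has zero total divergence, ∫|∇φ|² = ∫|∇φ +
φV|² + ∫φ²(div V - |V|²) for every vector field V regular near the support of φ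
(`IsTestFunction.integral_norm_gradient_sq`). For V = -∇U/U with U > 0 the last weight is -ΔU/U. The
ground state U = |x|^(-(n-2)/2) yields (n-2)²/4 · |x|⁻², and U = ⟨ν, x⟩ |x|^(-n/2) yields n²/4 ·
|x|⁻² on a half-space. Dropping the square proves the Hardy inequalities. Multiplying U by
logarithmic cutoffs of small energy makes the square small and shows that both constants are
optimal.

By Fatou's lemma the Hardy constant is decided by test functions (`le_hardyConstant_iff`), and both
energies scale alike, so near-optimal functions can be moved into arbitrarily small balls. At an
interior point this gives (n-2)²/4. At a boundary point a chart normalised to have derivative the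
identity at 0 almost preserves both energies. It gives the upper bound n²/4 and, conversely, a local
inequality with any constant below n²/4 (`IsSmoothDomain.hardy_local`). A cutoff makes the latter
global at the price of a term C∫φ² (`IsSmoothDomain.hardy_garding`).

On a bounded domain that price is paid by the L² remainder in the classical Hardy inequality, whence
strictness of the lower bound. For attainment, Rellich's theorem makes a minimizing sequence Cauchy
in L²; the parallelogram law and the inequality with error C∫φ² then make it Cauchy in the Dirichlet
norm. The infimum (n-2)²/4 is approached by balls with a small ball through the origin removed.

For domains slightly larger than the half-space, a small shear keeps the constant near n²/4. It
drops strictly below because a virtual ground state of the half-space, which has deficit nearly 0,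
is perturbed to first order by a bump crossing the boundary
(`exists_isTestFunction_halfSpace_union`). -/

open scoped RealInnerProductSpace

/-! ### Calculus rules for gradients -/

section GradientCalculus

variable {F : Type*} [NormedAddCommGroup F] [InnerProductSpace ℝ F] [CompleteSpace F]
  {f g : F → ℝ} {f' g' x : F}

theorem HasGradientAt.fun_add (hf : HasGradientAt f f' x) (hg : HasGradientAt g g' x) :
    HasGradientAt (fun y => f y + g y) (f' + g') x := by
  rw [hasGradientAt_iff_hasFDerivAt] at *
  rw [map_add]; exact hf.add hg

theorem HasGradientAt.fun_sub (hf : HasGradientAt f f' x) (hg : HasGradientAt g g' x) :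
    HasGradientAt (fun y => f y - g y) (f' - g') x := by
  rw [hasGradientAt_iff_hasFDerivAt] at *
  rw [map_sub]; exact hf.sub hg

theorem HasGradientAt.fun_mul (hf : HasGradientAt f f' x) (hg : HasGradientAt g g' x) :
    HasGradientAt (fun y => f y * g y) (f x • g' + g x • f') x := by
  rw [hasGradientAt_iff_hasFDerivAt] at *
  rw [map_add,
        map_smul, map_smul]; exact hf.mul hg

theorem HasDerivAt.comp_hasGradientAt {q : ℝ → ℝ} {q' : ℝ} (hq : HasDerivAt q q' (f x))
    (hf : HasGradientAt f f' x) : HasGradientAt (fun y => q (f y)) (q' • f') x := by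
  rw [hasGradientAt_iff_hasFDerivAt] at *
  rw [map_smul]; exact hq.comp_hasFDerivAt x hf

theorem hasGradientAt_inner_left (v x : F) : HasGradientAt (fun y => ⟪v, y⟫) v x := by
  rw [hasGradientAt_iff_hasFDerivAt]
  exact ((InnerProductSpace.toDual ℝ F) v).hasFDerivAt

theorem hasGradientAt_norm_sq (x : F) : HasGradientAt (fun y => ‖y‖ ^ 2) ((2 : ℝ) • x) x := by
  rw [hasGradientAt_iff_hasFDerivAt]
  have h : (InnerProductSpace.toDual ℝ F) ((2 : ℝ) • x) = 2 • (innerSL ℝ) x := by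
    ext y
    simp [two_smul]
  rw [h]
  exact (hasStrictFDerivAt_norm_sq x).hasFDerivAt

end GradientCalculus

/-! ### Regularity of functions vanishing off a compact or closed set -/

section CompactSupport

variable {X : Type*} [TopologicalSpace X] {G : Type*} [TopologicalSpace G] [Zero G]

/-- A function that is continuous on an open set `O` and vanishes off a compact `K ⊆ O`. -/
theorem continuous_of_continuousOn_of_eq_zero [T2Space X] {f : X → G} {O K : Set X}
    (hO : IsOpen O) (hf : ContinuousOn f O) (hK : IsCompact K) (hKO : K ⊆ O)
    (h0 : ∀ x ∉ K, f x = 0) : Continuous f := by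
  rw [continuous_iff_continuousAt]
  intro x
  by_cases hx : x ∈ O
  · exact hf.continuousAt (hO.mem_nhds hx)
  · have hxK : x ∈ Kᶜ := fun h => hx (hKO h)
    have : f =ᶠ[𝓝 x] fun _ => 0 :=
      Filter.eventually_of_mem (hK.isClosed.isOpen_compl.mem_nhds hxK) h0
    exact continuousAt_const.congr this.symm

theorem contDiff_of_contDiffOn_of_eq_zero {F G : Type*} [NormedAddCommGroup F] [NormedSpace ℝ F]
    [NormedAddCommGroup G] [NormedSpace ℝ G] {k : WithTop ℕ∞} {f : F → G} {O K : Set F}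
    (hO : IsOpen O) (hf : ContDiffOn ℝ k f O) (hK : IsClosed K) (hKO : K ⊆ O)
    (h0 : ∀ x ∉ K, f x = 0) : ContDiff ℝ k f := by
  rw [contDiff_iff_contDiffAt]
  intro x
  by_cases hx : x ∈ O
  · exact hf.contDiffAt (hO.mem_nhds hx)
  · have hxK : x ∈ Kᶜ := fun h => hx (hKO h)
    have : f =ᶠ[𝓝 x] fun _ => 0 :=
      Filter.eventually_of_mem (hK.isOpen_compl.mem_nhds hxK) h0
    exact contDiffAt_const.congr_of_eventuallyEq this

end CompactSupport

/-! ### Test functions and their two energies -/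

section TestFunctions

variable {n : ℕ} {Ω Ω' : Set (EuclideanSpace ℝ (Fin n))} {φ ψ : EuclideanSpace ℝ (Fin n) → ℝ}

theorem IsTestFunction.of_contDiffOn {O K : Set (EuclideanSpace ℝ (Fin n))} (hO : IsOpen O)
    (hf : ContDiffOn ℝ ∞ φ O) (hK : IsCompact K) (hKO : K ⊆ O) (hKΩ : K ⊆ Ω)
    (h0 : ∀ x ∉ K, φ x = 0) : IsTestFunction Ω φ := by
  have hs : tsupport φ ⊆ K := closure_minimal
    (fun x hx => by_contra fun h => hx (h0 x h)) hK.isClosed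
  exact ⟨contDiff_of_contDiffOn_of_eq_zero hO hf hK.isClosed hKO h0,
    hK.of_isClosed_subset (isClosed_tsupport _) hs, hs.trans hKΩ⟩

theorem IsTestFunction.mono (h : IsTestFunction Ω φ) (hΩ : tsupport φ ⊆ Ω') :
    IsTestFunction Ω' φ := ⟨h.1, h.2.1, hΩ⟩

theorem IsTestFunction.continuous (h : IsTestFunction Ω φ) : Continuous φ := h.1.continuous

theorem IsTestFunction.differentiable (h : IsTestFunction Ω φ) : Differentiable ℝ φ :=
  h.1.differentiable (by simp)

theorem IsTestFunction.hasGradientAt (h : IsTestFunction Ω φ) (x : EuclideanSpace ℝ (Fin n)) :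
    HasGradientAt φ (gradient φ x) x := (h.differentiable x).hasGradientAt

theorem IsTestFunction.continuous_gradient (h : IsTestFunction Ω φ) :
    Continuous (gradient φ) :=
  (LinearIsometryEquiv.continuous _).comp (h.1.continuous_fderiv (by simp))

theorem gradient_eq_zero_of_notMem_tsupport {x : EuclideanSpace ℝ (Fin n)}
    (hx : x ∉ tsupport φ) : gradient φ x = 0 := by
  have h := image_eq_zero_of_notMem_tsupport (fun h => hx (tsupport_fderiv_subset ℝ h))
  rw [gradient, h, map_zero]

theorem IsTestFunction.hasCompactSupport_gradient (h : IsTestFunction Ω φ) :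
    HasCompactSupport (gradient φ) :=
  HasCompactSupport.intro h.2.1 fun _ hx => gradient_eq_zero_of_notMem_tsupport hx

theorem IsTestFunction.add (h : IsTestFunction Ω φ) (h' : IsTestFunction Ω ψ) :
    IsTestFunction Ω (fun x => φ x + ψ x) :=
  ⟨h.1.add h'.1, h.2.1.add h'.2.1,
    (tsupport_add φ ψ).trans (Set.union_subset h.2.2 h'.2.2)⟩

theorem IsTestFunction.mul_left {q : EuclideanSpace ℝ (Fin n) → ℝ} (h : IsTestFunction Ω φ)
    (hq : ContDiff ℝ ∞ q) : IsTestFunction Ω (fun x => q x * φ x) :=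
  ⟨hq.mul h.1, h.2.1.mul_left, (tsupport_mul_subset_right (f := q) (g := φ)).trans h.2.2⟩

theorem IsTestFunction.const_mul (h : IsTestFunction Ω φ) (c : ℝ) :
    IsTestFunction Ω (fun x => c * φ x) := h.mul_left contDiff_const

theorem IsTestFunction.sub (h : IsTestFunction Ω φ) (h' : IsTestFunction Ω ψ) :
    IsTestFunction Ω (fun x => φ x - ψ x) := by
  simpa [sub_eq_add_neg] using h.add (h'.const_mul (-1))

/-- A function continuous near the support of `φ`, that vanishes where `φ` does, is integrable. -/
theorem IsTestFunction.integrable {G : Type*} [NormedAddCommGroup G] (h : IsTestFunction Ω φ)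
    {O : Set (EuclideanSpace ℝ (Fin n))} (hO : IsOpen O) (hφ : tsupport φ ⊆ O)
    {q : EuclideanSpace ℝ (Fin n) → G} (hq : ContinuousOn q O)
    (h0 : ∀ x ∉ tsupport φ, q x = 0) : Integrable q :=
  (continuous_of_continuousOn_of_eq_zero hO hq h.2.1 hφ h0).integrable_of_hasCompactSupport
    (HasCompactSupport.intro h.2.1 h0)

/-- The Dirichlet energy `∫ |∇φ|²`. -/
noncomputable def dirichletEnergy (φ : EuclideanSpace ℝ (Fin n) → ℝ) : ℝ≥0∞ :=
  ∫⁻ x, ‖gradient φ x‖ₑ ^ 2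

/-- The Hardy energy `∫ φ² / |x|²`. -/
noncomputable def hardyEnergy (φ : EuclideanSpace ℝ (Fin n) → ℝ) : ℝ≥0∞ :=
  ∫⁻ x, ‖φ x‖ₑ ^ 2 / ‖x‖ₑ ^ 2

theorem IsTestFunction.integrable_norm_gradient_sq (h : IsTestFunction Ω φ) :
    Integrable (fun x => ‖gradient φ x‖ ^ 2) :=
  h.integrable isOpen_univ (Set.subset_univ _)
    (h.continuous_gradient.norm.pow 2).continuousOn
    fun x hx => by simp [gradient_eq_zero_of_notMem_tsupport hx]

theorem IsTestFunction.dirichletEnergy_eq (h : IsTestFunction Ω φ) :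
    dirichletEnergy φ = ENNReal.ofReal (∫ x, ‖gradient φ x‖ ^ 2) := by
  rw [ofReal_integral_eq_lintegral_ofReal h.integrable_norm_gradient_sq
    (ae_of_all _ fun x => by positivity)]
  refine lintegral_congr fun x => ?_
  rw [ENNReal.ofReal_pow (norm_nonneg _), ofReal_norm]

theorem IsTestFunction.integrable_sq (h : IsTestFunction Ω φ) :
    Integrable (fun x => φ x ^ 2) :=
  h.integrable isOpen_univ (Set.subset_univ _) (h.continuous.pow 2).continuousOn
    fun x hx => by simp [image_eq_zero_of_notMem_tsupport hx]

theorem IsTestFunction.integrable_sq_div (h : IsTestFunction Ω φ) (h0 : 0 ∉ tsupport φ) :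
    Integrable (fun x => φ x ^ 2 / ‖x‖ ^ 2) := by
  refine h.integrable isOpen_compl_singleton (O := {0}ᶜ) (fun x hx h => h0 (h ▸ hx))
    (ContinuousOn.div (h.continuous.pow 2).continuousOn (by fun_prop) fun x hx => ?_)
    fun x hx => by simp [image_eq_zero_of_notMem_tsupport hx]
  have : ‖x‖ ≠ 0 := norm_ne_zero_iff.2 hx
  positivity

theorem hardyEnergy_eq_lintegral_ofReal [NeZero n] :
    hardyEnergy φ = ∫⁻ x, ENNReal.ofReal (φ x ^ 2 / ‖x‖ ^ 2) := by
  refine lintegral_congr_ae ?_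
  filter_upwards [Measure.ae_ne volume 0] with x hx
  have : 0 < ‖x‖ := norm_pos_iff.2 hx
  rw [ENNReal.ofReal_div_of_pos (by positivity), ENNReal.ofReal_pow this.le, ← sq_abs,
    ENNReal.ofReal_pow (abs_nonneg _), ofReal_norm, ← Real.norm_eq_abs,
    ofReal_norm]

theorem IsTestFunction.hardyEnergy_eq [NeZero n] (h : IsTestFunction Ω φ) (h0 : 0 ∉ tsupport φ) :
    hardyEnergy φ = ENNReal.ofReal (∫ x, φ x ^ 2 / ‖x‖ ^ 2) := by
  rw [ofReal_integral_eq_lintegral_ofReal (h.integrable_sq_div h0)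
    (ae_of_all _ fun x => by positivity), hardyEnergy_eq_lintegral_ofReal]

theorem IsTestFunction.mul_hardyEnergy_le_iff [NeZero n] (h : IsTestFunction Ω φ)
    (h0 : 0 ∉ tsupport φ) {c : ℝ} (hc : 0 ≤ c) :
    ENNReal.ofReal c * hardyEnergy φ ≤ dirichletEnergy φ ↔
      c * ∫ x, φ x ^ 2 / ‖x‖ ^ 2 ≤ ∫ x, ‖gradient φ x‖ ^ 2 := by
  rw [h.hardyEnergy_eq h0, h.dirichletEnergy_eq, ← ENNReal.ofReal_mul hc,
    ENNReal.ofReal_le_ofReal_iff (integral_nonneg fun x => by positivity)]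

end TestFunctions

/-! ### The divergence theorem and completing the square -/

section IntegrationByParts

variable {n : ℕ} {Ω O : Set (EuclideanSpace ℝ (Fin n))} {φ : EuclideanSpace ℝ (Fin n) → ℝ}

/-- The divergence theorem without boundary term: each diagonal entry ⟨v, DW v⟩ is the derivative of
⟨v, W⟩ along v, and it integrates to zero by parts against the constant 1. -/
theorem integral_trace_fderiv_eq_zero {W : EuclideanSpace ℝ (Fin n) → EuclideanSpace ℝ (Fin n)}
    (hW : ContDiff ℝ 1 W) (hc : HasCompactSupport W) :
    ∫ x, LinearMap.trace ℝ _ (fderiv ℝ W x : EuclideanSpace ℝ (Fin n) →ₗ[ℝ] _) = 0 := by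
  have hd : Continuous (fderiv ℝ W) := hW.continuous_fderiv (by simp)
  have hcd : HasCompactSupport (fderiv ℝ W) := hc.fderiv ℝ
  have key : ∀ v : EuclideanSpace ℝ (Fin n), ∫ x, ⟪v, fderiv ℝ W x v⟫ = 0 := by
    intro v
    have h1 : ∀ x, fderiv ℝ (fun y => ⟪v, W y⟫) x v = ⟪v, fderiv ℝ W x v⟫ := by
      intro x
      have := ((innerSL ℝ v).hasFDerivAt (x := W x)).comp x
        ((hW.differentiable (by simp)) x).hasFDerivAt
      have h2 := this.fderiv
      simp only [Function.comp_def, innerSL_apply_apply] at h2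
      rw [h2]; simp
    have hi : Integrable (fun x => ⟪v, fderiv ℝ W x v⟫) := by
      apply Continuous.integrable_of_hasCompactSupport (by fun_prop)
      exact hcd.comp_left (g := fun A : EuclideanSpace ℝ (Fin n) →L[ℝ] EuclideanSpace ℝ (Fin n) =>
        ⟪v, A v⟫) (by simp)
    have hi' : Integrable (fun x => ⟪v, W x⟫) := by
      apply Continuous.integrable_of_hasCompactSupport (by have := hW.continuous; fun_prop)
      exact hc.comp_left (g := fun w : EuclideanSpace ℝ (Fin n) => ⟪v, w⟫) (by simp)
    have := integral_mul_fderiv_eq_neg_fderiv_mul_of_integrable (μ := volume)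
      (f := fun _ : EuclideanSpace ℝ (Fin n) => (1 : ℝ)) (g := fun y => ⟪v, W y⟫) (v := v)
      (by simp) (by simpa [h1] using hi) (by simpa using hi') (by simp)
      (fun x _ => ((innerSL ℝ v).differentiable.comp (hW.differentiable (by simp))) x)
    simpa [h1] using this
  have ht : ∀ x, LinearMap.trace ℝ _ (fderiv ℝ W x : EuclideanSpace ℝ (Fin n) →ₗ[ℝ] _) =
      ∑ i, ⟪EuclideanSpace.basisFun (Fin n) ℝ i,
        fderiv ℝ W x (EuclideanSpace.basisFun (Fin n) ℝ i)⟫ := fun x => by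
    rw [LinearMap.trace_eq_sum_inner _ (EuclideanSpace.basisFun (Fin n) ℝ)]; rfl
  simp_rw [ht]
  rw [integral_finsetSum]
  · exact Finset.sum_eq_zero fun i _ => key _
  · intro i _
    apply Continuous.integrable_of_hasCompactSupport (by fun_prop)
    exact hcd.comp_left (g := fun A : EuclideanSpace ℝ (Fin n) →L[ℝ] EuclideanSpace ℝ (Fin n) =>
        ⟪EuclideanSpace.basisFun (Fin n) ℝ i, A (EuclideanSpace.basisFun (Fin n) ℝ i)⟫) (by simp)

theorem trace_smulRight (v w : EuclideanSpace ℝ (Fin n)) :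
    LinearMap.trace ℝ _ (((innerSL ℝ v).smulRight w :
      EuclideanSpace ℝ (Fin n) →L[ℝ] _) : EuclideanSpace ℝ (Fin n) →ₗ[ℝ] _) = ⟪v, w⟫ := by
  rw [LinearMap.trace_eq_sum_inner _ (EuclideanSpace.basisFun (Fin n) ℝ)]
  simp only [ContinuousLinearMap.coe_coe, ContinuousLinearMap.smulRight_apply, inner_smul_right,
    innerSL_apply_apply]
  exact OrthonormalBasis.sum_inner_mul_inner (EuclideanSpace.basisFun (Fin n) ℝ) v w

/-- Completing the square: for a vector field `V` with derivative `V'` near the support of `φ`,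
`∫ |∇φ|² = ∫ |∇φ + φ V|² + ∫ φ² (div V - |V|²)`. -/
theorem IsTestFunction.integral_norm_gradient_sq (h : IsTestFunction Ω φ) (hO : IsOpen O)
    (hφ : tsupport φ ⊆ O) {V : EuclideanSpace ℝ (Fin n) → EuclideanSpace ℝ (Fin n)}
    {V' : EuclideanSpace ℝ (Fin n) → EuclideanSpace ℝ (Fin n) →L[ℝ] EuclideanSpace ℝ (Fin n)}
    (hV : ∀ x ∈ O, HasFDerivAt V (V' x) x) (hV' : ContinuousOn V' O) :
    ∫ x, ‖gradient φ x‖ ^ 2 = (∫ x, ‖gradient φ x + φ x • V x‖ ^ 2) +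
      ∫ x, φ x ^ 2 * (LinearMap.trace ℝ _ (V' x : EuclideanSpace ℝ (Fin n) →ₗ[ℝ] _) -
        ‖V x‖ ^ 2) := by
  have hz := fun x (hx : x ∉ tsupport φ) => image_eq_zero_of_notMem_tsupport hx
  have hz' := fun x (hx : x ∉ tsupport φ) => gradient_eq_zero_of_notMem_tsupport hx
  have hVc : ContinuousOn V O := fun x hx => (hV x hx).continuousAt.continuousWithinAt
  have hVC1 : ContDiffOn ℝ 1 V O := by
    rw [show (1 : WithTop ℕ∞) = 0 + 1 by simp, contDiffOn_succ_iff_fderiv_of_isOpen hO]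
    refine ⟨fun x hx => (hV x hx).differentiableAt.differentiableWithinAt, by simp, ?_⟩
    rw [contDiffOn_zero]
    exact hV'.congr fun x hx => (hV x hx).fderiv
  have htr : Continuous fun A : EuclideanSpace ℝ (Fin n) →L[ℝ] EuclideanSpace ℝ (Fin n) =>
      LinearMap.trace ℝ _ (A : EuclideanSpace ℝ (Fin n) →ₗ[ℝ] _) := by
    have : ∀ A : EuclideanSpace ℝ (Fin n) →L[ℝ] EuclideanSpace ℝ (Fin n),
        LinearMap.trace ℝ _ (A : EuclideanSpace ℝ (Fin n) →ₗ[ℝ] _) =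
        ∑ i, ⟪EuclideanSpace.basisFun (Fin n) ℝ i,
          A (EuclideanSpace.basisFun (Fin n) ℝ i)⟫ := fun A => by
      rw [LinearMap.trace_eq_sum_inner _ (EuclideanSpace.basisFun (Fin n) ℝ)]; rfl
    simp_rw [this]; fun_prop
  -- The divergence of φ²V is φ² div V + 2φ⟨∇φ, V⟩. Its integral vanishes, which removes the cross
  -- term of |∇φ + φV|².
  set W := fun x => φ x ^ 2 • V x with hWdef
  have hW : ContDiff ℝ 1 W := by
    refine contDiff_of_contDiffOn_of_eq_zero hO ?_ (isClosed_tsupport φ) hφ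
      fun x hx => by simp [hWdef, hz x hx]
    exact ((h.1.of_le (by exact_mod_cast le_top)).pow 2).contDiffOn.smul hVC1
  have hWc : HasCompactSupport W := HasCompactSupport.intro h.2.1
    fun x hx => by simp [hWdef, hz x hx]
  have hder : ∀ x, LinearMap.trace ℝ _ (fderiv ℝ W x : EuclideanSpace ℝ (Fin n) →ₗ[ℝ] _) =
      φ x ^ 2 * LinearMap.trace ℝ _ (V' x : EuclideanSpace ℝ (Fin n) →ₗ[ℝ] _) +
        2 * φ x * ⟪gradient φ x, V x⟫ := by
    intro x
    by_cases hx : x ∈ tsupport φ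
    · have hg := hasGradientAt_iff_hasFDerivAt.1 (h.hasGradientAt x)
      have h1 := (hg.pow 2).smul (hV x (hφ hx))
      have h2 : fderiv ℝ W x = φ x ^ 2 • V' x +
          (2 * φ x) • (innerSL ℝ (gradient φ x)).smulRight (V x) := by
        rw [show fderiv ℝ W x = _ from h1.fderiv]
        ext y
        simp [mul_assoc]
      rw [h2]
      simp only [ContinuousLinearMap.toLinearMap_add, ContinuousLinearMap.toLinearMap_smul, map_add, map_smul,
        trace_smulRight, smul_eq_mul]
    · have : fderiv ℝ W x = 0 := image_eq_zero_of_notMem_tsupport fun hx' => hx <| by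
        refine closure_minimal ?_ (isClosed_tsupport φ) (tsupport_fderiv_subset ℝ hx')
        intro y hy
        by_contra hy'
        exact hy (by simp [hWdef, hz y hy'])
      simp [this, hz x hx]
  have hint := integral_trace_fderiv_eq_zero hW hWc
  simp_rw [hder] at hint
  have i1 : Integrable (fun x => φ x ^ 2 *
      LinearMap.trace ℝ _ (V' x : EuclideanSpace ℝ (Fin n) →ₗ[ℝ] _)) :=
    h.integrable hO hφ ((h.continuous.pow 2).continuousOn.mul (htr.comp_continuousOn hV'))
      fun x hx => by simp [hz x hx]
  have i2 : Integrable (fun x => 2 * φ x * ⟪gradient φ x, V x⟫) :=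
    h.integrable hO hφ ((h.continuous.const_mul 2).continuousOn.mul
      (h.continuous_gradient.continuousOn.inner hVc)) fun x hx => by simp [hz x hx]
  have i3 : Integrable (fun x => φ x ^ 2 * ‖V x‖ ^ 2) :=
    h.integrable hO hφ ((h.continuous.pow 2).continuousOn.mul (hVc.norm.pow 2))
      fun x hx => by simp [hz x hx]
  have e1 : ∀ x, ‖gradient φ x + φ x • V x‖ ^ 2 =
      ‖gradient φ x‖ ^ 2 + (2 * φ x * ⟪gradient φ x, V x⟫ + φ x ^ 2 * ‖V x‖ ^ 2) := fun x => by
    rw [norm_add_sq_real, inner_smul_right, norm_smul, mul_pow, Real.norm_eq_abs, sq_abs]; ring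
  simp_rw [e1, mul_sub]
  rw [integral_add h.integrable_norm_gradient_sq (i2.fun_add i3), integral_add i2 i3,
    integral_sub i1 i3]
  rw [integral_add i1 i2] at hint
  linarith

end IntegrationByParts

/-! ### Hardy inequalities from explicit vector fields -/

section HardyFields

variable {n : ℕ} {Ω O : Set (EuclideanSpace ℝ (Fin n))} {φ : EuclideanSpace ℝ (Fin n) → ℝ}

/-- Completing the square for the vector fields `V x = α(⟨ν, x⟩) ν + β(|x|²) x`. -/
theorem IsTestFunction.integral_norm_gradient_sq_field (h : IsTestFunction Ω φ) (hO : IsOpen O)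
    (hφ : tsupport φ ⊆ O) (ν : EuclideanSpace ℝ (Fin n)) {α α' β β' : ℝ → ℝ}
    (hα : ∀ x ∈ O, HasDerivAt α (α' ⟪ν, x⟫) ⟪ν, x⟫)
    (hβ : ∀ x ∈ O, HasDerivAt β (β' (‖x‖ ^ 2)) (‖x‖ ^ 2))
    (hα' : ContinuousOn (fun x => α' ⟪ν, x⟫) O) (hβ' : ContinuousOn (fun x => β' (‖x‖ ^ 2)) O) :
    ∫ x, ‖gradient φ x‖ ^ 2 =
      (∫ x, ‖gradient φ x + φ x • (α ⟪ν, x⟫ • ν + β (‖x‖ ^ 2) • x)‖ ^ 2) +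
      ∫ x, φ x ^ 2 * (α' ⟪ν, x⟫ * ‖ν‖ ^ 2 + n * β (‖x‖ ^ 2) + 2 * β' (‖x‖ ^ 2) * ‖x‖ ^ 2 -
        (α ⟪ν, x⟫ ^ 2 * ‖ν‖ ^ 2 + 2 * α ⟪ν, x⟫ * β (‖x‖ ^ 2) * ⟪ν, x⟫ +
          β (‖x‖ ^ 2) ^ 2 * ‖x‖ ^ 2)) := by
  have hV : ∀ x ∈ O, HasFDerivAt (fun x => α ⟪ν, x⟫ • ν + β (‖x‖ ^ 2) • x)
      (α' ⟪ν, x⟫ • (innerSL ℝ ν).smulRight ν +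
        (β (‖x‖ ^ 2) • ContinuousLinearMap.id ℝ _ +
          (2 * β' (‖x‖ ^ 2)) • (innerSL ℝ x).smulRight x)) x := by
    intro x hx
    have h1 := hasGradientAt_iff_hasFDerivAt.1
      ((hα x hx).comp_hasGradientAt (hasGradientAt_inner_left ν x))
    have h2 := hasGradientAt_iff_hasFDerivAt.1
      (HasDerivAt.comp_hasGradientAt (f := fun y => ‖y‖ ^ 2) (hβ x hx)
        (hasGradientAt_norm_sq x))
    refine ((h1.smul_const ν).add (h2.smul (hasFDerivAt_id x))).congr_fderiv ?_
    ext1 y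
    simp [smul_smul]
    module
  have hc : ContinuousOn (fun x => (α' ⟪ν, x⟫ • (innerSL ℝ ν).smulRight ν +
        (β (‖x‖ ^ 2) • ContinuousLinearMap.id ℝ (EuclideanSpace ℝ (Fin n)) +
          (2 * β' (‖x‖ ^ 2)) • (innerSL ℝ x).smulRight x))) O := by
    have hβc : ContinuousOn (fun x : EuclideanSpace ℝ (Fin n) => β (‖x‖ ^ 2)) O := fun x hx =>
      ((hβ x hx).continuousAt.comp (f := fun x : EuclideanSpace ℝ (Fin n) => ‖x‖ ^ 2)
        (by fun_prop)).continuousWithinAt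
    have hs : Continuous fun x : EuclideanSpace ℝ (Fin n) => (innerSL ℝ x).smulRight x := by
      have : Continuous fun x : EuclideanSpace ℝ (Fin n) =>
          (ContinuousLinearMap.smulRightL ℝ _ (EuclideanSpace ℝ (Fin n)) (innerSL ℝ x)) x := by
        fun_prop
      exact this
    exact (hα'.smul continuousOn_const).add ((hβc.smul continuousOn_const).add
      ((continuousOn_const.mul hβ').smul hs.continuousOn))
  rw [h.integral_norm_gradient_sq hO hφ hV hc]
  congr 2 with x
  have hT : LinearMap.trace ℝ _ ((α' ⟪ν, x⟫ • (innerSL ℝ ν).smulRight ν +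
        (β (‖x‖ ^ 2) • ContinuousLinearMap.id ℝ (EuclideanSpace ℝ (Fin n)) +
          (2 * β' (‖x‖ ^ 2)) • (innerSL ℝ x).smulRight x) : EuclideanSpace ℝ (Fin n) →L[ℝ] _) :
          EuclideanSpace ℝ (Fin n) →ₗ[ℝ] _) =
      α' ⟪ν, x⟫ * ‖ν‖ ^ 2 + n * β (‖x‖ ^ 2) + 2 * β' (‖x‖ ^ 2) * ‖x‖ ^ 2 := by
    have hid : LinearMap.trace ℝ _ ((ContinuousLinearMap.id ℝ (EuclideanSpace ℝ (Fin n))) :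
        EuclideanSpace ℝ (Fin n) →ₗ[ℝ] _) = n := by
      rw [show ((ContinuousLinearMap.id ℝ (EuclideanSpace ℝ (Fin n))) :
        EuclideanSpace ℝ (Fin n) →ₗ[ℝ] _) = LinearMap.id from rfl, LinearMap.trace_id,
        finrank_euclideanSpace_fin]
    simp only [ContinuousLinearMap.toLinearMap_add, ContinuousLinearMap.toLinearMap_smul, map_add,
      map_smul, trace_smulRight, smul_eq_mul, real_inner_self_eq_norm_sq, hid]
    ring
  rw [hT, norm_add_sq_real]
  simp only [norm_smul, mul_pow, inner_smul_left, inner_smul_right, Real.norm_eq_abs, sq_abs,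
    conj_trivial]
  ring

/-- The ground state representation for the weight `|x|^(-s)`. -/
theorem IsTestFunction.integral_norm_gradient_sq_power (h : IsTestFunction Ω φ)
    (h0 : 0 ∉ tsupport φ) (s : ℝ) :
    ∫ x, ‖gradient φ x‖ ^ 2 = (∫ x, ‖gradient φ x + φ x • (s / ‖x‖ ^ 2) • x‖ ^ 2) +
      s * (n - 2 - s) * ∫ x, φ x ^ 2 / ‖x‖ ^ 2 := by
  have hpos : ∀ x : EuclideanSpace ℝ (Fin n), x ∈ ({0}ᶜ : Set _) → ‖x‖ ^ 2 ≠ 0 := fun x hx =>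
    pow_ne_zero 2 (norm_ne_zero_iff.2 hx)
  have := h.integral_norm_gradient_sq_field isOpen_compl_singleton (O := {0}ᶜ)
    (fun x hx h => h0 (h ▸ hx)) 0 (α := fun _ => 0) (α' := fun _ => 0)
    (β := fun t => s / t) (β' := fun t => -s / t ^ 2)
    (fun x hx => hasDerivAt_const _ _)
    (fun x hx => by
      have := (hasDerivAt_inv (hpos x hx)).const_mul s
      simpa [div_eq_mul_inv] using this) continuousOn_const
    (ContinuousOn.div continuousOn_const (by fun_prop) fun x hx => pow_ne_zero 2 (hpos x hx))
  rw [this, ← integral_const_mul]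
  congr 1
  · simp
  · refine integral_congr_ae (ae_of_all _ fun x => ?_)
    by_cases hx : x = 0
    · have : φ 0 = 0 := image_eq_zero_of_notMem_tsupport h0
      simp [hx, this]
    · have := hpos x hx
      simp only [inner_zero_left, norm_zero]
      field_simp
      ring

/-- The field is -∇ log of the ground state ⟨ν, x⟩ |x|^(-n/2). The terms ‖ν‖² / ⟨ν, x⟩² from its
divergence and from its square cancel, so ν need not be a unit vector, and exactly n²/4 · |x|⁻²
remains. -/
theorem IsTestFunction.integral_norm_gradient_sq_halfSpace (h : IsTestFunction Ω φ)
    {ν : EuclideanSpace ℝ (Fin n)} (hφ : tsupport φ ⊆ {x | 0 < ⟪ν, x⟫}) :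
    ∫ x, ‖gradient φ x‖ ^ 2 =
      (∫ x, ‖gradient φ x + φ x • ((-⟪ν, x⟫⁻¹) • ν + (n / 2 / ‖x‖ ^ 2) • x)‖ ^ 2) +
      (n : ℝ) ^ 2 / 4 * ∫ x, φ x ^ 2 / ‖x‖ ^ 2 := by
  have hpos : ∀ x : EuclideanSpace ℝ (Fin n), x ∈ {x | 0 < ⟪ν, x⟫} → ‖x‖ ^ 2 ≠ 0 := fun x hx =>
    pow_ne_zero 2 (norm_ne_zero_iff.2 fun h => by simp [h] at hx)
  have hne : ∀ x : EuclideanSpace ℝ (Fin n), x ∈ {x | 0 < ⟪ν, x⟫} → ⟪ν, x⟫ ≠ 0 :=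
    fun x hx => ne_of_gt hx
  have hci : Continuous fun x : EuclideanSpace ℝ (Fin n) => ⟪ν, x⟫ := by fun_prop
  have := h.integral_norm_gradient_sq_field (O := {x | 0 < ⟪ν, x⟫})
    (isOpen_lt continuous_const hci) hφ ν (α := fun t => -t⁻¹) (α' := fun t => (t ^ 2)⁻¹)
    (β := fun t => n / 2 / t) (β' := fun t => -(n / 2) / t ^ 2)
    (fun x hx => by simpa using (hasDerivAt_inv (hne x hx)).fun_neg)
    (fun x hx => by
      have := (hasDerivAt_inv (hpos x hx)).const_mul ((n : ℝ) / 2)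
      simpa [div_eq_mul_inv] using this)
    (ContinuousOn.inv₀ (hci.pow 2).continuousOn fun x hx => pow_ne_zero 2 (hne x hx))
    (ContinuousOn.div continuousOn_const (by fun_prop) fun x hx => pow_ne_zero 2 (hpos x hx))
  rw [this, ← integral_const_mul]
  congr 1
  refine integral_congr_ae (ae_of_all _ fun x => ?_)
  by_cases hx : x ∈ tsupport φ
  · have h1 := hpos x (hφ hx)
    have h2 := hne x (hφ hx)
    field_simp
    ring
  · simp [image_eq_zero_of_notMem_tsupport hx]

theorem IsTestFunction.hardy_halfSpace [NeZero n] (h : IsTestFunction Ω φ)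
    {ν : EuclideanSpace ℝ (Fin n)} (hφ : tsupport φ ⊆ {x | 0 < ⟪ν, x⟫}) :
    ENNReal.ofReal ((n : ℝ) ^ 2 / 4) * hardyEnergy φ ≤ dirichletEnergy φ := by
  have h0 : 0 ∉ tsupport φ := fun h => by simpa using hφ h
  rw [h.mul_hardyEnergy_le_iff h0 (by positivity), h.integral_norm_gradient_sq_halfSpace hφ]
  have := integral_nonneg (μ := volume) (f := fun x => ‖gradient φ x + φ x • ((-⟪ν, x⟫⁻¹) • ν +
    ((n : ℝ) / 2 / ‖x‖ ^ 2) • x)‖ ^ 2) fun x => by positivity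
  linarith

/-- A regularised Hardy inequality with remainder. -/
theorem IsTestFunction.hardy_regularized (hn : 2 ≤ n) (h : IsTestFunction Ω φ) {ε : ℝ}
    (hε : 0 < ε) {b : ℝ} (hb : 0 ≤ b) :
    ∫ x, φ x ^ 2 * (((n : ℝ) - 2) ^ 2 / 4 / (‖x‖ ^ 2 + ε) + (2 * b - b ^ 2 * ‖x‖ ^ 2)) ≤
      ∫ x, ‖gradient φ x‖ ^ 2 := by
  have hpos : ∀ x : EuclideanSpace ℝ (Fin n), ‖x‖ ^ 2 + ε ≠ 0 := fun x => by positivity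
  have hc : Continuous fun x : EuclideanSpace ℝ (Fin n) => (‖x‖ ^ 2 + ε)⁻¹ :=
    Continuous.inv₀ (by fun_prop) hpos
  have hn' : (2 : ℝ) ≤ n := by exact_mod_cast hn
  set a : ℝ := ((n : ℝ) - 2) / 2 with ha
  -- The field is a x/(|x|² + ε) + b x with a = (n-2)/2. It is smooth at the origin, so the support
  -- of φ may contain 0.
  have := h.integral_norm_gradient_sq_field isOpen_univ (Set.subset_univ _)
    0 (α := fun _ => 0) (α' := fun _ => 0)
    (β := fun t => a * (t + ε)⁻¹ + b) (β' := fun t => a * (-(t + ε)⁻¹ ^ 2))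
    (fun x hx => hasDerivAt_const _ _)
    (fun x hx => by
      have h1 : HasDerivAt (fun t : ℝ => t + ε) 1 (‖x‖ ^ 2) := (hasDerivAt_id _).add_const ε
      have := ((h1.inv (hpos x)).const_mul a).add_const b
      simpa [neg_div] using this) continuousOn_const
    (continuous_const.mul (hc.pow 2).neg).continuousOn
  rw [this]
  refine le_trans ?_ (le_add_of_nonneg_left (integral_nonneg fun x => by positivity))
  have hz := fun x (hx : x ∉ tsupport φ) => image_eq_zero_of_notMem_tsupport hx
  have hφc := h.continuous
  refine integral_mono (h.integrable isOpen_univ (Set.subset_univ _) ?_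
    fun x hx => by simp [hz x hx])
    (h.integrable isOpen_univ (Set.subset_univ _) ?_ fun x hx => by simp [hz x hx]) fun x => ?_
  · simp_rw [div_eq_mul_inv _ (_ + ε)]; fun_prop
  · fun_prop
  · refine mul_le_mul_of_nonneg_left ?_ (by positivity)
    simp only [inner_zero_left, norm_zero]
    set r := ‖x‖ ^ 2 with hr
    have hr0 : 0 ≤ r := by positivity
    set y := (r + ε)⁻¹ with hy
    have hy0 : 0 < y := by positivity
    have hry : r * y ≤ 1 := by
      rw [hy, ← div_eq_mul_inv, div_le_one (by positivity)]; linarith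
    have hna : (n : ℝ) = 2 * a + 2 := by rw [ha]; ring
    have ha0 : 0 ≤ a := by rw [ha]; linarith
    rw [div_eq_mul_inv _ (r + ε), ← hy, show ((n : ℝ) - 2) ^ 2 / 4 = a ^ 2 by rw [ha]; ring, hna]
    -- The surplus of div V - |V|² over the claimed weight is 2ay(1-ry) + a²y(1-ry) + 2ab(1-ry).
    have h1 : 0 ≤ a * y * (1 - r * y) := mul_nonneg (by positivity) (by linarith)
    have h2 : 0 ≤ a ^ 2 * y * (1 - r * y) := mul_nonneg (by positivity) (by linarith)
    have h3 : 0 ≤ a * b * (1 - r * y) := mul_nonneg (by positivity) (by linarith)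
    nlinarith

/-- The Hardy inequality on `ℝⁿ`. -/
theorem IsTestFunction.hardy [NeZero n] (hn : 2 ≤ n) (h : IsTestFunction Ω φ) :
    ENNReal.ofReal (((n : ℝ) - 2) ^ 2 / 4) * hardyEnergy φ ≤ dirichletEnergy φ := by
  have hlim : ∀ᵐ x : EuclideanSpace ℝ (Fin n), Tendsto (fun k : ℕ =>
      ENNReal.ofReal (φ x ^ 2 * (((n : ℝ) - 2) ^ 2 / 4 / (‖x‖ ^ 2 + 1 / ((k : ℝ) + 1))))) atTop
      (𝓝 (ENNReal.ofReal (((n : ℝ) - 2) ^ 2 / 4) * ENNReal.ofReal (φ x ^ 2 / ‖x‖ ^ 2))) := by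
    filter_upwards [Measure.ae_ne volume 0] with x hx
    have hx' : ‖x‖ ^ 2 ≠ 0 := pow_ne_zero 2 (norm_ne_zero_iff.2 hx)
    rw [← ENNReal.ofReal_mul (by positivity)]
    refine ENNReal.tendsto_ofReal ?_
    have h1 : Tendsto (fun k : ℕ => ‖x‖ ^ 2 + 1 / ((k : ℝ) + 1)) atTop (𝓝 (‖x‖ ^ 2 + 0)) :=
      tendsto_const_nhds.add tendsto_one_div_add_atTop_nhds_zero_nat
    rw [add_zero] at h1
    have := ((tendsto_const_nhds (x := ((n : ℝ) - 2) ^ 2 / 4)).div h1 hx').const_mul (φ x ^ 2)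
    rw [mul_div_left_comm] 
    exact this
  rw [hardyEnergy_eq_lintegral_ofReal, ← lintegral_const_mul' _ _ ENNReal.ofReal_ne_top,
    h.dirichletEnergy_eq]
  -- Fatou's lemma for the regularised inequalities with ε = 1/(k+1) and b = 0.
  calc _ = ∫⁻ x, liminf (fun k : ℕ => ENNReal.ofReal (φ x ^ 2 *
        (((n : ℝ) - 2) ^ 2 / 4 / (‖x‖ ^ 2 + 1 / ((k : ℝ) + 1))))) atTop :=
        lintegral_congr_ae (hlim.mono fun x hx => hx.liminf_eq.symm)
    _ ≤ liminf (fun k : ℕ => ∫⁻ x, ENNReal.ofReal (φ x ^ 2 *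
        (((n : ℝ) - 2) ^ 2 / 4 / (‖x‖ ^ 2 + 1 / ((k : ℝ) + 1))))) atTop := by
        refine lintegral_liminf_le fun k => ?_
        have := h.continuous.measurable
        fun_prop
    _ ≤ liminf (fun k : ℕ => ENNReal.ofReal (∫ x, ‖gradient φ x‖ ^ 2)) atTop := by
        refine liminf_le_liminf (Eventually.of_forall fun k => ?_)
        have hk : (0 : ℝ) < 1 / ((k : ℝ) + 1) := by positivity
        have := h.hardy_regularized hn hk le_rfl
        simp only [mul_zero, ne_eq, OfNat.ofNat_ne_zero, not_false_eq_true, zero_pow, zero_mul,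
          sub_zero, add_zero] at this
        rw [← ofReal_integral_eq_lintegral_ofReal]
        · exact ENNReal.ofReal_le_ofReal this
        · refine h.integrable isOpen_univ (Set.subset_univ _) ?_
            fun x hx => by simp [image_eq_zero_of_notMem_tsupport hx]
          have hφc := h.continuous
          have hc : Continuous fun x : EuclideanSpace ℝ (Fin n) =>
              ((n : ℝ) - 2) ^ 2 / 4 / (‖x‖ ^ 2 + 1 / ((k : ℝ) + 1)) :=
            Continuous.div (by fun_prop) (by fun_prop) fun x => by positivity
          fun_prop
        · exact ae_of_all _ fun x => by positivity
    _ = _ := by simp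

/-- The Hardy inequality with remainder on a ball. -/
theorem IsTestFunction.hardy_remainder (hn : 2 ≤ n) (h : IsTestFunction Ω φ) (h0 : 0 ∉ tsupport φ)
    {R : ℝ} (hR : 0 < R) (hφ : tsupport φ ⊆ Metric.closedBall 0 R) :
    ((n : ℝ) - 2) ^ 2 / 4 * (∫ x, φ x ^ 2 / ‖x‖ ^ 2) + R⁻¹ ^ 2 * ∫ x, φ x ^ 2 ≤
      ∫ x, ‖gradient φ x‖ ^ 2 := by
  have hpos : ∀ x : EuclideanSpace ℝ (Fin n), x ∈ ({0}ᶜ : Set _) → ‖x‖ ^ 2 ≠ 0 := fun x hx =>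
    pow_ne_zero 2 (norm_ne_zero_iff.2 hx)
  have hn' : (2 : ℝ) ≤ n := by exact_mod_cast hn
  set a : ℝ := ((n : ℝ) - 2) / 2 with ha
  -- To the critical field a x/|x|² the term b x with b = R⁻² is added. It gains 2b - b²|x|², which
  -- is at least b on the ball of radius R.
  have := h.integral_norm_gradient_sq_field isOpen_compl_singleton (O := {0}ᶜ)
    (fun x hx h => h0 (h ▸ hx))
    0 (α := fun _ => 0) (α' := fun _ => 0)
    (β := fun t => a * t⁻¹ + R⁻¹ ^ 2) (β' := fun t => a * (-t⁻¹ ^ 2))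
    (fun x hx => hasDerivAt_const _ _)
    (fun x hx => by
      have := ((hasDerivAt_inv (hpos x hx)).const_mul a).add_const (R⁻¹ ^ 2)
      simpa using this) continuousOn_const
    (continuousOn_const.mul ((((continuous_norm.pow 2).continuousOn.inv₀ hpos).pow 2).neg))
  rw [this, ← integral_const_mul, ← integral_const_mul,
    ← integral_add ((h.integrable_sq_div h0).const_mul _) (h.integrable_sq.const_mul _)]
  refine le_trans ?_ (le_add_of_nonneg_left (integral_nonneg fun x => by positivity))
  have hz := fun x (hx : x ∉ tsupport φ) => image_eq_zero_of_notMem_tsupport hx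
  refine integral_mono (((h.integrable_sq_div h0).const_mul _).add (h.integrable_sq.const_mul _))
    (h.integrable isOpen_compl_singleton (O := {0}ᶜ) (fun x hx h => h0 (h ▸ hx)) ?_
      fun x hx => by simp [hz x hx]) fun x => ?_
  · have hφc := h.continuous
    have hc : ContinuousOn (fun x : EuclideanSpace ℝ (Fin n) => (‖x‖ ^ 2)⁻¹) {0}ᶜ :=
      (continuous_norm.pow 2).continuousOn.inv₀ hpos
    fun_prop
  · by_cases hx : x ∈ tsupport φ
    · have hx0 := hpos x fun h => h0 (h ▸ hx)
      have hxR : ‖x‖ ≤ R := by simpa using hφ hx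
      have hr : ‖x‖ ^ 2 * R⁻¹ ^ 2 ≤ 1 := by
        rw [← mul_pow]
        refine pow_le_one₀ (by positivity) ?_
        rwa [← div_eq_mul_inv, div_le_one hR]
      simp only [inner_zero_left, norm_zero]
      have hna : (n : ℝ) = 2 * a + 2 := by rw [ha]; ring
      rw [show ((n : ℝ) - 2) ^ 2 / 4 = a ^ 2 by rw [ha]; ring, hna, div_eq_mul_inv]
      set y := (‖x‖ ^ 2)⁻¹ with hy
      have hyx : ‖x‖ ^ 2 * y = 1 := mul_inv_cancel₀ hx0
      set r := ‖x‖ ^ 2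
      set b := R⁻¹ ^ 2
      have hb : 0 ≤ b := by positivity
      have e : (0 * 0 ^ 2 + (2 * a + 2) * (a * y + b) + 2 * (a * -y ^ 2) * r -
          (0 ^ 2 * 0 ^ 2 + 2 * 0 * (a * y + b) * 0 + (a * y + b) ^ 2 * r)) =
          a ^ 2 * y + b + b * (1 - r * b) := by
        linear_combination (-2 * a * y - a ^ 2 * y - 2 * a * b) * hyx
      rw [e]
      have : 0 ≤ φ x ^ 2 * (b * (1 - r * b)) :=
        mul_nonneg (by positivity) (mul_nonneg hb (by linarith))
      linarith
    · simp [hz x hx]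

end HardyFields

/-! ### From D^{1,2} to test functions -/

section Reduction

theorem eLpNorm_two_sq {X G : Type*} [MeasurableSpace X] {μ : Measure X} [NormedAddCommGroup G]
    (f : X → G) : eLpNorm f 2 μ ^ 2 = ∫⁻ x, ‖f x‖ₑ ^ 2 ∂μ := by
  have := eLpNorm_nnreal_pow_eq_lintegral (μ := μ) (f := f) (p := 2) two_ne_zero
  simpa using this

variable {n : ℕ} {Ω : Set (EuclideanSpace ℝ (Fin n))} {φ u : EuclideanSpace ℝ (Fin n) → ℝ}
  {g : EuclideanSpace ℝ (Fin n) → EuclideanSpace ℝ (Fin n)}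

theorem IsTestFunction.eq_zero_of_notMem (h : IsTestFunction Ω φ) {x : EuclideanSpace ℝ (Fin n)}
    (hx : x ∉ Ω) : φ x = 0 := image_eq_zero_of_notMem_tsupport fun h' => hx (h.2.2 h')

theorem IsTestFunction.gradient_eq_zero_of_notMem (h : IsTestFunction Ω φ)
    {x : EuclideanSpace ℝ (Fin n)} (hx : x ∉ Ω) : gradient φ x = 0 :=
  gradient_eq_zero_of_notMem_tsupport fun h' => hx (h.2.2 h')

theorem setLIntegral_eq_lintegral_of_eq_zero {X : Type*} [MeasurableSpace X] {μ : Measure X}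
    {s : Set X} (hs : MeasurableSet s) {f : X → ℝ≥0∞} (hf : ∀ x ∉ s, f x = 0) :
    ∫⁻ x in s, f x ∂μ = ∫⁻ x, f x ∂μ := by
  rw [← lintegral_indicator hs]
  congr 1
  exact Set.indicator_eq_self.2 fun x hx => by_contra fun h => hx (hf x h)

theorem IsTestFunction.setLIntegral_gradient (h : IsTestFunction Ω φ) (hΩ : IsOpen Ω) :
    ∫⁻ x in Ω, ‖gradient φ x‖ₑ ^ 2 = dirichletEnergy φ :=
  setLIntegral_eq_lintegral_of_eq_zero hΩ.measurableSet
    fun x hx => by simp [h.gradient_eq_zero_of_notMem hx]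

theorem IsTestFunction.setLIntegral_hardy (h : IsTestFunction Ω φ) (hΩ : IsOpen Ω) :
    ∫⁻ x in Ω, ‖φ x‖ₑ ^ 2 / ‖x‖ₑ ^ 2 = hardyEnergy φ :=
  setLIntegral_eq_lintegral_of_eq_zero hΩ.measurableSet
    fun x hx => by simp [h.eq_zero_of_notMem hx]

theorem IsTestFunction.memD12 (h : IsTestFunction Ω φ) : MemD12 Ω φ (gradient φ) where
  memLp_fun := h.continuous.memLp_of_hasCompactSupport h.2.1
  memLp_grad := h.continuous_gradient.memLp_of_hasCompactSupport h.hasCompactSupport_gradient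
  exists_approx := ⟨fun _ => φ, fun _ => h, by simp, by simp⟩

theorem sobolevExponent_pos (hn : 3 ≤ n) : sobolevExponent n ≠ 0 := by
  have : (3 : ℝ) ≤ n := by exact_mod_cast hn
  rw [sobolevExponent, Ne, ENNReal.ofReal_eq_zero, not_le]
  exact div_pos (by linarith) (by linarith)

/-- An inequality between the two energies passes from test functions to `D^{1,2}`. -/
theorem MemD12.hardy (hn : 3 ≤ n) (hΩ : IsOpen Ω) (h : MemD12 Ω u g) {C : ℝ≥0∞} (hC : C ≠ ⊤)
    (hφ : ∀ φ, IsTestFunction Ω φ → C * hardyEnergy φ ≤ dirichletEnergy φ) :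
    C * ∫⁻ x in Ω, ‖u x‖ₑ ^ 2 / ‖x‖ₑ ^ 2 ≤ ∫⁻ x in Ω, ‖g x‖ₑ ^ 2 := by
  have : NeZero n := ⟨by omega⟩
  obtain ⟨φ, ht, hu, hg⟩ := h.exists_approx
  obtain ⟨ns, hns, hae⟩ := (tendstoInMeasure_of_tendsto_eLpNorm (sobolevExponent_pos hn)
    (fun k => (ht k).continuous.aestronglyMeasurable) h.memLp_fun.1 hu).exists_seq_tendsto_ae
  have hlim : Tendsto (fun k => (eLpNorm (gradient (φ (ns k)) - g) 2 volume +
      eLpNorm g 2 (volume.restrict Ω)) ^ 2) atTop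
      (𝓝 ((0 + eLpNorm g 2 (volume.restrict Ω)) ^ 2)) :=
    ((ENNReal.continuous_pow 2).tendsto _).comp
      ((hg.comp hns.tendsto_atTop).add tendsto_const_nhds)
  rw [← lintegral_const_mul' _ _ hC]
  calc ∫⁻ x in Ω, C * (‖u x‖ₑ ^ 2 / ‖x‖ₑ ^ 2)
      -- The Sobolev-norm limit only provides almost everywhere convergence along a subsequence.
      -- That suffices, because Fatou's lemma needs no convergence of the Hardy integrals.
      = ∫⁻ x in Ω, liminf (fun k => C * (‖φ (ns k) x‖ₑ ^ 2 / ‖x‖ₑ ^ 2)) atTop := by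
        refine lintegral_congr_ae ?_
        filter_upwards [ae_restrict_of_ae hae, ae_restrict_of_ae (Measure.ae_ne volume 0)]
          with x hx hx0
        refine (Tendsto.liminf_eq ?_).symm
        have h1 : Tendsto (fun k => ‖φ (ns k) x‖ₑ ^ 2) atTop (𝓝 (‖u x‖ₑ ^ 2)) :=
          ((ENNReal.continuous_pow 2).tendsto _).comp ((continuous_enorm.tendsto _).comp hx)
        exact ENNReal.Tendsto.const_mul (ENNReal.Tendsto.div_const h1 (Or.inr (by simpa)))
          (Or.inr hC)
    _ ≤ liminf (fun k => ∫⁻ x in Ω, C * (‖φ (ns k) x‖ₑ ^ 2 / ‖x‖ₑ ^ 2)) atTop := by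
        refine lintegral_liminf_le fun k => ?_
        have := (ht (ns k)).continuous.measurable
        fun_prop
    _ ≤ liminf (fun k => (eLpNorm (gradient (φ (ns k)) - g) 2 volume +
      eLpNorm g 2 (volume.restrict Ω)) ^ 2) atTop := by
        refine liminf_le_liminf (Eventually.of_forall fun k => ?_)
        beta_reduce
        rw [lintegral_const_mul' _ _ hC, (ht (ns k)).setLIntegral_hardy hΩ]
        refine (hφ _ (ht (ns k))).trans ?_
        rw [← (ht (ns k)).setLIntegral_gradient hΩ, ← eLpNorm_two_sq]
        gcongr
        calc eLpNorm (gradient (φ (ns k))) 2 (volume.restrict Ω)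
            = eLpNorm ((gradient (φ (ns k)) - g) + g) 2 (volume.restrict Ω) := by simp
          _ ≤ _ := (eLpNorm_add_le
              ((ht (ns k)).continuous_gradient.aestronglyMeasurable.sub
                h.memLp_grad.1.restrict) h.memLp_grad.1.restrict (by norm_num)).trans
              (by gcongr; exact Measure.restrict_le_self)
    _ = _ := by rw [hlim.liminf_eq, zero_add, eLpNorm_two_sq]

theorem MemD12.ae_eq_zero_compl (hn : 3 ≤ n) (hΩ : IsOpen Ω) (h : MemD12 Ω u g) :
    ∀ᵐ x ∂volume.restrict Ωᶜ, u x = 0 := by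
  obtain ⟨φ, ht, hu, hg⟩ := h.exists_approx
  have h0 : eLpNorm u (sobolevExponent n) (volume.restrict Ωᶜ) = 0 := by
    refine le_antisymm (ge_of_tendsto' hu fun k => ?_) bot_le
    refine le_trans (le_of_eq ?_) (eLpNorm_mono_measure _ (Measure.restrict_le_self (s := Ωᶜ)))
    rw [← eLpNorm_neg]
    refine eLpNorm_congr_ae ?_
    filter_upwards [ae_restrict_mem hΩ.measurableSet.compl] with x hx
    simp [(ht k).eq_zero_of_notMem hx]
  exact (eLpNorm_eq_zero_iff h.memLp_fun.1.restrict (sobolevExponent_pos hn)).1 h0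

/-- A limit of test functions vanishes almost everywhere off Ω, so a zero Hardy integral over Ω
forces u = 0 everywhere up to a null set. This keeps the denominator of the Hardy quotient from
vanishing. -/
theorem MemD12.setLIntegral_ne_zero (hn : 3 ≤ n) (hΩ : IsOpen Ω) (h : MemD12 Ω u g)
    (hu : ¬ u =ᵐ[volume] 0) : ∫⁻ x in Ω, ‖u x‖ₑ ^ 2 / ‖x‖ₑ ^ 2 ≠ 0 := by
  intro h0
  apply hu
  have h1 : AEMeasurable (fun x => ‖u x‖ₑ ^ 2 / ‖x‖ₑ ^ 2) (volume.restrict Ω) := by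
    have := h.memLp_fun.1.restrict.aemeasurable (μ := volume.restrict Ω)
    fun_prop
  rw [lintegral_eq_zero_iff' h1] at h0
  refine ae_of_ae_restrict_of_ae_restrict_compl Ω ?_ (h.ae_eq_zero_compl hn hΩ)
  filter_upwards [h0] with x hx
  simpa [ENNReal.div_eq_zero_iff] using hx

theorem hardyEnergy_ne_zero (hφ : Continuous φ) {x : EuclideanSpace ℝ (Fin n)} (hx : φ x ≠ 0) :
    hardyEnergy φ ≠ 0 := by
  intro h0
  have h1 : Measurable (fun x => ‖φ x‖ₑ ^ 2 / ‖x‖ₑ ^ 2) := by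
    have := hφ.measurable
    fun_prop
  rw [hardyEnergy, lintegral_eq_zero_iff h1] at h0
  have h2 : φ =ᵐ[volume] fun _ => 0 := by
    filter_upwards [h0] with x hx
    simpa [ENNReal.div_eq_zero_iff] using hx
  exact hx (congrFun ((hφ.ae_eq_iff_eq volume continuous_const).1 h2) x)

theorem hardyEnergy_eq_zero (hφ : φ = 0) : hardyEnergy φ = 0 := by
  subst hφ; simp [hardyEnergy]

/-- The Hardy constant is determined by test functions. -/
theorem le_hardyConstant_iff (hn : 3 ≤ n) (hΩ : IsOpen Ω) {C : ℝ≥0∞} (hC : C ≠ ⊤) :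
    C ≤ hardyConstant Ω ↔ ∀ φ, IsTestFunction Ω φ → C * hardyEnergy φ ≤ dirichletEnergy φ := by
  constructor
  · intro h φ hφ
    by_cases h0 : φ = 0
    · simp [hardyEnergy_eq_zero h0]
    · obtain ⟨x, hx⟩ := Function.ne_iff.1 h0
      have hne : ¬ φ =ᵐ[volume] 0 := fun hc =>
        h0 ((hφ.continuous.ae_eq_iff_eq volume continuous_const).1 hc)
      have h1 : C ≤ hardyQuotient Ω φ (gradient φ) :=
        h.trans (sInf_le ⟨φ, _, hφ.memD12, hne, rfl⟩)
      rw [hardyQuotient, hφ.setLIntegral_gradient hΩ, hφ.setLIntegral_hardy hΩ,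
        ENNReal.le_div_iff_mul_le (Or.inl (hardyEnergy_ne_zero hφ.continuous hx))
        (Or.inr (by rw [hφ.dirichletEnergy_eq]; exact ENNReal.ofReal_ne_top))] at h1
      exact h1
  · rintro h
    refine le_sInf ?_
    rintro _ ⟨u, g, hu, hne, rfl⟩
    rw [hardyQuotient, ENNReal.le_div_iff_mul_le (Or.inl (hu.setLIntegral_ne_zero hn hΩ hne))]
    · exact hu.hardy hn hΩ hC h
    · right
      rw [← eLpNorm_two_sq]
      exact ENNReal.pow_ne_top (hu.memLp_grad.restrict Ω).eLpNorm_ne_top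

theorem hardyConstant_lt (hn : 3 ≤ n) (hΩ : IsOpen Ω) {C : ℝ≥0∞} (hC : C ≠ ⊤)
    (h : IsTestFunction Ω φ) (hφ : dirichletEnergy φ < C * hardyEnergy φ) :
    hardyConstant Ω < C := by
  rw [← not_le, le_hardyConstant_iff hn hΩ hC]
  exact fun h' => (h' φ h).not_gt hφ

theorem exists_isTestFunction_of_hardyConstant_lt (hn : 3 ≤ n) (hΩ : IsOpen Ω) {C : ℝ≥0∞}
    (hC : C ≠ ⊤) (h : hardyConstant Ω < C) :
    ∃ φ, IsTestFunction Ω φ ∧ dirichletEnergy φ < C * hardyEnergy φ := by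
  rw [← not_le, le_hardyConstant_iff hn hΩ hC] at h
  push Not at h
  exact h

theorem hardyConstant_ge (hn : 3 ≤ n) (hΩ : IsOpen Ω) :
    ENNReal.ofReal (((n : ℝ) - 2) ^ 2 / 4) ≤ hardyConstant Ω := by
  have : NeZero n := ⟨by omega⟩
  rw [le_hardyConstant_iff hn hΩ ENNReal.ofReal_ne_top]
  exact fun φ hφ => hφ.hardy (by omega)

end Reduction

/-! ### One-dimensional cutoffs -/

section Cutoffs

theorem tsupport_subset_of_eq_zero {X G : Type*} [TopologicalSpace X] [Zero G] {f : X → G}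
    {K : Set X} (hK : IsClosed K) (h0 : ∀ x ∉ K, f x = 0) : tsupport f ⊆ K :=
  closure_minimal (fun y hy => by_contra fun h => Function.mem_support.1 hy (h0 y h)) hK

theorem deriv_smoothTransition_eq_zero {t : ℝ} (ht : t < 0 ∨ 1 < t) :
    deriv Real.smoothTransition t = 0 := by
  rcases ht with ht | ht
  · have : Real.smoothTransition =ᶠ[𝓝 t] fun _ => 0 := by
      filter_upwards [Iio_mem_nhds ht] with s hs
      exact Real.smoothTransition.zero_of_nonpos (le_of_lt hs)
    rw [this.deriv_eq, deriv_const]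
  · have : Real.smoothTransition =ᶠ[𝓝 t] fun _ => 1 := by
      filter_upwards [Ioi_mem_nhds ht] with s hs
      exact Real.smoothTransition.one_of_one_le (le_of_lt hs)
    rw [this.deriv_eq, deriv_const]

theorem exists_abs_deriv_smoothTransition_le :
    ∃ D, 0 ≤ D ∧ ∀ t, |deriv Real.smoothTransition t| ≤ D := by
  have hc : Continuous (deriv Real.smoothTransition) :=
    (Real.smoothTransition.contDiff (n := 1)).continuous_deriv le_rfl
  obtain ⟨D, hD⟩ := isCompact_Icc.exists_bound_of_continuousOn (s := Set.Icc (0 : ℝ) 1)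
    hc.continuousOn
  refine ⟨D, (norm_nonneg _).trans (hD 0 (by simp)), fun t => ?_⟩
  by_cases ht : t ∈ Set.Icc (0 : ℝ) 1
  · exact hD t ht
  · rw [deriv_smoothTransition_eq_zero, abs_zero]
    · exact (norm_nonneg _).trans (hD 0 (by simp))
    · by_contra! h
      exact ht ⟨h.1, h.2⟩

theorem hasDerivAt_smoothTransition (t : ℝ) :
    HasDerivAt Real.smoothTransition (deriv Real.smoothTransition t) t :=
  ((Real.smoothTransition.contDiff (n := 1)).differentiable (by simp) t).hasDerivAt

/-- A smooth cutoff that vanishes for `t ≤ 1/m` and equals `1` for `t ≥ 2/m`. -/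
noncomputable def cutoffAbove (m t : ℝ) : ℝ := Real.smoothTransition (m * t - 1)

theorem contDiff_cutoffAbove (m : ℝ) : ContDiff ℝ ∞ (cutoffAbove m) :=
  Real.smoothTransition.contDiff.comp (by fun_prop)

theorem cutoffAbove_eq_zero {m t : ℝ} (h : m * t ≤ 1) : cutoffAbove m t = 0 :=
  Real.smoothTransition.zero_of_nonpos (by linarith)

theorem cutoffAbove_eq_one {m t : ℝ} (h : 2 ≤ m * t) : cutoffAbove m t = 1 :=
  Real.smoothTransition.one_of_one_le (by linarith)

theorem hasDerivAt_cutoffAbove (m t : ℝ) :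
    HasDerivAt (cutoffAbove m) (m * deriv Real.smoothTransition (m * t - 1)) t := by
  have h1 : HasDerivAt (fun t => m * t - 1) m t := by
    simpa using ((hasDerivAt_id t).const_mul m).sub_const 1
  have := (hasDerivAt_smoothTransition (m * t - 1)).comp t h1
  rw [mul_comm]; exact this

/-- The derivative is of size m but lives where 1 ≤ m t ≤ 2, so multiplication by t gives a bound
independent of m. A ground state vanishing linearly on the boundary can therefore be cut off there.
-/
theorem abs_mul_deriv_cutoffAbove_le {D : ℝ} (hD : ∀ t, |deriv Real.smoothTransition t| ≤ D)
    (m t : ℝ) : |t * (m * deriv Real.smoothTransition (m * t - 1))| ≤ 2 * D := by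
  have hD0 : 0 ≤ D := (abs_nonneg _).trans (hD 0)
  by_cases h : m * t - 1 < 0 ∨ 1 < m * t - 1
  · rw [deriv_smoothTransition_eq_zero h]; simpa using hD0
  · push Not at h
    rw [← mul_assoc, abs_mul]
    gcongr
    · rw [abs_le]; constructor <;> nlinarith
    · exact hD _

end Cutoffs

/-! ### Power weights and logarithmic cutoffs -/

section Weights

variable {n : ℕ}

/-- The weight `|x|^(-s)`. -/
noncomputable def powWeight (s : ℝ) (x : EuclideanSpace ℝ (Fin n)) : ℝ := (‖x‖ ^ 2) ^ (-s / 2)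

theorem powWeight_sq (s : ℝ) (x : EuclideanSpace ℝ (Fin n)) :
    powWeight s x ^ 2 = (‖x‖ ^ 2) ^ (-s) := by
  rw [powWeight, ← Real.rpow_natCast, ← Real.rpow_mul (by positivity)]
  congr 1
  push_cast; ring

theorem contDiffOn_powWeight (s : ℝ) :
    ContDiffOn ℝ ∞ (powWeight s : EuclideanSpace ℝ (Fin n) → ℝ) {0}ᶜ :=
  (contDiff_norm_sq ℝ).contDiffOn.rpow_const_of_ne fun _ hx =>
    pow_ne_zero 2 (norm_ne_zero_iff.2 hx)

theorem hasGradientAt_powWeight (s : ℝ) {x : EuclideanSpace ℝ (Fin n)} (hx : x ≠ 0) :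
    HasGradientAt (powWeight s) ((-(s / ‖x‖ ^ 2) * powWeight s x) • x) x := by
  have hx2 : ‖x‖ ^ 2 ≠ 0 := pow_ne_zero 2 (norm_ne_zero_iff.2 hx)
  have h := HasDerivAt.comp_hasGradientAt (f := fun y : EuclideanSpace ℝ (Fin n) => ‖y‖ ^ 2)
    (Real.hasDerivAt_rpow_const (p := -s / 2) (Or.inl hx2)) (hasGradientAt_norm_sq x)
  have e : (-s / 2 * (‖x‖ ^ 2) ^ (-s / 2 - 1)) • (2 : ℝ) • x =
      (-(s / ‖x‖ ^ 2) * powWeight s x) • x := by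
    rw [smul_smul, powWeight, Real.rpow_sub_one hx2]
    congr 1
    ring
  rw [← e]; exact h

/-- Shells carry a scale invariant mass for the weight `|x|^(-n)`. -/
theorem integral_indicator_shell [NeZero n] {a b : ℝ} (ha : 0 < a) (hab : a ≤ b) :
    ∫ x : EuclideanSpace ℝ (Fin n), (Set.Icc a b).indicator (fun r : ℝ => (r ^ n)⁻¹) ‖x‖ =
      n * volume.real (Metric.ball (0 : EuclideanSpace ℝ (Fin n)) 1) * Real.log (b / a) := by
  have hn : n ≠ 0 := NeZero.ne n
  rw [integral_fun_norm_addHaar, finrank_euclideanSpace_fin]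
  have : ∫ y in Set.Ioi (0 : ℝ), y ^ (n - 1) • (Set.Icc a b).indicator (fun r : ℝ => (r ^ n)⁻¹) y =
      Real.log (b / a) := by
    have e : ∀ y : ℝ, y ^ (n - 1) • (Set.Icc a b).indicator (fun r : ℝ => (r ^ n)⁻¹) y =
        (Set.Icc a b).indicator (fun r : ℝ => r⁻¹) y := by
      intro y
      by_cases hy : y ∈ Set.Icc a b
      · have : y ≠ 0 := (ha.trans_le hy.1).ne'
        rw [Set.indicator_of_mem hy, Set.indicator_of_mem hy, smul_eq_mul]
        obtain ⟨k, rfl⟩ := Nat.exists_eq_succ_of_ne_zero hn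
        rw [Nat.succ_sub_one, pow_succ]
        field_simp
      · simp [hy]
    simp_rw [e]
    rw [setIntegral_indicator measurableSet_Icc,
      Set.inter_eq_self_of_subset_right
        (fun y (hy : y ∈ Set.Icc a b) => Set.mem_Ioi.2 (ha.trans_le hy.1)),
      integral_Icc_eq_integral_Ioc, ← intervalIntegral.integral_of_le hab,
      integral_inv_of_pos ha (ha.trans_le hab)]
  rw [this, nsmul_eq_mul, smul_eq_mul, mul_assoc]

/-- Radial cutoffs with small energy for the weight `|x|^(2-n)`. -/
theorem exists_radial_cutoff [NeZero n] {ε : ℝ} (hε : 0 < ε) {R : ℝ} (hR : 1 ≤ R) :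
    ∃ f : EuclideanSpace ℝ (Fin n) → ℝ, IsTestFunction {0}ᶜ f ∧
      (∀ x, R⁻¹ ≤ ‖x‖ → ‖x‖ ≤ R → f x = 1) ∧
      ∫ x, powWeight (((n : ℝ) - 2) / 2) x ^ 2 * ‖gradient f x‖ ^ 2 < ε := by
  have hR0 : 0 < R := by linarith
  let F : ContDiffBump (0 : ℝ) := ⟨1, 2, one_pos, one_lt_two⟩
  have hFc : ContDiff ℝ ∞ F := F.contDiff
  obtain ⟨M, hM⟩ := F.hasCompactSupport.deriv.exists_bound_of_continuous
    (hFc.continuous_deriv (by simp))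
  have hM0 : 0 ≤ M := (norm_nonneg _).trans (hM 0)
  set C := 8 * M ^ 2 * (n * volume.real (Metric.ball (0 : EuclideanSpace ℝ (Fin n)) 1)) with hC
  -- K > 2 log R makes the cutoff 1 for R⁻¹ ≤ |x| ≤ R, and K > C/ε makes its energy, at most C/K,
  -- smaller than ε.
  obtain ⟨K, hK⟩ := exists_nat_gt (max (max 1 (2 * Real.log R)) (C / ε))
  rw [max_lt_iff, max_lt_iff] at hK
  obtain ⟨⟨hK1, hK2⟩, hK3⟩ := hK
  have hK0 : (0 : ℝ) < K := by linarith
  -- A logarithmic cutoff: |∇q| ≤ 2M/(K|x|), so the weighted energy is at most 4M²/K² times the mass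
  -- of |x|⁻ⁿ on e^(-K) ≤ |x| ≤ e^K. That mass grows only linearly in K.
  set q : EuclideanSpace ℝ (Fin n) → ℝ := fun x => F (Real.log (‖x‖ ^ 2) / K) with hq
  set f : EuclideanSpace ℝ (Fin n) → ℝ := Set.indicator {0}ᶜ q with hf
  set S : Set (EuclideanSpace ℝ (Fin n)) :=
    Metric.closedBall 0 (Real.exp K) ∩ {x | Real.exp (-K) ≤ ‖x‖} with hS
  have hSc : IsCompact S := (isCompact_closedBall _ _).inter_right
    (isClosed_le continuous_const continuous_norm)
  have hS0 : S ⊆ {0}ᶜ := fun x hx h => by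
    have h' : x = 0 := h
    have := hx.2
    simp only [h', Set.mem_ofPred_eq, norm_zero] at this
    exact absurd this (not_le.2 (Real.exp_pos _))
  have hfq : ∀ x ∈ ({0}ᶜ : Set (EuclideanSpace ℝ (Fin n))), f x = q x := fun x hx =>
    Set.indicator_of_mem hx q
  have hz : ∀ x ∉ S, f x = 0 := by
    intro x hx
    by_cases h0 : x = 0
    · simp [hf, h0]
    · rw [hfq x h0, hq]
      have hxp : 0 < ‖x‖ := norm_pos_iff.2 h0
      refine F.zero_of_le_dist ?_
      simp only [dist_zero_right, Real.norm_eq_abs, abs_div, Nat.abs_cast, Real.log_pow,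
        Nat.cast_ofNat, F]
      rw [le_div_iff₀ hK0, abs_mul, abs_two]
      refine mul_le_mul_of_nonneg_left ?_ zero_le_two
      by_cases h1 : ‖x‖ ≤ Real.exp K
      · have h2 : ‖x‖ < Real.exp (-K) := by
          by_contra h2
          exact hx ⟨by simpa using h1, not_lt.1 h2⟩
        have := (Real.log_lt_iff_lt_exp hxp).2 h2
        rw [le_abs]; right; linarith
      · have := (Real.lt_log_iff_exp_lt hxp).2 (not_le.1 h1)
        rw [le_abs]; left; linarith
  have hqs : ContDiffOn ℝ ∞ q {0}ᶜ := by
    refine hFc.comp_contDiffOn (ContDiffOn.div_const (ContDiffOn.log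
      (contDiff_norm_sq ℝ).contDiffOn fun x hx => pow_ne_zero 2 (norm_ne_zero_iff.2 hx)) _)
  have ht : IsTestFunction {0}ᶜ f := IsTestFunction.of_contDiffOn isOpen_compl_singleton
    (hqs.congr hfq) hSc hS0 hS0 hz
  refine ⟨f, ht, fun x h1 h2 => ?_, ?_⟩
  · have hxp : 0 < ‖x‖ := (by positivity : 0 < R⁻¹).trans_le h1
    rw [hfq x (norm_pos_iff.1 hxp)]
    refine F.one_of_mem_closedBall ?_
    simp only [mem_closedBall_zero_iff, Real.norm_eq_abs, abs_div, Nat.abs_cast, Real.log_pow,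
        Nat.cast_ofNat, F]
    rw [div_le_one hK0, abs_mul, abs_two]
    have h3 := Real.log_le_log hxp h2
    have h4 := Real.log_le_log (by positivity) h1
    rw [Real.log_inv] at h4
    have : |Real.log ‖x‖| ≤ Real.log R := abs_le.2 ⟨h4, h3⟩
    linarith
  · have hgrad : ∀ x ∈ S, ‖gradient f x‖ ≤ 2 * M / (K * ‖x‖) := by
      intro x hx
      have hx0 : x ≠ 0 := hS0 hx
      have hxp : 0 < ‖x‖ := norm_pos_iff.2 hx0
      have h1 : HasDerivAt (fun t => F (Real.log t / K))
          (deriv F (Real.log (‖x‖ ^ 2) / K) * ((‖x‖ ^ 2)⁻¹ / K)) (‖x‖ ^ 2) :=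
        ((hFc.differentiable (by simp)) _).hasDerivAt.comp (‖x‖ ^ 2)
          ((Real.hasDerivAt_log (by positivity)).div_const _)
      have h2 : HasGradientAt q ((deriv F (Real.log (‖x‖ ^ 2) / K) * ((‖x‖ ^ 2)⁻¹ / K)) •
          (2 : ℝ) • x) x := HasDerivAt.comp_hasGradientAt
            (f := fun y : EuclideanSpace ℝ (Fin n) => ‖y‖ ^ 2) h1 (hasGradientAt_norm_sq x)
      have h3 : f =ᶠ[𝓝 x] q :=
        Filter.eventually_of_mem (isOpen_compl_singleton.mem_nhds hx0) hfq
      rw [(h2.congr_of_eventuallyEq h3).gradient, norm_smul, norm_smul, norm_mul]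
      have h4 := hM (Real.log (‖x‖ ^ 2) / K)
      rw [Real.norm_of_nonneg (show 0 ≤ (‖x‖ ^ 2)⁻¹ / (K : ℝ) by positivity),
        Real.norm_of_nonneg (zero_le_two : (0 : ℝ) ≤ 2)]
      calc _ ≤ M * ((‖x‖ ^ 2)⁻¹ / K) * (2 * ‖x‖) := by gcongr
        _ = _ := by field_simp
    have hle : ∀ x, powWeight (((n : ℝ) - 2) / 2) x ^ 2 * ‖gradient f x‖ ^ 2 ≤
        4 * M ^ 2 / K ^ 2 * (Set.Icc (Real.exp (-K)) (Real.exp K)).indicator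
          (fun r : ℝ => (r ^ n)⁻¹) ‖x‖ := by
      intro x
      by_cases hx : x ∈ S
      · have hx0 : x ≠ 0 := hS0 hx
        have hxp : 0 < ‖x‖ := norm_pos_iff.2 hx0
        have hx1 : ‖x‖ ≤ Real.exp K := by simpa using hx.1
        rw [Set.indicator_of_mem (Set.mem_Icc.2 ⟨hx.2, hx1⟩), powWeight_sq]
        have e : (‖x‖ ^ 2) ^ (-(((n : ℝ) - 2) / 2)) = (‖x‖ ^ n)⁻¹ * ‖x‖ ^ 2 := by
          rw [← Real.rpow_natCast ‖x‖ n, ← Real.rpow_natCast ‖x‖ 2, ← Real.rpow_mul hxp.le,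
            ← Real.rpow_neg hxp.le, ← Real.rpow_add hxp]
          congr 1; push_cast; ring
        rw [e]
        calc _ ≤ (‖x‖ ^ n)⁻¹ * ‖x‖ ^ 2 * (2 * M / (K * ‖x‖)) ^ 2 := by
              gcongr; exact hgrad x hx
          _ = _ := by field_simp; ring
      · have : gradient f x = 0 := gradient_eq_zero_of_notMem_tsupport fun h => hx
          (tsupport_subset_of_eq_zero hSc.isClosed hz h)
        rw [this, norm_zero]
        have : 0 ≤ (Set.Icc (Real.exp (-K)) (Real.exp K)).indicator
          (fun r : ℝ => (r ^ n)⁻¹) ‖x‖ :=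
            Set.indicator_apply_nonneg fun h => inv_nonneg.2 (by positivity)
        simp only [ne_eq, OfNat.ofNat_ne_zero, not_false_eq_true, zero_pow, mul_zero]
        positivity
    have hexp : Real.exp (-K) ≤ Real.exp K := Real.exp_le_exp.2 (by linarith)
    have hint : Integrable (fun x : EuclideanSpace ℝ (Fin n) => 4 * M ^ 2 / K ^ 2 *
        (Set.Icc (Real.exp (-K)) (Real.exp K)).indicator (fun r : ℝ => (r ^ n)⁻¹) ‖x‖) := by
      refine Integrable.const_mul ?_ _
      have hm : MeasurableSet S := hSc.measurableSet
      have e : (fun x : EuclideanSpace ℝ (Fin n) => (Set.Icc (Real.exp (-K)) (Real.exp K)).indicator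
          (fun r : ℝ => (r ^ n)⁻¹) ‖x‖) = S.indicator (fun x => (‖x‖ ^ n)⁻¹) := by
        ext x
        by_cases hx : x ∈ S
        · rw [Set.indicator_of_mem hx, Set.indicator_of_mem]
          exact ⟨hx.2, by simpa using hx.1⟩
        · rw [Set.indicator_of_notMem hx, Set.indicator_of_notMem]
          exact fun h => hx ⟨by simpa using h.2, h.1⟩
      rw [e, integrable_indicator_iff hm]
      refine ContinuousOn.integrableOn_compact hSc (ContinuousOn.inv₀ (by fun_prop) fun x hx => ?_)
      exact pow_ne_zero _ (norm_ne_zero_iff.2 (hS0 hx))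
    calc _ ≤ ∫ x : EuclideanSpace ℝ (Fin n), 4 * M ^ 2 / K ^ 2 *
          (Set.Icc (Real.exp (-K)) (Real.exp K)).indicator (fun r : ℝ => (r ^ n)⁻¹) ‖x‖ :=
          integral_mono_of_nonneg (ae_of_all _ fun x => by positivity) hint (ae_of_all _ hle)
      _ = C / K := by
          rw [integral_const_mul, integral_indicator_shell (Real.exp_pos _) hexp,
            ← Real.exp_sub, Real.log_exp, hC]
          field_simp
          ring
      _ < ε := by
          rw [div_lt_iff₀ hK0]
          rw [div_lt_iff₀ hε] at hK3
          linarith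

end Weights

/-! ### Truncated ground states and optimality of the constants -/

section GroundStates

variable {n : ℕ} {Ω O : Set (EuclideanSpace ℝ (Fin n))} {f q : EuclideanSpace ℝ (Fin n) → ℝ}

theorem IsTestFunction.contDiffOn_mul (h : IsTestFunction Ω f) (hO : IsOpen O)
    (hq : ContDiffOn ℝ ∞ q O) (hf : tsupport f ⊆ O) : IsTestFunction Ω (fun x => q x * f x) :=
  IsTestFunction.of_contDiffOn hO (hq.mul h.1.contDiffOn) h.2.1 hf h.2.2
    fun x hx => by simp [image_eq_zero_of_notMem_tsupport hx]

theorem IsTestFunction.powWeight_mul (h : IsTestFunction Ω f) (h0 : 0 ∉ tsupport f) (s : ℝ) :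
    IsTestFunction Ω (fun x => powWeight s x * f x) :=
  h.contDiffOn_mul isOpen_compl_singleton (contDiffOn_powWeight s) fun _ hx hc => h0 (hc ▸ hx)

/-- The twist by s x/|x|² annihilates the weight |x|^(-s) itself, so only the derivative of the
other factor survives. -/
theorem gradient_powWeight_mul_add (h : IsTestFunction Ω f) (s : ℝ)
    {x : EuclideanSpace ℝ (Fin n)} (hx : x ≠ 0) :
    gradient (fun x => powWeight s x * f x) x + (powWeight s x * f x) • (s / ‖x‖ ^ 2) • x =
      powWeight s x • gradient f x := by
  rw [((hasGradientAt_powWeight s hx).fun_mul (h.hasGradientAt x)).gradient]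
  module

/-- The Hardy constant `(n-2)²/4` is optimal among functions supported away from the origin. -/
theorem exists_isTestFunction_hardy_lt (hn : 3 ≤ n) {ε : ℝ} (hε : 0 < ε) :
    ∃ φ : EuclideanSpace ℝ (Fin n) → ℝ, IsTestFunction {0}ᶜ φ ∧
      ∫ x, ‖gradient φ x‖ ^ 2 < (((n : ℝ) - 2) ^ 2 / 4 + ε) * ∫ x, φ x ^ 2 / ‖x‖ ^ 2 := by
  have : NeZero n := ⟨by omega⟩
  -- The mass of |x|⁻ⁿ on 1/2 ≤ |x| ≤ 2. It bounds the Hardy integral from below for every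
  -- admissible cutoff, so cutoff energy below εβ is enough.
  set β := n * volume.real (Metric.ball (0 : EuclideanSpace ℝ (Fin n)) 1) * Real.log (2 / 2⁻¹)
  have hβ : 0 < β := by
    refine mul_pos (mul_pos (by positivity) ?_) (Real.log_pos (by norm_num))
    exact ENNReal.toReal_pos (Metric.measure_ball_pos _ _ one_pos).ne' measure_ball_lt_top.ne
  obtain ⟨f, hf, hf1, hJ⟩ := exists_radial_cutoff (n := n) (mul_pos hε hβ) one_le_two
  have h0 : 0 ∉ tsupport f := fun h => hf.2.2 h rfl
  set a := ((n : ℝ) - 2) / 2 with ha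
  have hφ := hf.powWeight_mul h0 a
  have h0φ : 0 ∉ tsupport (fun x => powWeight a x * f x) := fun h => hφ.2.2 h rfl
  refine ⟨_, hφ, ?_⟩
  rw [hφ.integral_norm_gradient_sq_power h0φ a]
  have e1 : ∫ x, ‖gradient (fun x => powWeight a x * f x) x +
      (powWeight a x * f x) • (a / ‖x‖ ^ 2) • x‖ ^ 2 =
      ∫ x, powWeight a x ^ 2 * ‖gradient f x‖ ^ 2 := by
    refine integral_congr_ae ?_
    filter_upwards [Measure.ae_ne volume 0] with x hx
    rw [gradient_powWeight_mul_add hf a hx, norm_smul, mul_pow, Real.norm_eq_abs, sq_abs]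
  have e2 : β ≤ ∫ x, (powWeight a x * f x) ^ 2 / ‖x‖ ^ 2 := by
    rw [show β = _ from (integral_indicator_shell (n := n) (a := 2⁻¹) (b := 2)
      (by norm_num) (by norm_num)).symm]
    refine integral_mono_of_nonneg (ae_of_all _ fun x => Set.indicator_apply_nonneg fun h => ?_)
      (hφ.integrable_sq_div h0φ) (ae_of_all _ fun x => ?_)
    · positivity
    · by_cases hx : ‖x‖ ∈ Set.Icc (2⁻¹ : ℝ) 2
      · have hxp : 0 < ‖x‖ := lt_of_lt_of_le (by norm_num) hx.1
        simp only [Set.indicator_of_mem hx, hf1 x hx.1 hx.2, mul_one, powWeight_sq]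
        have e : (‖x‖ ^ 2) ^ (-a) = (‖x‖ ^ n)⁻¹ * ‖x‖ ^ 2 := by
          rw [← Real.rpow_natCast ‖x‖ n, ← Real.rpow_natCast ‖x‖ 2, ← Real.rpow_mul hxp.le,
            ← Real.rpow_neg hxp.le, ← Real.rpow_add hxp]
          congr 1; rw [ha]; push_cast; ring
        rw [e]
        exact le_of_eq (by field_simp)
      · simp only [Set.indicator_of_notMem hx]
        positivity
  rw [e1]
  -- The choice a = (n-2)/2 maximises s(n-2-s).
  have : a * (n - 2 - a) = ((n : ℝ) - 2) ^ 2 / 4 := by rw [ha]; ring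
  rw [this, add_mul, add_comm]
  have := mul_le_mul_of_nonneg_left e2 hε.le
  linarith

/-- The truncated ground state `⟨ν, x⟩ |x|^(-n/2)` of a half-space. -/
noncomputable def halfSpaceState (ν : EuclideanSpace ℝ (Fin n)) (m : ℝ)
    (f : EuclideanSpace ℝ (Fin n) → ℝ) (x : EuclideanSpace ℝ (Fin n)) : ℝ :=
  ⟪ν, x⟫ * powWeight (n / 2) x * (cutoffAbove m ⟪ν, x⟫ * f x)

variable {ν : EuclideanSpace ℝ (Fin n)} {m : ℝ}

theorem halfSpaceState_eq_zero {x : EuclideanSpace ℝ (Fin n)}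
    (hx : x ∉ tsupport f ∩ {x | m⁻¹ ≤ ⟪ν, x⟫}) (hm : 0 < m) : halfSpaceState ν m f x = 0 := by
  by_cases h : x ∈ tsupport f
  · have : cutoffAbove m ⟪ν, x⟫ = 0 := by
      refine cutoffAbove_eq_zero ?_
      have h1 : ⟪ν, x⟫ < m⁻¹ := not_le.1 fun h' => hx ⟨h, h'⟩
      have h2 := mul_lt_mul_of_pos_left h1 hm
      rw [mul_inv_cancel₀ hm.ne'] at h2
      exact h2.le
    simp [halfSpaceState, this]
  · simp [halfSpaceState, image_eq_zero_of_notMem_tsupport h]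

theorem IsTestFunction.halfSpaceState (hf : IsTestFunction {0}ᶜ f) (ν) (hm : 0 < m) :
    IsTestFunction {x | 0 < ⟪ν, x⟫} (halfSpaceState ν m f) := by
  have hci : Continuous fun x : EuclideanSpace ℝ (Fin n) => ⟪ν, x⟫ := by fun_prop
  have hcd : ContDiff ℝ ∞ fun x : EuclideanSpace ℝ (Fin n) => ⟪ν, x⟫ :=
    (innerSL ℝ ν).contDiff
  refine IsTestFunction.of_contDiffOn isOpen_compl_singleton (O := {0}ᶜ)
    (K := tsupport f ∩ {x | m⁻¹ ≤ ⟪ν, x⟫}) ?_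
    (IsCompact.inter_right hf.2.1 (isClosed_le continuous_const hci))
    (Set.inter_subset_left.trans hf.2.2) (fun x hx => (inv_pos.2 hm).trans_le hx.2)
    fun x hx => halfSpaceState_eq_zero hx hm
  exact (hcd.contDiffOn.mul (contDiffOn_powWeight _)).mul
    (((contDiff_cutoffAbove m).comp hcd).contDiffOn.mul hf.1.contDiffOn)

/-- The twist annihilates the ground state, so the square in the half-space identity becomes the
weighted energy of the cutoffs alone. -/
theorem gradient_halfSpaceState_add (hf : IsTestFunction {0}ᶜ f)
    {x : EuclideanSpace ℝ (Fin n)} (hx : 0 < ⟪ν, x⟫) :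
    gradient (halfSpaceState ν m f) x + halfSpaceState ν m f x •
      ((-⟪ν, x⟫⁻¹) • ν + (n / 2 / ‖x‖ ^ 2) • x) = (⟪ν, x⟫ * powWeight (n / 2) x) •
      (cutoffAbove m ⟪ν, x⟫ • gradient f x +
        f x • (m * deriv Real.smoothTransition (m * ⟪ν, x⟫ - 1)) • ν) := by
  have hx0 : x ≠ 0 := fun h => by simp [h] at hx
  have h1 := ((hasDerivAt_cutoffAbove m ⟪ν, x⟫).comp_hasGradientAt
    (hasGradientAt_inner_left ν x)).fun_mul (hf.hasGradientAt x)
  have h2 := (hasGradientAt_inner_left ν x).fun_mul (hasGradientAt_powWeight (n / 2) hx0)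
  have h3 : gradient (halfSpaceState ν m f) x = _ := (h2.fun_mul h1).gradient
  rw [h3, halfSpaceState]
  have e : ⟪ν, x⟫ * powWeight (n / 2) x * (cutoffAbove m ⟪ν, x⟫ * f x) * (-⟪ν, x⟫⁻¹) =
      -(powWeight (n / 2) x * (cutoffAbove m ⟪ν, x⟫ * f x)) := by
    field_simp
  rw [smul_add _ ((-⟪ν, x⟫⁻¹) • ν), smul_smul _ (-⟪ν, x⟫⁻¹), e]
  module

/-- The deficit is the square left by `IsTestFunction.integral_norm_gradient_sq_halfSpace`. The
boundary cutoff contributes only on the strip m⁻¹ ≤ ⟨ν, x⟩ ≤ 2m⁻¹, with constant independent of m.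
The radial factor contributes with weight ⟨ν, x⟩² |x|⁻ⁿ ≤ |x|^(2-n). The two are separated by |a +
b|² ≤ 2|a|² + 2|b|². -/
theorem halfSpaceState_deficit (hf : IsTestFunction {0}ᶜ f) (hν : ‖ν‖ = 1) (hm : 0 < m) {D : ℝ}
    (hD : ∀ t, |deriv Real.smoothTransition t| ≤ D) :
    (∫ x, ‖gradient (halfSpaceState ν m f) x‖ ^ 2) -
      (n : ℝ) ^ 2 / 4 * ∫ x, halfSpaceState ν m f x ^ 2 / ‖x‖ ^ 2 ≤
      8 * D ^ 2 * (∫ x, {x | m⁻¹ ≤ ⟪ν, x⟫ ∧ ⟪ν, x⟫ ≤ 2 * m⁻¹}.indicator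
        (fun x => (powWeight (n / 2) x * f x) ^ 2) x) +
      2 * ∫ x, powWeight (((n : ℝ) - 2) / 2) x ^ 2 * ‖gradient f x‖ ^ 2 := by
  have h := hf.halfSpaceState ν hm
  have h0 : 0 ∉ tsupport f := fun h => hf.2.2 h rfl
  have hci : Continuous fun x : EuclideanSpace ℝ (Fin n) => ⟪ν, x⟫ := by fun_prop
  set S : Set (EuclideanSpace ℝ (Fin n)) := {x | m⁻¹ ≤ ⟪ν, x⟫ ∧ ⟪ν, x⟫ ≤ 2 * m⁻¹} with hS
  have hSm : MeasurableSet S := (isClosed_le continuous_const hci).measurableSet.inter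
    (isClosed_le hci continuous_const).measurableSet
  have i1 : Integrable (S.indicator fun x => (powWeight (n / 2) x * f x) ^ 2) :=
    (hf.powWeight_mul h0 (n / 2)).integrable_sq.indicator hSm
  have i2 : Integrable (fun x => powWeight (((n : ℝ) - 2) / 2) x ^ 2 * ‖gradient f x‖ ^ 2) :=
    hf.integrable isOpen_compl_singleton (O := {0}ᶜ) hf.2.2
      (((contDiffOn_powWeight _).continuousOn.pow 2).mul
        (hf.continuous_gradient.norm.pow 2).continuousOn)
      fun x hx => by simp [gradient_eq_zero_of_notMem_tsupport hx]
  rw [h.integral_norm_gradient_sq_halfSpace h.2.2, add_sub_cancel_right, ← integral_const_mul,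
    ← integral_const_mul, ← integral_add (i1.const_mul _) (i2.const_mul _)]
  refine integral_mono_of_nonneg (ae_of_all _ fun x => by positivity)
    ((i1.const_mul _).add (i2.const_mul _)) (ae_of_all _ fun x => ?_)
  have hnn : 0 ≤ S.indicator (fun x => (powWeight (n / 2) x * f x) ^ 2) x :=
    Set.indicator_apply_nonneg fun _ => by positivity
  by_cases hx : 0 < ⟪ν, x⟫
  swap
  · have hxs : x ∉ tsupport (halfSpaceState ν m f) := fun hx' => hx (h.2.2 hx')
    simp only [gradient_eq_zero_of_notMem_tsupport hxs, image_eq_zero_of_notMem_tsupport hxs,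
      zero_smul, add_zero, norm_zero, ne_eq, OfNat.ofNat_ne_zero, not_false_eq_true, zero_pow]
    positivity
  · have hx0 : x ≠ 0 := fun h => by simp [h] at hx
    have hxp : 0 < ‖x‖ := norm_pos_iff.2 hx0
    beta_reduce
    rw [gradient_halfSpaceState_add hf hx, norm_smul, mul_pow, Real.norm_eq_abs, sq_abs]
    set t := ⟪ν, x⟫ with ht
    set p := powWeight (n / 2) x with hp
    set d := m * deriv Real.smoothTransition (m * t - 1) with hd
    have htx : t ≤ ‖x‖ := by simpa [hν] using real_inner_le_norm ν x
    have hp2 : (t * p) ^ 2 ≤ powWeight (((n : ℝ) - 2) / 2) x ^ 2 := by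
      have e : powWeight (((n : ℝ) - 2) / 2) x ^ 2 = ‖x‖ ^ 2 * p ^ 2 := by
        rw [hp, powWeight_sq, powWeight_sq,
          show -(((n : ℝ) - 2) / 2) = 1 + -(n / 2) by ring, Real.rpow_add (by positivity),
          Real.rpow_one]
      rw [e, mul_pow]
      gcongr
    have hcut : cutoffAbove m t ^ 2 ≤ 1 :=
      pow_le_one₀ (Real.smoothTransition.nonneg _) (Real.smoothTransition.le_one _)
    have htd : (t * p) ^ 2 * (f x * d) ^ 2 ≤
        4 * D ^ 2 * S.indicator (fun x => (powWeight (n / 2) x * f x) ^ 2) x := by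
      by_cases hxS : x ∈ S
      · rw [Set.indicator_of_mem hxS, ← hp]
        have := abs_mul_deriv_cutoffAbove_le hD m t
        rw [← hd] at this
        have h2 : (t * d) ^ 2 ≤ (2 * D) ^ 2 := sq_le_sq' (by linarith [(abs_le.1 this).1])
          (abs_le.1 this).2
        calc (t * p) ^ 2 * (f x * d) ^ 2 = (t * d) ^ 2 * (p * f x) ^ 2 := by ring
          _ ≤ (2 * D) ^ 2 * (p * f x) ^ 2 := by gcongr
          _ = _ := by ring
      · have : d = 0 := by
          rw [hd, deriv_smoothTransition_eq_zero, mul_zero]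
          by_contra! hc
          apply hxS
          have h1 : 1 ≤ m * t := by linarith [hc.1]
          have h2 : m * t ≤ 2 := by linarith [hc.2]
          refine ⟨?_, ?_⟩
          · rw [inv_le_iff_one_le_mul₀' hm]; exact h1
          · rw [← div_eq_mul_inv, le_div_iff₀' hm]; exact h2
        rw [this]; simp only [mul_zero, ne_eq, OfNat.ofNat_ne_zero, not_false_eq_true, zero_pow]
        positivity
    have hsum : ‖cutoffAbove m t • gradient f x + f x • d • ν‖ ^ 2 ≤
        2 * (cutoffAbove m t ^ 2 * ‖gradient f x‖ ^ 2 + (f x * d) ^ 2) := by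
      have h1 := norm_add_le (cutoffAbove m t • gradient f x) (f x • d • ν)
      have h2 : ‖cutoffAbove m t • gradient f x‖ ^ 2 = cutoffAbove m t ^ 2 * ‖gradient f x‖ ^ 2 := by
        rw [norm_smul, mul_pow, Real.norm_eq_abs, sq_abs]
      have h3 : ‖f x • d • ν‖ ^ 2 = (f x * d) ^ 2 := by
        rw [smul_smul, norm_smul, hν, mul_one, Real.norm_eq_abs, sq_abs]
      rw [← h2, ← h3]
      nlinarith [norm_nonneg (cutoffAbove m t • gradient f x + f x • d • ν),
        sq_nonneg (‖cutoffAbove m t • gradient f x‖ - ‖f x • d • ν‖)]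
    calc _ ≤ (t * p) ^ 2 * (2 * (cutoffAbove m t ^ 2 * ‖gradient f x‖ ^ 2 + (f x * d) ^ 2)) := by
          gcongr
      _ = 2 * ((t * p) ^ 2 * (f x * d) ^ 2) +
          2 * ((t * p) ^ 2 * (cutoffAbove m t ^ 2 * ‖gradient f x‖ ^ 2)) := by ring
      _ ≤ 2 * (4 * D ^ 2 * S.indicator (fun x => (powWeight (n / 2) x * f x) ^ 2) x) +
          2 * (powWeight (((n : ℝ) - 2) / 2) x ^ 2 * (1 * ‖gradient f x‖ ^ 2)) := by gcongr
      _ = _ := by ring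

/-- Truncated ground states of a half-space with small deficit. -/
theorem exists_halfSpaceState (hn : n ≠ 0) (hν : ‖ν‖ = 1) {ε R : ℝ} (hε : 0 < ε) (hR : 1 ≤ R) :
    ∃ f : EuclideanSpace ℝ (Fin n) → ℝ, IsTestFunction {0}ᶜ f ∧
      (∀ x, R⁻¹ ≤ ‖x‖ → ‖x‖ ≤ R → f x = 1) ∧
      ∀ᶠ m : ℝ in atTop, (∫ x, ‖gradient (halfSpaceState ν m f) x‖ ^ 2) -
        (n : ℝ) ^ 2 / 4 * (∫ x, halfSpaceState ν m f x ^ 2 / ‖x‖ ^ 2) < ε := by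
  have : NeZero n := ⟨hn⟩
  obtain ⟨D, hD0, hD⟩ := exists_abs_deriv_smoothTransition_le
  obtain ⟨f, hf, hf1, hJ⟩ := exists_radial_cutoff (n := n) (half_pos hε) hR
  refine ⟨f, hf, hf1, ?_⟩
  have h0 : 0 ∉ tsupport f := fun h => hf.2.2 h rfl
  have hci : Continuous fun x : EuclideanSpace ℝ (Fin n) => ⟪ν, x⟫ := by fun_prop
  -- Every point leaves the strip once m is large, so dominated convergence removes the boundary
  -- contribution.
  have hlim : Tendsto (fun m : ℝ => ∫ x, {x | m⁻¹ ≤ ⟪ν, x⟫ ∧ ⟪ν, x⟫ ≤ 2 * m⁻¹}.indicator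
        (fun x => (powWeight (n / 2) x * f x) ^ 2) x) atTop
        (𝓝 (∫ x : EuclideanSpace ℝ (Fin n), (0 : ℝ))) := by
    have hi := (hf.powWeight_mul h0 (n / 2)).integrable_sq
    refine tendsto_integral_filter_of_dominated_convergence
      (fun x => (powWeight (n / 2) x * f x) ^ 2) (Eventually.of_forall fun m => ?_)
      (Eventually.of_forall fun m => ae_of_all _ fun x => ?_) hi (ae_of_all _ fun x => ?_)
    · exact hi.1.indicator ((isClosed_le continuous_const hci).measurableSet.inter
        (isClosed_le hci continuous_const).measurableSet)
    · refine (norm_indicator_le_norm_self _ _).trans (le_of_eq ?_)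
      rw [Real.norm_of_nonneg (by positivity)]
    · refine tendsto_const_nhds.congr' ?_
      rcases le_or_gt ⟪ν, x⟫ 0 with hx | hx
      · filter_upwards [eventually_gt_atTop 0] with m hm
        rw [Set.indicator_of_notMem]
        exact fun h => absurd (hx.trans_lt (inv_pos.2 hm)) (not_lt.2 h.1)
      · filter_upwards [(tendsto_inv_atTop_zero.const_mul (2 : ℝ)).eventually_lt_const
          (by simpa using hx)] with m hm
        rw [Set.indicator_of_notMem]
        exact fun h => absurd hm (not_lt.2 h.2)
  rw [integral_zero] at hlim
  have h2 := hlim.const_mul (8 * D ^ 2)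
  rw [mul_zero] at h2
  have h3 := h2.add_const (2 * ∫ x, powWeight (((n : ℝ) - 2) / 2) x ^ 2 * ‖gradient f x‖ ^ 2)
  filter_upwards [h3.eventually_lt_const (u := ε) (by linarith), eventually_gt_atTop 0]
    with m hm hm0
  exact (halfSpaceState_deficit hf hν hm0 hD).trans_lt hm

end GroundStates

/-! ### Dilation invariance and concentration at the origin -/

section Scaling

variable {n : ℕ} {Ω : Set (EuclideanSpace ℝ (Fin n))} {φ : EuclideanSpace ℝ (Fin n) → ℝ}

theorem IsTestFunction.dirichletEnergy_lt_iff [NeZero n] (h : IsTestFunction Ω φ)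
    (h0 : 0 ∉ tsupport φ) {c : ℝ} (hc : 0 ≤ c) :
    dirichletEnergy φ < ENNReal.ofReal c * hardyEnergy φ ↔
      ∫ x, ‖gradient φ x‖ ^ 2 < c * ∫ x, φ x ^ 2 / ‖x‖ ^ 2 := by
  rw [← not_le, ← not_le, h.mul_hardyEnergy_le_iff h0 hc]

theorem IsTestFunction.comp_smul (h : IsTestFunction Ω φ) {c : ℝ} (hc : c ≠ 0) :
    IsTestFunction {x | c • x ∈ Ω} (fun x => φ (c • x)) := by
  have hcd : ContDiff ℝ ∞ fun x : EuclideanSpace ℝ (Fin n) => c • x := contDiff_const_smul c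
  refine IsTestFunction.of_contDiffOn isOpen_univ (h.1.comp hcd).contDiffOn
    (K := (fun x => c • x) ⁻¹' tsupport φ) ?_ (Set.subset_univ _) (fun x hx => h.2.2 hx)
    fun x hx => image_eq_zero_of_notMem_tsupport (f := φ) hx
  exact (Homeomorph.smulOfNeZero c hc).isClosedEmbedding.isCompact_preimage h.2.1

theorem IsTestFunction.gradient_comp_smul (h : IsTestFunction Ω φ) (c : ℝ)
    (x : EuclideanSpace ℝ (Fin n)) :
    gradient (fun x => φ (c • x)) x = c • gradient φ (c • x) := by
  refine HasGradientAt.gradient ?_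
  have h1 := hasGradientAt_iff_hasFDerivAt.1 (h.hasGradientAt (c • x))
  have h2 : HasFDerivAt (fun x : EuclideanSpace ℝ (Fin n) => c • x)
      (c • ContinuousLinearMap.id ℝ _) x := (hasFDerivAt_id x).const_smul c
  rw [hasGradientAt_iff_hasFDerivAt]
  refine (h1.comp x h2).congr_fderiv ?_
  ext1 y
  simp

/-- Both energies scale in the same way under dilations. -/
theorem IsTestFunction.dirichletEnergy_comp_smul_lt [NeZero n] (h : IsTestFunction Ω φ)
    (h0 : 0 ∉ tsupport φ) {c C : ℝ} (hc : c ≠ 0) (hC : 0 ≤ C)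
    (hlt : dirichletEnergy φ < ENNReal.ofReal C * hardyEnergy φ) :
    dirichletEnergy (fun x => φ (c • x)) <
      ENNReal.ofReal C * hardyEnergy (fun x => φ (c • x)) := by
  have h0' : 0 ∉ tsupport (fun x => φ (c • x)) := fun h' => h0 <| by
    have := (h.mono (Ω' := tsupport φ) subset_rfl).comp_smul hc
    simpa using this.2.2 h'
  rw [(h.comp_smul hc).dirichletEnergy_lt_iff h0' hC]
  rw [h.dirichletEnergy_lt_iff h0 hC] at hlt
  -- Both integrals are multiplied by the same factor |c|^(2-n): c² comes from the gradient or from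
  -- |x|⁻², the rest from the Jacobian.
  set k := c ^ 2 * |(c ^ Module.finrank ℝ (EuclideanSpace ℝ (Fin n)))⁻¹| with hk
  have hk0 : 0 < k := by positivity
  have e1 : ∫ x, ‖gradient (fun x => φ (c • x)) x‖ ^ 2 = k * ∫ x, ‖gradient φ x‖ ^ 2 := by
    simp_rw [h.gradient_comp_smul, norm_smul, mul_pow, Real.norm_eq_abs, sq_abs]
    rw [integral_const_mul, Measure.integral_comp_smul volume (fun x => ‖gradient φ x‖ ^ 2) c,
      smul_eq_mul, hk, mul_assoc]
  have e2 : ∫ x, φ (c • x) ^ 2 / ‖x‖ ^ 2 = k * ∫ x, φ x ^ 2 / ‖x‖ ^ 2 := by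
    have : ∀ x : EuclideanSpace ℝ (Fin n), φ (c • x) ^ 2 / ‖x‖ ^ 2 =
        c ^ 2 * (φ (c • x) ^ 2 / ‖c • x‖ ^ 2) := fun x => by
      rw [norm_smul, mul_pow, Real.norm_eq_abs, sq_abs]
      field_simp
    simp_rw [this]
    rw [integral_const_mul, Measure.integral_comp_smul volume (fun x => φ x ^ 2 / ‖x‖ ^ 2) c,
      smul_eq_mul, hk, mul_assoc]
  rw [e1, e2, mul_left_comm]
  exact mul_lt_mul_of_pos_left hlt hk0

theorem exists_smul_mem_ball (h : IsTestFunction Ω φ) {δ : ℝ} (hδ : 0 < δ) :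
    ∃ c : ℝ, 0 < c ∧ tsupport (fun x => φ (c • x)) ⊆ Metric.ball 0 δ := by
  obtain ⟨R, hR⟩ := h.2.1.isBounded.subset_ball 0
  have hR0 : 0 < max R 1 := by positivity
  have hc : 0 < max R 1 / δ := by positivity
  refine ⟨max R 1 / δ, hc, fun x hx => ?_⟩
  have h1 := ((h.mono (Ω' := tsupport φ) subset_rfl).comp_smul hc.ne').2.2 hx
  have h2 := hR h1
  rw [mem_ball_zero_iff, norm_smul, Real.norm_of_nonneg hc.le] at h2
  rw [mem_ball_zero_iff]
  have h3 : max R 1 / δ * ‖x‖ < max R 1 / δ * δ := by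
    rw [div_mul_cancel₀ _ hδ.ne']; exact h2.trans_le (le_max_left _ _)
  exact lt_of_mul_lt_mul_left h3 hc.le

/-- Near optimal functions for the Hardy inequality, supported in small punctured balls. -/
theorem exists_isTestFunction_ball (hn : 3 ≤ n) {ε δ : ℝ} (hε : 0 < ε) (hδ : 0 < δ) :
    ∃ φ : EuclideanSpace ℝ (Fin n) → ℝ, IsTestFunction ({0}ᶜ ∩ Metric.ball 0 δ) φ ∧
      dirichletEnergy φ < ENNReal.ofReal (((n : ℝ) - 2) ^ 2 / 4 + ε) * hardyEnergy φ := by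
  have : NeZero n := ⟨by omega⟩
  obtain ⟨φ, hφ, hlt⟩ := exists_isTestFunction_hardy_lt hn hε
  have h0 : 0 ∉ tsupport φ := fun h => hφ.2.2 h rfl
  rw [← hφ.dirichletEnergy_lt_iff h0 (by positivity)] at hlt
  obtain ⟨c, hc, hs⟩ := exists_smul_mem_ball hφ hδ
  refine ⟨_, (hφ.comp_smul hc.ne').mono (Set.subset_inter ?_ hs),
    hφ.dirichletEnergy_comp_smul_lt h0 hc.ne' (by positivity) hlt⟩
  intro x hx
  have := (hφ.comp_smul hc.ne').2.2 hx
  intro h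
  rw [Set.mem_singleton_iff.1 h] at this
  simp at this

/-- Near optimal functions for the Hardy inequality in half-balls. -/
theorem exists_isTestFunction_halfBall (hn : n ≠ 0) {ν : EuclideanSpace ℝ (Fin n)} (hν : ν ≠ 0)
    {ε δ : ℝ} (hε : 0 < ε) (hδ : 0 < δ) :
    ∃ φ : EuclideanSpace ℝ (Fin n) → ℝ, IsTestFunction ({x | 0 < ⟪ν, x⟫} ∩ Metric.ball 0 δ) φ ∧
      dirichletEnergy φ < ENNReal.ofReal ((n : ℝ) ^ 2 / 4 + ε) * hardyEnergy φ := by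
  have : NeZero n := ⟨hn⟩
  wlog hν1 : ‖ν‖ = 1 generalizing ν
  · have hp : 0 < ‖ν‖⁻¹ := inv_pos.2 (norm_pos_iff.2 hν)
    obtain ⟨φ, hφ, hlt⟩ := this (ν := ‖ν‖⁻¹ • ν) (smul_ne_zero hp.ne' hν)
      (by rw [norm_smul, norm_inv, norm_norm, inv_mul_cancel₀ (norm_ne_zero_iff.2 hν)])
    refine ⟨φ, hφ.mono (hφ.2.2.trans fun x hx => ⟨?_, hx.2⟩), hlt⟩
    have := hx.1
    simp only [Set.mem_ofPred_eq, real_inner_smul_left] at this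
    exact pos_of_mul_pos_right this hp.le
  set p0 : ℝ := ((2 : ℝ) ^ 2) ^ (-(n / 2 : ℝ) / 2) with hp0
  have hp0' : 0 < p0 := by positivity
  -- On the ball of radius 1/4 about the unit vector ν one has 1/2 ≤ |x| ≤ 2 and ⟨ν, x⟩ ≥ 3/4. With
  -- m ≥ 3 both cutoffs are 1 there, so β bounds the Hardy integral from below independently of ε.
  set β : ℝ := volume.real (Metric.ball ν (1 / 4)) * ((3 / 4 * p0) ^ 2 / 2 ^ 2) with hβ
  have hβ0 : 0 < β := by
    refine mul_pos (ENNReal.toReal_pos (Metric.measure_ball_pos _ _ (by norm_num)).ne'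
      measure_ball_lt_top.ne) (by positivity)
  obtain ⟨f, hf, hf1, hm⟩ := exists_halfSpaceState hn hν1 (mul_pos hε hβ0) one_le_two
  obtain ⟨m, hm, hm3⟩ := (hm.and (eventually_ge_atTop 3)).exists
  have hm0 : 0 < m := by linarith
  have hv := hf.halfSpaceState ν hm0
  have h0 : 0 ∉ tsupport (halfSpaceState ν m f) := fun h => by simpa using hv.2.2 h
  have hlow : β ≤ ∫ x, halfSpaceState ν m f x ^ 2 / ‖x‖ ^ 2 := by
    have hi := hv.integrable_sq_div h0
    calc β = ∫ x in Metric.ball ν (1 / 4), (3 / 4 * p0) ^ 2 / 2 ^ 2 := by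
          rw [setIntegral_const, smul_eq_mul]
      _ ≤ ∫ x in Metric.ball ν (1 / 4), halfSpaceState ν m f x ^ 2 / ‖x‖ ^ 2 := by
          refine setIntegral_mono_on (integrableOn_const measure_ball_lt_top.ne) hi.integrableOn
            measurableSet_ball fun x hx => ?_
          have hd : ‖x - ν‖ < 1 / 4 := by simpa [dist_eq_norm] using hx
          have h1 : ‖x‖ ≤ 2 := by
            have := norm_add_le (x - ν) ν
            rw [sub_add_cancel, hν1] at this; linarith
          have h2 : 1 / 2 ≤ ‖x‖ := by
            have := norm_sub_norm_le ν x
            rw [norm_sub_rev, hν1] at this; linarith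
          have h3 : 3 / 4 ≤ ⟪ν, x⟫ := by
            have h4 : ⟪ν, x⟫ = 1 + ⟪ν, x - ν⟫ := by
              rw [inner_sub_right, real_inner_self_eq_norm_sq, hν1]; ring
            have h5 := abs_real_inner_le_norm ν (x - ν)
            rw [hν1, one_mul] at h5
            linarith [(abs_le.1 h5).1]
          have hxp : 0 < ‖x‖ := by linarith
          have h6 : p0 ≤ powWeight (n / 2) x := by
            rw [hp0, powWeight]
            refine Real.rpow_le_rpow_of_nonpos (by positivity) (by gcongr) ?_
            have : (0 : ℝ) ≤ n := by positivity
            linarith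
          rw [halfSpaceState, cutoffAbove_eq_one (by nlinarith), hf1 x (by linarith) h1, mul_one,
            mul_one]
          gcongr
      _ ≤ _ := setIntegral_le_integral hi (ae_of_all _ fun x => by positivity)
  have hlt : dirichletEnergy (halfSpaceState ν m f) <
      ENNReal.ofReal ((n : ℝ) ^ 2 / 4 + ε) * hardyEnergy (halfSpaceState ν m f) := by
    rw [hv.dirichletEnergy_lt_iff h0 (by positivity), add_mul]
    have := mul_le_mul_of_nonneg_left hlow hε.le
    linarith
  obtain ⟨c, hc, hs⟩ := exists_smul_mem_ball hv hδ
  refine ⟨_, (hv.comp_smul hc.ne').mono (Set.subset_inter (fun x hx => ?_) hs),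
    hv.dirichletEnergy_comp_smul_lt h0 hc.ne' (by positivity) hlt⟩
  have := (hv.comp_smul hc.ne').2.2 hx
  simp only [Set.mem_ofPred_eq, real_inner_smul_right] at this
  exact pos_of_mul_pos_right this hc.le

end Scaling

/-! ### Change of variables by near-identity diffeomorphisms -/

section Transport

variable {n : ℕ} {Ω : Set (EuclideanSpace ℝ (Fin n))} {φ : EuclideanSpace ℝ (Fin n) → ℝ}

theorem norm_gradient_eq (φ : EuclideanSpace ℝ (Fin n) → ℝ) (x : EuclideanSpace ℝ (Fin n)) :
    ‖gradient φ x‖ = ‖fderiv ℝ φ x‖ :=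
  LinearIsometryEquiv.norm_map _ _

/-- Pulling back a test function by a diffeomorphism with controlled distortion. -/
theorem IsTestFunction.exists_pullback [NeZero n]
    (Φ : OpenPartialHomeomorph (EuclideanSpace ℝ (Fin n)) (EuclideanSpace ℝ (Fin n)))
    (hΦ : ContDiffOn ℝ ∞ Φ Φ.source) {τ : ℝ} (hτ : 0 ≤ τ)
    (h1 : ∀ x ∈ Φ.source, ‖fderiv ℝ Φ x‖ ^ 2 ≤ τ * |(fderiv ℝ Φ x).det|)
    (h2 : ∀ x ∈ Φ.source, |(fderiv ℝ Φ x).det| * ‖x‖ ^ 2 ≤ τ * ‖Φ x‖ ^ 2)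
    (h : IsTestFunction Φ.target φ) :
    ∃ v, IsTestFunction (Φ.source ∩ Φ ⁻¹' tsupport φ) v ∧
      dirichletEnergy v ≤ ENNReal.ofReal τ * dirichletEnergy φ ∧
      hardyEnergy φ ≤ ENNReal.ofReal τ * hardyEnergy v := by
  set v : EuclideanSpace ℝ (Fin n) → ℝ := Φ.source.indicator (fun x => φ (Φ x)) with hv
  have hvs : ∀ x ∈ Φ.source, v x = φ (Φ x) := fun x hx => Set.indicator_of_mem hx _
  set K := Φ.symm '' tsupport φ with hK
  have hKc : IsCompact K := h.2.1.isCompact.image_of_continuousOn (Φ.continuousOn_symm.mono h.2.2)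
  have hKsub : K ⊆ Φ.source ∩ Φ ⁻¹' tsupport φ := by
    rintro _ ⟨y, hy, rfl⟩
    refine ⟨Φ.map_target (h.2.2 hy), ?_⟩
    rw [Set.mem_preimage, Φ.right_inv (h.2.2 hy)]; exact hy
  have hvz : ∀ x ∉ K, v x = 0 := by
    intro x hx
    by_cases hxs : x ∈ Φ.source
    · rw [hvs x hxs]
      refine image_eq_zero_of_notMem_tsupport fun hc => hx ⟨Φ x, hc, Φ.left_inv hxs⟩
    · exact Set.indicator_of_notMem hxs _
  have htest : IsTestFunction (Φ.source ∩ Φ ⁻¹' tsupport φ) v :=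
    IsTestFunction.of_contDiffOn Φ.open_source
      ((h.1.comp_contDiffOn hΦ).congr hvs) hKc (hKsub.trans Set.inter_subset_left) hKsub hvz
  have hΦd : ∀ x ∈ Φ.source, HasFDerivAt Φ (fderiv ℝ Φ x) x := fun x hx =>
    ((hΦ.contDiffAt (Φ.open_source.mem_nhds hx)).differentiableAt (by simp)).hasFDerivAt
  have hgrad : ∀ x ∈ Φ.source, ‖gradient v x‖ ≤ ‖gradient φ (Φ x)‖ * ‖fderiv ℝ Φ x‖ := by
    intro x hx
    have e1 : v =ᶠ[𝓝 x] fun x => φ (Φ x) :=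
      Filter.eventually_of_mem (Φ.open_source.mem_nhds hx) hvs
    have e2 : HasFDerivAt (fun x => φ (Φ x)) ((fderiv ℝ φ (Φ x)).comp (fderiv ℝ Φ x)) x :=
      (h.differentiable (Φ x)).hasFDerivAt.comp x (hΦd x hx)
    rw [norm_gradient_eq, norm_gradient_eq, (e2.congr_of_eventuallyEq e1).fderiv]
    exact ContinuousLinearMap.opNorm_comp_le _ _
  have hcv : ∀ q : EuclideanSpace ℝ (Fin n) → ℝ≥0∞, ∫⁻ y in Φ.target, q y =
      ∫⁻ x in Φ.source, ENNReal.ofReal |(fderiv ℝ Φ x).det| * q (Φ x) := fun q => by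
    rw [← Φ.image_source_eq_target]
    exact lintegral_image_eq_lintegral_abs_det_fderiv_mul volume
      Φ.open_source.measurableSet (fun x hx => (hΦd x hx).hasFDerivWithinAt) Φ.injOn q
  have hvz' : ∀ x ∉ Φ.source, x ∉ tsupport v := fun x hx hc => hx (htest.2.2 hc).1
  refine ⟨v, htest, ?_, ?_⟩
  · rw [← h.setLIntegral_gradient Φ.open_target, hcv,
      ← lintegral_const_mul' _ _ ENNReal.ofReal_ne_top,
      ← (htest.mono (htest.2.2.trans Set.inter_subset_left)).setLIntegral_gradient Φ.open_source]
    refine setLIntegral_mono' Φ.open_source.measurableSet fun x hx => ?_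
    rw [← ofReal_norm, ← ofReal_norm, ← ENNReal.ofReal_pow (norm_nonneg _),
      ← ENNReal.ofReal_pow (norm_nonneg _), ← ENNReal.ofReal_mul (abs_nonneg _),
      ← ENNReal.ofReal_mul hτ]
    refine ENNReal.ofReal_le_ofReal ?_
    calc ‖gradient v x‖ ^ 2 ≤ (‖gradient φ (Φ x)‖ * ‖fderiv ℝ Φ x‖) ^ 2 := by
          gcongr; exact hgrad x hx
      _ = ‖gradient φ (Φ x)‖ ^ 2 * ‖fderiv ℝ Φ x‖ ^ 2 := mul_pow _ _ _
      _ ≤ ‖gradient φ (Φ x)‖ ^ 2 * (τ * |(fderiv ℝ Φ x).det|) := by gcongr; exact h1 x hx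
      _ = _ := by ring
  · rw [hardyEnergy_eq_lintegral_ofReal, hardyEnergy_eq_lintegral_ofReal,
      ← setLIntegral_eq_lintegral_of_eq_zero (f := fun x => ENNReal.ofReal (φ x ^ 2 / ‖x‖ ^ 2))
      Φ.open_target.measurableSet (fun x hx => by simp [h.eq_zero_of_notMem hx]),
      hcv, ← lintegral_const_mul' _ _ ENNReal.ofReal_ne_top,
      ← setLIntegral_eq_lintegral_of_eq_zero
      (f := fun x => ENNReal.ofReal τ * ENNReal.ofReal (v x ^ 2 / ‖x‖ ^ 2))
      Φ.open_source.measurableSet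
      (fun x hx => by
        have : v x = 0 := image_eq_zero_of_notMem_tsupport (hvz' x hx)
        simp [this])]
    refine lintegral_mono_ae ?_
    filter_upwards [ae_restrict_mem Φ.open_source.measurableSet,
      ae_restrict_of_ae (Measure.ae_ne volume 0)] with x hx hx0
    rw [← ENNReal.ofReal_mul (abs_nonneg _), ← ENNReal.ofReal_mul hτ, hvs x hx]
    refine ENNReal.ofReal_le_ofReal ?_
    have hxp : 0 < ‖x‖ := norm_pos_iff.2 hx0
    -- Where Φ x = 0 the left-hand quotient is 0 by the convention for division by zero.
    rcases (norm_nonneg (Φ x)).eq_or_lt with hy | hy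
    · rw [← hy, zero_pow two_ne_zero, div_zero, mul_zero]; positivity
    · rw [mul_div_left_comm |_|, mul_div_left_comm τ]
      refine mul_le_mul_of_nonneg_left ?_ (by positivity)
      rw [div_le_div_iff₀ (by positivity) (by positivity)]
      exact h2 x hx

/-- Norm and determinant are continuous and equal 1 at the identity. The same η occurs in (1 - η)²
because a map with |Φ x - x| ≤ η|x| satisfies |Φ x| ≥ (1 - η)|x|. -/
theorem exists_det_bounds [NeZero n] {τ : ℝ} (hτ : 1 < τ) : ∃ η, 0 < η ∧ η < 1 ∧
    ∀ A : EuclideanSpace ℝ (Fin n) →L[ℝ] EuclideanSpace ℝ (Fin n),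
      ‖A - ContinuousLinearMap.id ℝ _‖ ≤ η →
      ‖A‖ ^ 2 ≤ τ * |A.det| ∧ |A.det| ≤ τ * (1 - η) ^ 2 := by
  have hdet : Continuous fun A : EuclideanSpace ℝ (Fin n) →L[ℝ] EuclideanSpace ℝ (Fin n) =>
      |A.det| := ContinuousLinearMap.continuous_det.abs
  have hid : (ContinuousLinearMap.id ℝ (EuclideanSpace ℝ (Fin n))).det = 1 := by
    rw [ContinuousLinearMap.det]
    exact LinearMap.det_id
  have : Nonempty (Fin n) := ⟨0⟩
  have h1 : ∀ᶠ A in 𝓝 (ContinuousLinearMap.id ℝ (EuclideanSpace ℝ (Fin n))),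
      ‖A‖ ^ 2 < τ * |A.det| := by
    refine ContinuousAt.eventually_lt (by fun_prop) (hdet.const_mul τ).continuousAt ?_
    rw [hid, ContinuousLinearMap.norm_id]; simpa using hτ
  -- The margin τ is split as √τ · √τ: one factor for the determinant, one for (1 - η)⁻².
  have hs : 1 < √τ := by rw [Real.lt_sqrt] <;> linarith
  have h2 : ∀ᶠ A in 𝓝 (ContinuousLinearMap.id ℝ (EuclideanSpace ℝ (Fin n))),
      |A.det| < √τ := by
    refine ContinuousAt.eventually_lt hdet.continuousAt (by fun_prop) ?_
    rw [hid]; simpa using hs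
  obtain ⟨η₁, hη₁, hb⟩ := Metric.eventually_nhds_iff.1 (h1.and h2)
  have h3 : ∀ᶠ η : ℝ in 𝓝[>] 0, √τ ≤ τ * (1 - η) ^ 2 ∧ η < η₁ ∧ η < 1 := by
    refine nhdsWithin_le_nhds ?_
    refine Eventually.and ?_ ((eventually_lt_nhds hη₁).and (eventually_lt_nhds one_pos))
    have : ∀ᶠ η : ℝ in 𝓝 0, √τ < τ * (1 - η) ^ 2 := by
      refine ContinuousAt.eventually_lt (by fun_prop) (by fun_prop) ?_
      have := Real.mul_self_sqrt (show 0 ≤ τ by linarith)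
      nlinarith
    exact this.mono fun _ => le_of_lt
  obtain ⟨η, ⟨ha, hb', hc⟩, hη⟩ := (h3.and self_mem_nhdsWithin).exists
  refine ⟨η, hη, hc, fun A hA => ?_⟩
  have := hb (y := A) (by rw [dist_eq_norm]; exact hA.trans_lt hb')
  exact ⟨this.1.le, this.2.le.trans ha⟩

/-- Near-identity diffeomorphisms almost preserve both energies. -/
theorem exists_pullback_of_near_id [NeZero n] {τ : ℝ} (hτ : 1 < τ) : ∃ η, 0 < η ∧
    ∀ Φ : OpenPartialHomeomorph (EuclideanSpace ℝ (Fin n)) (EuclideanSpace ℝ (Fin n)),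
      ContDiffOn ℝ ∞ Φ Φ.source →
      (∀ x ∈ Φ.source, ‖fderiv ℝ Φ x - ContinuousLinearMap.id ℝ _‖ ≤ η ∧
        ‖Φ x - x‖ ≤ η * ‖x‖) →
      ∀ φ, IsTestFunction Φ.target φ →
      ∃ v, IsTestFunction (Φ.source ∩ Φ ⁻¹' tsupport φ) v ∧
        dirichletEnergy v ≤ ENNReal.ofReal τ * dirichletEnergy φ ∧
        hardyEnergy φ ≤ ENNReal.ofReal τ * hardyEnergy v := by
  obtain ⟨η, hη, hη1, hA⟩ := exists_det_bounds (n := n) hτ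
  refine ⟨η, hη, fun Φ hΦ hb φ hφ => IsTestFunction.exists_pullback Φ hΦ (by linarith)
    (fun x hx => (hA _ (hb x hx).1).1) (fun x hx => ?_) hφ⟩
  have h1 := (hA _ (hb x hx).1).2
  have h2 : (1 - η) * ‖x‖ ≤ ‖Φ x‖ := by
    have := norm_sub_norm_le x (Φ x)
    rw [norm_sub_rev] at this
    linarith [(hb x hx).2]
  calc _ ≤ τ * (1 - η) ^ 2 * ‖x‖ ^ 2 := by gcongr
    _ = τ * ((1 - η) * ‖x‖) ^ 2 := by ring
    _ ≤ _ := by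
      have : 0 ≤ (1 - η) * ‖x‖ := mul_nonneg (by linarith) (norm_nonneg _)
      gcongr

/-- Continuity of the derivative gives closeness to the identity on a small ball. The mean value
inequality for Φ - id, which vanishes at 0, then bounds |Φ x - x| by η|x|. -/
theorem exists_pullback_local [NeZero n]
    (Φ : OpenPartialHomeomorph (EuclideanSpace ℝ (Fin n)) (EuclideanSpace ℝ (Fin n)))
    (hΦ : ContDiffOn ℝ ∞ Φ Φ.source) (h0 : 0 ∈ Φ.source) (hΦ0 : Φ 0 = 0)
    (hd : fderiv ℝ Φ 0 = ContinuousLinearMap.id ℝ _) {τ : ℝ} (hτ : 1 < τ) : ∃ δ, 0 < δ ∧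
      ∀ φ, IsTestFunction (Metric.ball 0 δ) φ →
      ∃ v, IsTestFunction (Φ.source ∩ Φ ⁻¹' tsupport φ) v ∧
        dirichletEnergy v ≤ ENNReal.ofReal τ * dirichletEnergy φ ∧
        hardyEnergy φ ≤ ENNReal.ofReal τ * hardyEnergy v := by
  obtain ⟨η, hη, hA⟩ := exists_pullback_of_near_id (n := n) hτ
  have hc : ContinuousAt (fderiv ℝ Φ) 0 :=
    (hΦ.continuousOn_fderiv_of_isOpen Φ.open_source (by simp)).continuousAt
      (Φ.open_source.mem_nhds h0)
  have hev : ∀ᶠ x in 𝓝 (0 : EuclideanSpace ℝ (Fin n)), x ∈ Φ.source ∧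
      ‖fderiv ℝ Φ x - ContinuousLinearMap.id ℝ _‖ < η := by
    refine (Φ.open_source.eventually_mem h0).and ?_
    refine ContinuousAt.eventually_lt (by fun_prop) (by fun_prop) ?_
    rw [hd, sub_self, norm_zero]; exact hη
  obtain ⟨r, hr, hball⟩ := Metric.eventually_nhds_iff_ball.1 hev
  set Ψ := Φ.restrOpen (Metric.ball 0 r) Metric.isOpen_ball with hΨ
  have hs : Ψ.source = Metric.ball 0 r := by
    rw [hΨ, Φ.restrOpen_source]
    exact Set.inter_eq_self_of_subset_right fun x hx => (hball x hx).1
  have h0Ψ : 0 ∈ Ψ.target := by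
    have : (0 : EuclideanSpace ℝ (Fin n)) ∈ Ψ.source := by rw [hs]; simpa using hr
    simpa [hΨ, hΦ0] using Ψ.map_source this
  obtain ⟨δ, hδ, hδt⟩ := Metric.isOpen_iff.1 Ψ.open_target 0 h0Ψ
  refine ⟨δ, hδ, fun φ hφ => ?_⟩
  have hb : ∀ x ∈ Ψ.source, ‖fderiv ℝ Ψ x - ContinuousLinearMap.id ℝ _‖ ≤ η ∧
      ‖Ψ x - x‖ ≤ η * ‖x‖ := by
    rw [hs]
    intro x hx
    refine ⟨(hball x hx).2.le, ?_⟩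
    have hmv := (convex_ball (0 : EuclideanSpace ℝ (Fin n)) r).norm_image_sub_le_of_norm_fderiv_le
      (𝕜 := ℝ) (f := fun x => Φ x - x) (C := η) (x := 0) (y := x) ?_ ?_ (by simpa using hr) hx
    · simpa [hΦ0, hΨ] using hmv
    · intro y hy
      exact ((hΦ.contDiffAt (Φ.open_source.mem_nhds (hball y hy).1)).differentiableAt
        (by simp)).sub differentiableAt_id
    · intro y hy
      have h1 := ((hΦ.contDiffAt (Φ.open_source.mem_nhds (hball y hy).1)).differentiableAt
        (by simp)).hasFDerivAt.sub (hasFDerivAt_id y)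
      rw [show fderiv ℝ (fun x => Φ x - x) y = _ from h1.fderiv]
      exact (hball y hy).2.le
  obtain ⟨v, hv, hv1, hv2⟩ := hA Ψ (hΦ.mono (by rw [hs]; exact fun x hx => (hball x hx).1)) hb φ
    (hφ.mono (hφ.2.2.trans hδt))
  refine ⟨v, hv.mono (hv.2.2.trans ?_), hv1, hv2⟩
  rw [hs]
  exact fun x hx => ⟨(hball x hx.1).1, hx.2⟩

end Transport

/-! ### Interior and boundary singularities -/

section BoundaryPoint

variable {n : ℕ} {Ω : Set (EuclideanSpace ℝ (Fin n))}

theorem ENNReal.le_ofReal_of_forall_pos_le {a : ℝ≥0∞} {c : ℝ}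
    (h : ∀ ε : ℝ, 0 < ε → a ≤ ENNReal.ofReal (c + ε)) : a ≤ ENNReal.ofReal c := by
  have h1 : Tendsto (fun k : ℕ => ENNReal.ofReal (c + 1 / ((k : ℝ) + 1))) atTop
      (𝓝 (ENNReal.ofReal (c + 0))) :=
    ENNReal.tendsto_ofReal (tendsto_const_nhds.add tendsto_one_div_add_atTop_nhds_zero_nat)
  rw [add_zero] at h1
  exact ge_of_tendsto' h1 fun k => h _ (by positivity)

theorem hardyConstant_eq_of_zero_mem (hn : 3 ≤ n) (hΩ : IsOpen Ω) (h0 : 0 ∈ Ω) :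
    hardyConstant Ω = ENNReal.ofReal (((n : ℝ) - 2) ^ 2 / 4) := by
  refine le_antisymm (ENNReal.le_ofReal_of_forall_pos_le fun ε hε => ?_) (hardyConstant_ge hn hΩ)
  obtain ⟨δ, hδ, hball⟩ := Metric.isOpen_iff.1 hΩ 0 h0
  obtain ⟨φ, hφ, hlt⟩ := exists_isTestFunction_ball hn hε hδ
  exact (hardyConstant_lt hn hΩ ENNReal.ofReal_ne_top
    (hφ.mono (hφ.2.2.trans (Set.inter_subset_right.trans hball))) hlt).le

variable [NeZero n]

/-- Near a boundary point at the origin, a smooth domain is the image of a half-space under a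
diffeomorphism tangent to the identity. -/
theorem IsSmoothDomain.exists_flattening (hΩ : IsSmoothDomain Ω) (h0 : 0 ∈ frontier Ω) :
    ∃ ν : EuclideanSpace ℝ (Fin n), ν ≠ 0 ∧
      ∃ Φ : OpenPartialHomeomorph (EuclideanSpace ℝ (Fin n)) (EuclideanSpace ℝ (Fin n)),
        ContDiffOn ℝ ∞ Φ Φ.source ∧ ContDiffOn ℝ ∞ Φ.symm Φ.target ∧
        0 ∈ Φ.source ∧ Φ 0 = 0 ∧ fderiv ℝ Φ 0 = ContinuousLinearMap.id ℝ _ ∧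
        fderiv ℝ Φ.symm 0 = ContinuousLinearMap.id ℝ _ ∧
        ∀ x ∈ Φ.source, (Φ x ∈ Ω ↔ 0 < ⟪ν, x⟫) := by
  obtain ⟨φ, hs, h00, hφ, hφs, hΩφ⟩ := hΩ.exists_chart 0 h0
  have ht : (0 : EuclideanSpace ℝ (Fin n)) ∈ φ.target := by simpa [h00] using φ.map_source hs
  have h00s : φ.symm 0 = 0 := by rw [← h00]; exact (φ.left_inv hs).trans h00.symm
  set A := fderiv ℝ φ 0 with hA
  set B := fderiv ℝ φ.symm 0 with hB
  have hdA : HasFDerivAt φ A 0 :=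
    ((hφ.contDiffAt (φ.open_source.mem_nhds hs)).differentiableAt (by simp)).hasFDerivAt
  have hdB : HasFDerivAt φ.symm B 0 :=
    ((hφs.contDiffAt (φ.open_target.mem_nhds ht)).differentiableAt (by simp)).hasFDerivAt
  have hAB : A.comp B = ContinuousLinearMap.id ℝ _ := by
    have h1 : HasFDerivAt (φ ∘ φ.symm) (A.comp B) 0 := by
      refine HasFDerivAt.comp 0 ?_ hdB
      rw [h00s]; exact hdA
    have h2 : φ ∘ φ.symm =ᶠ[𝓝 0] id :=
      Filter.eventually_of_mem (φ.open_target.mem_nhds ht) fun x hx => φ.right_inv hx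
    exact h1.unique ((hasFDerivAt_id 0).congr_of_eventuallyEq h2)
  have hBA : B.comp A = ContinuousLinearMap.id ℝ _ := by
    have h1 : HasFDerivAt (φ.symm ∘ φ) (B.comp A) 0 := by
      refine HasFDerivAt.comp 0 ?_ hdA
      rw [h00]; exact hdB
    have h2 : φ.symm ∘ φ =ᶠ[𝓝 0] id :=
      Filter.eventually_of_mem (φ.open_source.mem_nhds hs) fun x hx => φ.left_inv hx
    exact h1.unique ((hasFDerivAt_id 0).congr_of_eventuallyEq h2)
  -- Precomposing the chart with the inverse of its derivative at 0 makes it tangent to the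
  -- identity. The half-space {x₁ > 0} is turned into one whose normal ν represents the first
  -- coordinate of L.
  let L : EuclideanSpace ℝ (Fin n) ≃L[ℝ] EuclideanSpace ℝ (Fin n) :=
    ContinuousLinearEquiv.equivOfInverse B A (fun x => congrArg (fun T => T x) hAB)
      (fun x => congrArg (fun T => T x) hBA)
  let ℓ : StrongDual ℝ (EuclideanSpace ℝ (Fin n)) := (EuclideanSpace.proj 0).comp B
  have hℓ : ∀ x, ⟪(InnerProductSpace.toDual ℝ _).symm ℓ, x⟫ = (B x) 0 := fun x => by
    rw [InnerProductSpace.toDual_symm_apply]; rfl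
  refine ⟨(InnerProductSpace.toDual ℝ _).symm ℓ, ?_,
    L.toHomeomorph.transOpenPartialHomeomorph φ, ?_, ?_, ?_, ?_, ?_, ?_, ?_⟩
  · intro h
    have := hℓ (A (EuclideanSpace.single 0 1))
    rw [h, inner_zero_left] at this
    have h2 : B (A (EuclideanSpace.single 0 1)) = EuclideanSpace.single 0 1 :=
      congrArg (fun T => T (EuclideanSpace.single 0 1)) hBA
    rw [h2] at this
    simp at this
  · exact hφ.comp L.contDiff.contDiffOn fun x hx => hx
  · exact L.symm.contDiff.comp_contDiffOn hφs
  · change L 0 ∈ φ.source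
    rw [map_zero]; exact hs
  · change φ (L 0) = 0
    rw [map_zero]; exact h00
  · have : HasFDerivAt (φ ∘ L) (A.comp B) 0 := by
      refine HasFDerivAt.comp 0 ?_ L.hasFDerivAt
      rw [map_zero]; exact hdA
    rw [hAB] at this
    exact this.fderiv
  · have : HasFDerivAt (L.symm ∘ φ.symm) (A.comp B) 0 := HasFDerivAt.comp 0 L.symm.hasFDerivAt hdB
    rw [hAB] at this
    exact this.fderiv
  · intro x hx
    rw [hℓ]
    exact (hΩφ (L x) hx).1

/-- The square makes room for two losses of a factor τ in a transport, one for each energy. -/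
theorem exists_sq_mul_lt {c d : ℝ} (h : c < d) : ∃ τ : ℝ, 1 < τ ∧ τ ^ 2 * c < d := by
  have : ∀ᶠ τ : ℝ in 𝓝[>] 1, τ ^ 2 * c < d := by
    refine nhdsWithin_le_nhds (ContinuousAt.eventually_lt (by fun_prop) (by fun_prop) ?_)
    simpa using h
  obtain ⟨τ, h1, h2⟩ := (this.and self_mem_nhdsWithin).exists
  exact ⟨τ, h2, h1⟩

/-- The Hardy inequality near a smooth boundary point, with a constant close to `n²/4`. -/
theorem IsSmoothDomain.hardy_local (hΩ : IsSmoothDomain Ω) (h0 : 0 ∈ frontier Ω) {c : ℝ}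
    (hc0 : 0 ≤ c) (hc : c < (n : ℝ) ^ 2 / 4) : ∃ δ, 0 < δ ∧
    ∀ φ, IsTestFunction (Ω ∩ Metric.ball 0 δ) φ →
      ENNReal.ofReal c * hardyEnergy φ ≤ dirichletEnergy φ := by
  obtain ⟨τ, hτ1, hτ⟩ := exists_sq_mul_lt hc
  obtain ⟨ν, -, Φ, hΦ, -, hs, hΦ0, hd, -, hΩΦ⟩ := hΩ.exists_flattening h0
  obtain ⟨δ, hδ, hpull⟩ := exists_pullback_local Φ hΦ hs hΦ0 hd hτ1
  refine ⟨δ, hδ, fun φ hφ => ?_⟩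
  obtain ⟨v, hv, hv1, hv2⟩ := hpull φ (hφ.mono (hφ.2.2.trans Set.inter_subset_right))
  have hvH := hv.hardy_halfSpace (ν := ν)
    (hv.2.2.trans fun x hx => (hΩΦ x hx.1).1 (hφ.2.2 hx.2).1)
  have hτ0 : 0 < τ := by linarith
  -- Transport to the half-space costs τ in the Hardy energy and τ in the Dirichlet energy; τ²c <
  -- n²/4 absorbs both.
  have key : ENNReal.ofReal τ * (ENNReal.ofReal c * hardyEnergy φ) ≤
      ENNReal.ofReal τ * dirichletEnergy φ :=
    calc _ ≤ ENNReal.ofReal τ * (ENNReal.ofReal c * (ENNReal.ofReal τ * hardyEnergy v)) := by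
          gcongr
      _ = ENNReal.ofReal (τ ^ 2 * c) * hardyEnergy v := by
          rw [← mul_assoc, ← mul_assoc, ← ENNReal.ofReal_mul hτ0.le,
            ← ENNReal.ofReal_mul (by positivity)]
          congr 2; ring
      _ ≤ ENNReal.ofReal ((n : ℝ) ^ 2 / 4) * hardyEnergy v := by gcongr
      _ ≤ _ := hvH.trans hv1
  rwa [ENNReal.mul_le_mul_iff_right (by simpa using hτ0) ENNReal.ofReal_ne_top] at key

/-- Near-optimal functions of the tangent half-space, concentrated at the origin, are carried into
Ω. Pulling back by `Φ.symm` does this, so the derivative of the inverse chart is the one needed. -/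
theorem IsSmoothDomain.hardyConstant_le (hn : 3 ≤ n) (hΩ : IsSmoothDomain Ω)
    (h0 : 0 ∈ frontier Ω) : hardyConstant Ω ≤ ENNReal.ofReal ((n : ℝ) ^ 2 / 4) := by
  refine ENNReal.le_ofReal_of_forall_pos_le fun ε hε => ?_
  obtain ⟨τ, hτ1, hτ⟩ := exists_sq_mul_lt (c := (n : ℝ) ^ 2 / 4 + ε / 2) (d := (n : ℝ) ^ 2 / 4 + ε)
    (by linarith)
  have hτ0 : 0 < τ := by linarith
  obtain ⟨ν, hν, Φ, -, hΦs, hs, hΦ0, -, hd, hΩΦ⟩ := hΩ.exists_flattening h0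
  have ht : (0 : EuclideanSpace ℝ (Fin n)) ∈ Φ.target := by simpa [hΦ0] using Φ.map_source hs
  have h00s : Φ.symm 0 = 0 := by rw [← hΦ0]; exact (Φ.left_inv hs).trans hΦ0.symm
  obtain ⟨δ, hδ, hpull⟩ := exists_pullback_local Φ.symm hΦs ht h00s hd hτ1
  obtain ⟨φ, hφ, hlt⟩ := exists_isTestFunction_halfBall (NeZero.ne n) hν (half_pos hε) hδ
  obtain ⟨u, hu, hu1, hu2⟩ := hpull φ (hφ.mono (hφ.2.2.trans Set.inter_subset_right))
  refine (hardyConstant_lt hn hΩ.isOpen ENNReal.ofReal_ne_top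
    (hu.mono (hu.2.2.trans fun y hy => ?_)) ?_).le
  · have h1 := (hφ.2.2 hy.2).1
    have h2 := (hΩΦ (Φ.symm y) (Φ.map_target hy.1)).2 h1
    rwa [Φ.right_inv hy.1] at h2
  · calc dirichletEnergy u ≤ ENNReal.ofReal τ * dirichletEnergy φ := hu1
      _ < ENNReal.ofReal τ * (ENNReal.ofReal ((n : ℝ) ^ 2 / 4 + ε / 2) * hardyEnergy φ) :=
          ENNReal.mul_lt_mul_right (by simpa using hτ0) ENNReal.ofReal_ne_top hlt
      _ ≤ ENNReal.ofReal τ * (ENNReal.ofReal ((n : ℝ) ^ 2 / 4 + ε / 2) *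
          (ENNReal.ofReal τ * hardyEnergy u)) := by gcongr
      _ = ENNReal.ofReal (τ ^ 2 * ((n : ℝ) ^ 2 / 4 + ε / 2)) * hardyEnergy u := by
          rw [← mul_assoc, ← mul_assoc, ← ENNReal.ofReal_mul hτ0.le,
            ← ENNReal.ofReal_mul (by positivity)]
          congr 2; ring
      _ ≤ _ := by gcongr

theorem halfSpace_eq : halfSpace n = {x | 0 < ⟪EuclideanSpace.single 0 (1 : ℝ), x⟫} := by
  ext x
  simp [halfSpace, EuclideanSpace.inner_single_left]

theorem hardyConstant_ge_of_subset_halfSpace (hn : 3 ≤ n) (hΩ : IsOpen Ω) (h : Ω ⊆ halfSpace n) :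
    ENNReal.ofReal ((n : ℝ) ^ 2 / 4) ≤ hardyConstant Ω := by
  rw [le_hardyConstant_iff hn hΩ ENNReal.ofReal_ne_top]
  intro φ hφ
  rw [halfSpace_eq] at h
  exact hφ.hardy_halfSpace (hφ.2.2.trans h)

end BoundaryPoint

/-! ### Localization and the strict lower bound -/

section Localization

variable {n : ℕ} {Ω : Set (EuclideanSpace ℝ (Fin n))} {φ θ : EuclideanSpace ℝ (Fin n) → ℝ}

/-- The difference of the two sides is |cos θ ∇φ - φ sin θ ∇θ|². Writing the cutoff as sin θ keeps
the coefficient of |∇φ|² equal to 1, so localization costs only an L² term and no part of the Hardy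
constant. -/
theorem IsTestFunction.norm_gradient_sin_mul_sq_le (h : IsTestFunction Ω φ)
    (hθ : Differentiable ℝ θ) (x : EuclideanSpace ℝ (Fin n)) :
    ‖gradient (fun x => Real.sin (θ x) * φ x) x‖ ^ 2 ≤
      ‖gradient φ x‖ ^ 2 + ‖gradient θ x‖ ^ 2 * φ x ^ 2 := by
  have h1 := ((Real.hasDerivAt_sin (θ x)).comp_hasGradientAt
    (hθ x).hasGradientAt).fun_mul (h.hasGradientAt x)
  rw [h1.gradient, norm_add_sq_real]
  simp only [norm_smul, mul_pow, inner_smul_left, inner_smul_right, Real.norm_eq_abs, sq_abs,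
    conj_trivial]
  have h2 : 0 ≤ ‖Real.cos (θ x) • gradient φ x - (φ x * Real.sin (θ x)) • gradient θ x‖ ^ 2 := by
    positivity
  rw [norm_sub_sq_real] at h2
  simp only [norm_smul, mul_pow, inner_smul_left, inner_smul_right, Real.norm_eq_abs, sq_abs,
    conj_trivial] at h2
  have h3 := Real.sin_sq_add_cos_sq (θ x)
  have h4 : Real.cos (θ x) ^ 2 = 1 - Real.sin (θ x) ^ 2 := by linarith
  rw [h4] at h2 ⊢
  nlinarith

variable [NeZero n]

/-- A Gårding type inequality with constant close to `n²/4`. -/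
theorem IsSmoothDomain.hardy_garding (hΩ : IsSmoothDomain Ω) (h0 : 0 ∈ frontier Ω) {c : ℝ}
    (hc0 : 0 ≤ c) (hc : c < (n : ℝ) ^ 2 / 4) : ∃ C, 0 ≤ C ∧ ∀ φ, IsTestFunction Ω φ →
      c * (∫ x, φ x ^ 2 / ‖x‖ ^ 2) ≤ (∫ x, ‖gradient φ x‖ ^ 2) + C * ∫ x, φ x ^ 2 := by
  obtain ⟨δ, hδ, hloc⟩ := hΩ.hardy_local h0 hc0 hc
  let b : ContDiffBump (0 : EuclideanSpace ℝ (Fin n)) :=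
    ⟨δ / 3, δ / 2, by positivity, by linarith⟩
  -- Thus sin θ is 1 for |x| ≤ δ/3 and 0 for |x| ≥ δ/2.
  set θ : EuclideanSpace ℝ (Fin n) → ℝ := fun x => Real.pi / 2 * b x with hθ
  have hθc : ContDiff ℝ ∞ θ := contDiff_const.mul b.contDiff
  have hθs : HasCompactSupport θ := b.hasCompactSupport.mul_left
  have hθd : Differentiable ℝ θ := hθc.differentiable (by simp)
  obtain ⟨M, hM⟩ := (hθs.fderiv ℝ).exists_bound_of_continuous (hθc.continuous_fderiv (by simp))
  have h0Ω : (0 : EuclideanSpace ℝ (Fin n)) ∉ Ω := fun h => by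
    rw [hΩ.isOpen.frontier_eq] at h0; exact h0.2 h
  -- M² bounds |∇θ|², and (3/δ)² bounds |x|⁻² outside the ball where the cutoff is 1.
  refine ⟨M ^ 2 + c * (3 / δ) ^ 2, by positivity, fun φ hφ => ?_⟩
  have hφ0 : 0 ∉ tsupport φ := fun h => h0Ω (hφ.2.2 h)
  have hφ1 : IsTestFunction Ω (fun x => Real.sin (θ x) * φ x) :=
    hφ.mul_left (Real.contDiff_sin.comp hθc)
  have hφ10 : 0 ∉ tsupport (fun x => Real.sin (θ x) * φ x) := fun h => h0Ω (hφ1.2.2 h)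
  have hs : tsupport (fun x => Real.sin (θ x) * φ x) ⊆ Metric.closedBall 0 (δ / 2) := by
    refine tsupport_subset_of_eq_zero Metric.isClosed_closedBall fun x hx => ?_
    have : b x = 0 := b.zero_of_le_dist (not_le.1 hx).le
    simp [hθ, this]
  have hsub : tsupport (fun x => Real.sin (θ x) * φ x) ⊆ Ω ∩ Metric.ball 0 δ := fun x hx =>
    ⟨hφ1.2.2 hx, Metric.closedBall_subset_ball (by linarith) (hs hx)⟩
  have h1 := hloc _ (hφ1.mono hsub)
  rw [hφ1.mul_hardyEnergy_le_iff hφ10 hc0] at h1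
  have h2 : ∫ x, ‖gradient (fun x => Real.sin (θ x) * φ x) x‖ ^ 2 ≤
      (∫ x, ‖gradient φ x‖ ^ 2) + M ^ 2 * ∫ x, φ x ^ 2 := by
    rw [← integral_const_mul, ← integral_add hφ.integrable_norm_gradient_sq
      (hφ.integrable_sq.const_mul _)]
    refine integral_mono hφ1.integrable_norm_gradient_sq
      (hφ.integrable_norm_gradient_sq.add (hφ.integrable_sq.const_mul _)) fun x => ?_
    refine (hφ.norm_gradient_sin_mul_sq_le hθd x).trans ?_
    have : ‖gradient θ x‖ ≤ M := by rw [norm_gradient_eq]; exact hM x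
    beta_reduce
    gcongr
  have h3 : ∫ x, φ x ^ 2 / ‖x‖ ^ 2 ≤ (∫ x, (Real.sin (θ x) * φ x) ^ 2 / ‖x‖ ^ 2) +
      (3 / δ) ^ 2 * ∫ x, φ x ^ 2 := by
    rw [← integral_const_mul, ← integral_add (hφ1.integrable_sq_div hφ10)
      (hφ.integrable_sq.const_mul _)]
    refine integral_mono (hφ.integrable_sq_div hφ0)
      ((hφ1.integrable_sq_div hφ10).add (hφ.integrable_sq.const_mul _)) fun x => ?_
    beta_reduce
    by_cases hx : x ∈ Metric.closedBall (0 : EuclideanSpace ℝ (Fin n)) (δ / 3)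
    · have : b x = 1 := b.one_of_mem_closedBall hx
      simp only [hθ, this, mul_one, Real.sin_pi_div_two, one_mul]
      exact le_add_of_nonneg_right (by positivity)
    · have hx' : δ / 3 ≤ ‖x‖ := by
        rw [mem_closedBall_zero_iff, not_le] at hx; exact hx.le
      have hxp : 0 < ‖x‖ := lt_of_lt_of_le (by positivity) hx'
      refine le_trans ?_ (le_add_of_nonneg_left (by positivity))
      rw [div_le_iff₀ (by positivity)]
      have h4 : 1 ≤ (3 / δ) * ‖x‖ := by
        rw [div_mul_eq_mul_div, le_div_iff₀ hδ]; linarith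
      have h5 : 1 ≤ ((3 / δ) * ‖x‖) ^ 2 := one_le_pow₀ h4
      calc φ x ^ 2 = φ x ^ 2 * 1 := (mul_one _).symm
        _ ≤ φ x ^ 2 * ((3 / δ) * ‖x‖) ^ 2 := by gcongr
        _ = _ := by ring
  have h4 := mul_le_mul_of_nonneg_left h3 hc0
  nlinarith

/-- A convex combination of two inequalities: `IsSmoothDomain.hardy_garding`, with a constant c
above (n-2)²/4 but error -C∫φ², and `IsTestFunction.hardy_remainder`, with the critical constant and
gain R⁻²∫φ². -/
theorem IsSmoothDomain.lt_hardyConstant (hn : 3 ≤ n) (hΩ : IsSmoothDomain Ω)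
    (hb : Bornology.IsBounded Ω) (h0 : 0 ∈ frontier Ω) :
    ENNReal.ofReal (((n : ℝ) - 2) ^ 2 / 4) < hardyConstant Ω := by
  have hn' : (3 : ℝ) ≤ n := by exact_mod_cast hn
  obtain ⟨R, hR0, hR⟩ : ∃ R, 0 < R ∧ Ω ⊆ Metric.closedBall 0 R := by
    obtain ⟨R, hR⟩ := hb.subset_closedBall 0
    exact ⟨max R 1, by positivity, hR.trans (Metric.closedBall_subset_closedBall (le_max_left _ _))⟩
  have h0Ω : (0 : EuclideanSpace ℝ (Fin n)) ∉ Ω := fun h => by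
    rw [hΩ.isOpen.frontier_eq] at h0; exact h0.2 h
  set a := ((n : ℝ) - 2) ^ 2 / 4 with ha
  obtain ⟨c, hac, hcn⟩ : ∃ c, a < c ∧ c < (n : ℝ) ^ 2 / 4 := exists_between (by rw [ha]; nlinarith)
  have ha0 : 0 ≤ a := by positivity
  obtain ⟨C, hC0, hC⟩ := hΩ.hardy_garding h0 (ha0.trans hac.le) hcn
  -- The weight for which tC = (1 - t)R⁻², so that the zero-order terms cancel exactly.
  set t := (1 + C * R ^ 2)⁻¹ with ht
  have ht0 : 0 < t := by positivity
  have ht1 : t * (1 + C * R ^ 2) = 1 := inv_mul_cancel₀ (by positivity)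
  have ht2 : 0 ≤ 1 - t := by nlinarith [mul_nonneg ht0.le (mul_nonneg hC0 (sq_nonneg R))]
  have htC : t * C = (1 - t) * R⁻¹ ^ 2 := by
    have : R ^ 2 * R⁻¹ ^ 2 = 1 := by rw [← mul_pow, mul_inv_cancel₀ hR0.ne', one_pow]
    linear_combination R⁻¹ ^ 2 * ht1 - t * C * this
  refine lt_of_lt_of_le (b := ENNReal.ofReal (t * c + (1 - t) * a)) ?_ ?_
  · rw [ENNReal.ofReal_lt_ofReal_iff (by nlinarith)]
    nlinarith
  · rw [le_hardyConstant_iff hn hΩ.isOpen ENNReal.ofReal_ne_top]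
    intro φ hφ
    have hφ0 : 0 ∉ tsupport φ := fun h => h0Ω (hφ.2.2 h)
    rw [hφ.mul_hardyEnergy_le_iff hφ0 (by nlinarith)]
    have h1 := mul_le_mul_of_nonneg_left (hC φ hφ) ht0.le
    have h2 := mul_le_mul_of_nonneg_left (hφ.hardy_remainder (by omega) hφ0 hR0
      (hφ.2.2.trans hR)) ht2
    set I := ∫ x, φ x ^ 2 / ‖x‖ ^ 2
    set J := ∫ x, ‖gradient φ x‖ ^ 2
    set N := ∫ x, φ x ^ 2
    have h3 : t * C * N = (1 - t) * R⁻¹ ^ 2 * N := by rw [htC]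
    rw [← ha] at h2
    linarith

end Localization

/-! ### Translates and averages of test functions -/

section Averages

variable {n : ℕ} {Ω : Set (EuclideanSpace ℝ (Fin n))} {φ : EuclideanSpace ℝ (Fin n) → ℝ}

theorem enorm_integral_sq_le {X : Type*} [MeasurableSpace X] {μ : Measure X}
    [IsProbabilityMeasure μ] {f : X → ℝ} (hf : AEStronglyMeasurable f μ) :
    ‖∫ x, f x ∂μ‖ₑ ^ 2 ≤ ∫⁻ x, ‖f x‖ₑ ^ 2 ∂μ := by
  rw [← eLpNorm_two_sq]
  gcongr
  calc ‖∫ x, f x ∂μ‖ₑ ≤ ∫⁻ x, ‖f x‖ₑ ∂μ := enorm_integral_le_lintegral_enorm f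
    _ = eLpNorm f 1 μ := eLpNorm_one_eq_lintegral_enorm.symm
    _ ≤ eLpNorm f 2 μ := eLpNorm_le_eLpNorm_of_exponent_le (by norm_num) hf

/-- The difference is the integral of ⟨∇φ(x + ty), y⟩ over 0 < t ≤ 1. Jensen, Cauchy–Schwarz,
Tonelli and translation invariance finish. -/
theorem IsTestFunction.lintegral_translate_sub_le (h : IsTestFunction Ω φ)
    (y : EuclideanSpace ℝ (Fin n)) :
    ∫⁻ x, ‖φ (x + y) - φ x‖ₑ ^ 2 ≤ ‖y‖ₑ ^ 2 * dirichletEnergy φ := by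
  have hg := h.continuous_gradient
  have : IsProbabilityMeasure (volume.restrict (Set.Ioc (0 : ℝ) 1)) := ⟨by simp⟩
  have hpt : ∀ x, ‖φ (x + y) - φ x‖ₑ ^ 2 ≤
      ∫⁻ t in Set.Ioc (0 : ℝ) 1, ‖y‖ₑ ^ 2 * ‖gradient φ (x + t • y)‖ₑ ^ 2 := by
    intro x
    have hd : ∀ t : ℝ, HasDerivAt (fun t : ℝ => φ (x + t • y)) ⟪gradient φ (x + t • y), y⟫ t := by
      intro t
      have h1 : HasDerivAt (fun t : ℝ => x + t • y) y t := by
        simpa using ((hasDerivAt_id t).smul_const y).const_add x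
      have := (h.hasGradientAt (x + t • y)).hasFDerivAt.comp_hasDerivAt t h1
      rw [InnerProductSpace.toDual_apply_apply] at this
      exact this
    have hc : Continuous fun t : ℝ => ⟪gradient φ (x + t • y), y⟫ := by fun_prop
    have h2 := intervalIntegral.integral_eq_sub_of_hasDerivAt (fun t _ => hd t)
      (hc.intervalIntegrable 0 1)
    rw [one_smul, zero_smul, add_zero, intervalIntegral.integral_of_le zero_le_one] at h2
    rw [← h2]
    refine (enorm_integral_sq_le hc.aestronglyMeasurable).trans (lintegral_mono fun t => ?_)
    rw [mul_comm, ← mul_pow]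
    gcongr
    rw [← ofReal_norm, ← ofReal_norm, ← ofReal_norm, ← ENNReal.ofReal_mul (norm_nonneg _)]
    exact ENNReal.ofReal_le_ofReal (norm_inner_le_norm _ _)
  calc _ ≤ ∫⁻ x, ∫⁻ t in Set.Ioc (0 : ℝ) 1, ‖y‖ₑ ^ 2 * ‖gradient φ (x + t • y)‖ₑ ^ 2 :=
        lintegral_mono hpt
    _ = ∫⁻ t in Set.Ioc (0 : ℝ) 1, ∫⁻ x, ‖y‖ₑ ^ 2 * ‖gradient φ (x + t • y)‖ₑ ^ 2 := by
        refine lintegral_lintegral_swap (Measurable.aemeasurable ?_)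
        have : Continuous fun p : EuclideanSpace ℝ (Fin n) × ℝ => gradient φ (p.1 + p.2 • y) := by
          fun_prop
        have := this.measurable
        simp only [Function.uncurry_def]
        fun_prop
    _ = ∫⁻ t in Set.Ioc (0 : ℝ) 1, ‖y‖ₑ ^ 2 * dirichletEnergy φ := by
        refine lintegral_congr fun t => ?_
        rw [lintegral_const_mul _ (by have := hg.measurable; fun_prop), dirichletEnergy,
          lintegral_add_right_eq_self (fun x => ‖gradient φ x‖ₑ ^ 2)]
    _ = _ := by simp

/-- The average of `φ` against translates of `μ`. -/
noncomputable def translateAverage (μ : Measure (EuclideanSpace ℝ (Fin n)))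
    (φ : EuclideanSpace ℝ (Fin n) → ℝ) (x : EuclideanSpace ℝ (Fin n)) : ℝ := ∫ y, φ (x + y) ∂μ

variable {μ : Measure (EuclideanSpace ℝ (Fin n))} [IsProbabilityMeasure μ]

theorem stronglyMeasurable_translateAverage (hφ : Continuous φ) :
    StronglyMeasurable (translateAverage μ φ) := by
  have : Continuous fun p : EuclideanSpace ℝ (Fin n) × EuclideanSpace ℝ (Fin n) =>
    φ (p.1 + p.2) := by fun_prop
  exact this.stronglyMeasurable.integral_prod_right'

theorem IsTestFunction.lintegral_translateAverage_sub_le (h : IsTestFunction Ω φ) {s : ℝ}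
    (hμ : ∀ᵐ y ∂μ, ‖y‖ ≤ s) :
    ∫⁻ x, ‖translateAverage μ φ x - φ x‖ₑ ^ 2 ≤ ENNReal.ofReal s ^ 2 * dirichletEnergy φ := by
  have hφ := h.continuous
  have hpt : ∀ x, ‖translateAverage μ φ x - φ x‖ₑ ^ 2 ≤ ∫⁻ y, ‖φ (x + y) - φ x‖ₑ ^ 2 ∂μ := by
    intro x
    have hc : Continuous fun y => φ (x + y) := by fun_prop
    obtain ⟨C, hC⟩ := h.2.1.exists_bound_of_continuous hφ
    have hi : Integrable (fun y => φ (x + y)) μ :=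
      Integrable.of_bound hc.aestronglyMeasurable C (ae_of_all _ fun y => hC _)
    have e : translateAverage μ φ x - φ x = ∫ y, (φ (x + y) - φ x) ∂μ := by
      rw [integral_sub hi (integrable_const _)]
      simp [translateAverage]
    rw [e]
    exact enorm_integral_sq_le (by fun_prop)
  calc _ ≤ ∫⁻ x, ∫⁻ y, ‖φ (x + y) - φ x‖ₑ ^ 2 ∂μ := lintegral_mono hpt
    _ = ∫⁻ y, (∫⁻ x, ‖φ (x + y) - φ x‖ₑ ^ 2) ∂μ := by
        refine lintegral_lintegral_swap (Measurable.aemeasurable ?_)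
        have : Continuous fun p : EuclideanSpace ℝ (Fin n) × EuclideanSpace ℝ (Fin n) =>
          φ (p.1 + p.2) - φ p.1 := by fun_prop
        have := this.measurable
        simp only [Function.uncurry_def]
        fun_prop
    _ ≤ ∫⁻ y, ENNReal.ofReal s ^ 2 * dirichletEnergy φ ∂μ := by
        refine lintegral_mono_ae ?_
        filter_upwards [hμ] with y hy
        refine (h.lintegral_translate_sub_le y).trans ?_
        gcongr
        rw [← ofReal_norm]
        exact ENNReal.ofReal_le_ofReal hy
    _ = _ := by simp

end Averages

/-! ### Rellich compactness -/

section Rellich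

variable {n : ℕ} {Ω : Set (EuclideanSpace ℝ (Fin n))}

/-- A bounded sequence in `L²` has a subsequence whose integrals over sets of finite measure
converge. -/
theorem exists_subseq_tendsto_setIntegral {X : Type*} [MeasurableSpace X] {μ : Measure X}
    [SigmaFinite μ] [MeasurableSpace.CountablyGenerated X] {f : ℕ → X → ℝ}
    (hf : ∀ k, MemLp (f k) 2 μ) {M : ℝ} (hM : ∀ k, ‖(hf k).toLp‖ ≤ M) :
    ∃ ns : ℕ → ℕ, StrictMono ns ∧ ∀ s, MeasurableSet s → μ s ≠ ⊤ →
      ∃ a, Tendsto (fun k => ∫ x in s, f (ns k) x ∂μ) atTop (𝓝 a) := by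
  have : Fact ((2 : ℝ≥0∞) ≠ ⊤) := ⟨by norm_num⟩
  have hsep : TopologicalSpace.SeparableSpace (Lp ℝ 2 μ) := inferInstance
  -- Sequential Banach–Alaoglu in the separable space L². The limit functional is only evaluated on
  -- indicators of sets of finite measure.
  obtain ⟨ℓ, -, ns, hns, hlim⟩ := WeakDual.isSeqCompact_closedBall ℝ (Lp ℝ 2 μ) 0 M
    (x := fun k => StrongDual.toWeakDual (InnerProductSpace.toDual ℝ _ (hf k).toLp))
    (fun k => by simpa using hM k)
  refine ⟨ns, hns, fun s hs hμs => ⟨ℓ (indicatorConstLp 2 hs hμs 1), ?_⟩⟩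
  have h1 := (WeakDual.eval_continuous (indicatorConstLp 2 hs hμs (1 : ℝ))).tendsto ℓ |>.comp hlim
  refine h1.congr fun k => ?_
  simp only [Function.comp_apply]
  change ⟪(hf (ns k)).toLp, indicatorConstLp 2 hs hμs 1⟫ = _
  rw [real_inner_comm, L2.inner_indicatorConstLp_one]
  exact setIntegral_congr_ae hs ((hf (ns k)).coeFn_toLp.mono fun x hx _ => hx)

/-- Rellich's theorem for test functions in a bounded set. -/
theorem exists_subseq_cauchy_eLpNorm [NeZero n] {R : ℝ} {φ : ℕ → EuclideanSpace ℝ (Fin n) → ℝ}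
    (hφ : ∀ k, IsTestFunction (Metric.closedBall 0 R) (φ k)) {M : ℝ}
    (hM : ∀ k, eLpNorm (φ k) 2 volume ≤ ENNReal.ofReal M)
    (hE : ∀ k, dirichletEnergy (φ k) ≤ ENNReal.ofReal M ^ 2) :
    ∃ ns : ℕ → ℕ, StrictMono ns ∧ ∀ ε : ℝ, 0 < ε → ∃ K, ∀ k ≥ K, ∀ l ≥ K,
      eLpNorm (φ (ns k) - φ (ns l)) 2 volume ≤ ENNReal.ofReal ε := by
  wlog hM0 : 0 ≤ M generalizing M
  · refine this (M := max M 0) (fun k => (hM k).trans ?_) (fun k => (hE k).trans ?_)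
      (le_max_right _ _)
    · exact ENNReal.ofReal_le_ofReal (le_max_left _ _)
    · gcongr; exact le_max_left _ _
  have hmem : ∀ k, MemLp (φ k) 2 volume := fun k =>
    (hφ k).continuous.memLp_of_hasCompactSupport (hφ k).2.1
  obtain ⟨ns, hns, hlim⟩ := exists_subseq_tendsto_setIntegral hmem (M := M) fun k => by
    rw [Lp.norm_toLp]
    exact ENNReal.toReal_le_of_le_ofReal hM0 (hM k)
  refine ⟨ns, hns, fun ε hε => ?_⟩
  -- Averaging over the ball of radius s moves each function by at most sM ≤ ε/4 in L², uniformly in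
  -- the sequence.
  set s : ℝ := ε / (4 * (M + 1)) with hs
  have hs0 : 0 < s := by positivity
  have hsM : s * M ≤ ε / 4 := by
    rw [hs, div_mul_eq_mul_div, div_le_div_iff₀ (by positivity) (by positivity)]
    nlinarith
  set B := Metric.ball (0 : EuclideanSpace ℝ (Fin n)) s with hB
  have hBm : MeasurableSet B := measurableSet_ball
  have hB0 : volume B ≠ 0 := (Metric.measure_ball_pos _ _ hs0).ne'
  have hBt : volume B ≠ ⊤ := measure_ball_lt_top.ne
  set μ := ProbabilityTheory.cond volume B with hμ
  have hμp : IsProbabilityMeasure μ := ProbabilityTheory.cond_isProbabilityMeasure_of_finite hB0 hBt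
  have hμae : ∀ᵐ y ∂μ, ‖y‖ ≤ s := by
    rw [hμ, ProbabilityTheory.cond]
    refine Measure.ae_smul_measure ?_ _
    filter_upwards [ae_restrict_mem hBm] with y hy
    exact (mem_ball_zero_iff.1 hy).le
  -- The average at x is a fixed multiple of the integral over a ball, so the averages converge at
  -- every point along the chosen subsequence.
  have hA : ∀ k x, translateAverage μ (φ k) x =
      (volume B)⁻¹.toReal * ∫ y in Metric.ball x s, φ k y := by
    intro k x
    rw [translateAverage, hμ, ProbabilityTheory.cond, integral_smul_measure, smul_eq_mul]
    congr 1
    rw [← integral_indicator hBm, ← integral_indicator measurableSet_ball,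
      ← integral_add_left_eq_self (fun y => (Metric.ball x s).indicator (φ k) y) x]
    congr 1 with y
    by_cases hy : y ∈ B
    · rw [Set.indicator_of_mem hy, Set.indicator_of_mem]
      simpa [hB] using hy
    · rw [Set.indicator_of_notMem hy, Set.indicator_of_notMem]
      simpa [hB] using hy
  have hAlim : ∀ x, ∃ a, Tendsto (fun k => translateAverage μ (φ (ns k)) x) atTop (𝓝 a) := by
    intro x
    obtain ⟨a, ha⟩ := hlim (Metric.ball x s) measurableSet_ball measure_ball_lt_top.ne
    exact ⟨_, (ha.const_mul _).congr fun k => (hA _ _).symm⟩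
  choose a ha using hAlim
  have hAm : ∀ k, AEStronglyMeasurable (translateAverage μ (φ k)) volume := fun k =>
    (stronglyMeasurable_translateAverage (hφ k).continuous).aestronglyMeasurable
  have ham : AEStronglyMeasurable a volume :=
    aestronglyMeasurable_of_tendsto_ae atTop (fun k => hAm (ns k)) (ae_of_all _ ha)
  set C : ℝ≥0∞ := (volume B)⁻¹ * ENNReal.ofReal M ^ 2 with hC
  have hCt : C ≠ ⊤ := ENNReal.mul_ne_top (ENNReal.inv_ne_top.2 hB0)
    (ENNReal.pow_ne_top ENNReal.ofReal_ne_top)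
  -- The averages are uniformly bounded and supported in a common ball. Dominated convergence thus
  -- upgrades their pointwise limit to an L² limit.
  have hAb : ∀ k x, ‖translateAverage μ (φ k) x‖ₑ ^ 2 ≤
      (Metric.closedBall (0 : EuclideanSpace ℝ (Fin n)) (R + s)).indicator (fun _ => C) x := by
    intro k x
    have hφc := (hφ k).continuous
    have h1 : ‖translateAverage μ (φ k) x‖ₑ ^ 2 ≤ ∫⁻ y, ‖φ k (x + y)‖ₑ ^ 2 ∂μ :=
      enorm_integral_sq_le (by fun_prop)
    by_cases hx : x ∈ Metric.closedBall (0 : EuclideanSpace ℝ (Fin n)) (R + s)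
    · rw [Set.indicator_of_mem hx]
      refine h1.trans ?_
      rw [hμ, ProbabilityTheory.cond, lintegral_smul_measure, smul_eq_mul, hC]
      gcongr
      calc _ ≤ ∫⁻ y, ‖φ k (x + y)‖ₑ ^ 2 := setLIntegral_le_lintegral _ _
        _ = ∫⁻ y, ‖φ k y‖ₑ ^ 2 := lintegral_add_left_eq_self (fun y => ‖φ k y‖ₑ ^ 2) x
        _ = eLpNorm (φ k) 2 volume ^ 2 := (eLpNorm_two_sq _).symm
        _ ≤ _ := by gcongr; exact hM k
    · rw [Set.indicator_of_notMem hx]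
      refine h1.trans (le_of_eq ?_)
      rw [lintegral_eq_zero_iff' (by have := hφc.measurable; fun_prop)]
      filter_upwards [hμae] with y hy
      have : φ k (x + y) = 0 := by
        refine (hφ k).eq_zero_of_notMem fun h => hx ?_
        rw [mem_closedBall_zero_iff] at h ⊢
        have := norm_sub_le (x + y) y
        rw [add_sub_cancel_right] at this
        linarith
      simp [this]
  have hab : ∀ x, ‖a x‖ₑ ^ 2 ≤
      (Metric.closedBall (0 : EuclideanSpace ℝ (Fin n)) (R + s)).indicator (fun _ => C) x :=
    fun x => le_of_tendsto' (((ENNReal.continuous_pow 2).tendsto _).comp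
      ((continuous_enorm.tendsto _).comp (ha x))) fun k => hAb (ns k) x
  have hL : Tendsto (fun k => ∫⁻ x, ‖translateAverage μ (φ (ns k)) x - a x‖ₑ ^ 2) atTop
      (𝓝 (∫⁻ x : EuclideanSpace ℝ (Fin n), 0)) := by
    refine tendsto_lintegral_of_dominated_convergence'
      (fun x => 4 * (Metric.closedBall (0 : EuclideanSpace ℝ (Fin n)) (R + s)).indicator
        (fun _ => C) x) (fun k => ?_) (fun k => ae_of_all _ fun x => ?_) ?_
      (ae_of_all _ fun x => ?_)
    · exact ((hAm (ns k)).sub ham).enorm.pow_const 2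
    · have h2 : ‖translateAverage μ (φ (ns k)) x - a x‖ₑ ≤
          ‖translateAverage μ (φ (ns k)) x‖ₑ + ‖a x‖ₑ := enorm_sub_le
      have h3 : ∀ p q : ℝ≥0∞, ∀ D, p ^ 2 ≤ D → q ^ 2 ≤ D → (p + q) ^ 2 ≤ 4 * D := by
        intro p q D hp hq
        calc (p + q) ^ 2 ≤ (max p q + max p q) ^ 2 := by
              gcongr
              · exact le_max_left _ _
              · exact le_max_right _ _
          _ = 4 * (max p q) ^ 2 := by ring
          _ ≤ 4 * D := by
            gcongr
            rcases max_choice p q with h | h <;> rw [h] <;> assumption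
      exact (pow_le_pow_left' h2 2).trans (h3 _ _ _ (hAb _ _) (hab _))
    · rw [lintegral_const_mul' _ _ (by norm_num),
        lintegral_indicator_const Metric.isClosed_closedBall.measurableSet]
      exact ENNReal.mul_ne_top (by norm_num) (ENNReal.mul_ne_top hCt measure_closedBall_lt_top.ne)
    · have h1 : Tendsto (fun k => translateAverage μ (φ (ns k)) x - a x) atTop (𝓝 0) := by
        simpa using (ha x).sub_const (a x)
      have := ((ENNReal.continuous_pow 2).tendsto _).comp ((continuous_enorm.tendsto _).comp h1)
      rw [enorm_zero, zero_pow two_ne_zero] at this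
      exact this
  rw [lintegral_zero] at hL
  have hε4 : 0 < ENNReal.ofReal (ε / 4) ^ 2 :=
    ENNReal.pow_pos (ENNReal.ofReal_pos.2 (by positivity)) 2
  obtain ⟨K, hK⟩ := eventually_atTop.1 (hL.eventually_lt_const hε4)
  have hhalf : ∀ k ≥ K, eLpNorm (φ (ns k) - a) 2 volume ≤ ENNReal.ofReal (ε / 2) := by
    intro k hk
    have e1 : eLpNorm (translateAverage μ (φ (ns k)) - φ (ns k)) 2 volume ≤
        ENNReal.ofReal (ε / 4) := by
      rw [← ENNReal.pow_le_pow_left_iff two_ne_zero, eLpNorm_two_sq]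
      refine ((hφ (ns k)).lintegral_translateAverage_sub_le hμae).trans ?_
      calc _ ≤ ENNReal.ofReal s ^ 2 * ENNReal.ofReal M ^ 2 := by gcongr; exact hE _
        _ = ENNReal.ofReal (s * M) ^ 2 := by rw [← mul_pow, ENNReal.ofReal_mul hs0.le]
        _ ≤ _ := by gcongr
    have e2 : eLpNorm (translateAverage μ (φ (ns k)) - a) 2 volume ≤ ENNReal.ofReal (ε / 4) := by
      rw [← ENNReal.pow_le_pow_left_iff two_ne_zero, eLpNorm_two_sq]
      exact (hK k hk).le
    calc eLpNorm (φ (ns k) - a) 2 volume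
        = eLpNorm ((translateAverage μ (φ (ns k)) - a) -
            (translateAverage μ (φ (ns k)) - φ (ns k))) 2 volume := by
          congr 1; abel
      _ ≤ _ := eLpNorm_sub_le ((hAm _).sub ham)
          ((hAm _).sub (hφ _).continuous.aestronglyMeasurable) (by norm_num)
      _ ≤ ENNReal.ofReal (ε / 4) + ENNReal.ofReal (ε / 4) := add_le_add e2 e1
      _ = _ := by rw [← ENNReal.ofReal_add (by positivity) (by positivity)]; congr 1; ring
  refine ⟨K, fun k hk l hl => ?_⟩
  calc eLpNorm (φ (ns k) - φ (ns l)) 2 volume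
      = eLpNorm ((φ (ns k) - a) - (φ (ns l) - a)) 2 volume := by congr 1; abel
    _ ≤ _ := eLpNorm_sub_le ((hφ _).continuous.aestronglyMeasurable.sub ham)
          ((hφ _).continuous.aestronglyMeasurable.sub ham) (by norm_num)
    _ ≤ ENNReal.ofReal (ε / 2) + ENNReal.ofReal (ε / 2) := add_le_add (hhalf k hk) (hhalf l hl)
    _ = _ := by rw [← ENNReal.ofReal_add (by positivity) (by positivity)]; congr 1; ring

end Rellich

/-! ### Completeness of D^{1,2} and attainment -/

section Attainment

theorem exists_tendsto_eLpNorm {X G : Type*} [MeasurableSpace X] {μ : Measure X}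
    [NormedAddCommGroup G] [CompleteSpace G] {p : ℝ≥0∞} (hp : 1 ≤ p) {f : ℕ → X → G}
    (hf : ∀ k, MemLp (f k) p μ)
    (hc : ∀ ε : ℝ≥0∞, 0 < ε → ∃ K, ∀ k ≥ K, ∀ l ≥ K, eLpNorm (f k - f l) p μ < ε) :
    ∃ g, MemLp g p μ ∧ Tendsto (fun k => eLpNorm (f k - g) p μ) atTop (𝓝 0) := by
  have : Fact (1 ≤ p) := ⟨hp⟩
  have h1 : CauchySeq fun k => (hf k).toLp (f k) := by
    rw [EMetric.cauchySeq_iff]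
    intro ε hε
    obtain ⟨K, hK⟩ := hc ε hε
    refine ⟨K, fun k hk l hl => ?_⟩
    rw [Lp.edist_toLp_toLp]
    exact hK k hk l hl
  obtain ⟨g, hg⟩ := cauchySeq_tendsto_of_complete h1
  refine ⟨g, Lp.memLp g, ?_⟩
  rw [← Lp.tendsto_Lp_iff_tendsto_eLpNorm'' f hf g (Lp.memLp g), Lp.toLp_coeFn]
  exact hg

variable {n : ℕ} {Ω : Set (EuclideanSpace ℝ (Fin n))} {φ u v : EuclideanSpace ℝ (Fin n) → ℝ}
  {g h : EuclideanSpace ℝ (Fin n) → EuclideanSpace ℝ (Fin n)}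

/-- The Gagliardo–Nirenberg–Sobolev inequality. It makes a sequence that is Cauchy in the Dirichlet
norm Cauchy in L^{2n/(n-2)}, hence convergent to an actual function. -/
theorem exists_sobolev_inequality (hn : 3 ≤ n) :
    ∃ C : ℝ≥0∞, C ≠ ⊤ ∧ ∀ φ : EuclideanSpace ℝ (Fin n) → ℝ, IsTestFunction Set.univ φ →
      eLpNorm φ (sobolevExponent n) volume ≤ C * eLpNorm (gradient φ) 2 volume := by
  have hn' : (3 : ℝ) ≤ n := by exact_mod_cast hn
  refine ⟨SNormLESNormFDerivOfEqConst ℝ (volume : Measure (EuclideanSpace ℝ (Fin n))) 2,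
    ENNReal.coe_ne_top, fun φ hφ => ?_⟩
  have h1 := eLpNorm_le_eLpNorm_fderiv_of_eq (F := ℝ) (μ := volume) (p := 2)
    (p' := (2 * (n : ℝ) / ((n : ℝ) - 2)).toNNReal) (hφ.1.of_le (by simp)) hφ.2.1 (by norm_num)
    (by simp; omega) (by
      rw [Real.coe_toNNReal _ (div_nonneg (by linarith) (by linarith)), finrank_euclideanSpace_fin]
      have : (n : ℝ) ≠ 0 := by linarith
      have : (n : ℝ) - 2 ≠ 0 := by linarith
      push_cast
      field_simp)
  refine h1.trans (le_of_eq ?_)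
  congr 1
  exact eLpNorm_congr_norm_ae (Eventually.of_forall fun x => (norm_gradient_eq φ x).symm)

theorem one_le_sobolevExponent (hn : 3 ≤ n) : 1 ≤ sobolevExponent n := by
  have hn' : (3 : ℝ) ≤ n := by exact_mod_cast hn
  rw [sobolevExponent, ENNReal.one_le_ofReal, le_div_iff₀ (by linarith)]
  linarith

theorem IsTestFunction.gradient_sub (hu : IsTestFunction Ω u) (hv : IsTestFunction Ω v) :
    gradient (u - v) = gradient u - gradient v :=
  funext fun x => ((hu.hasGradientAt x).fun_sub (hv.hasGradientAt x)).gradient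

theorem MemD12.isTestFunction_sub (hφ : IsTestFunction Ω φ) (hu : MemD12 Ω u g) :
    MemD12 Ω (φ - u) (gradient φ - g) := by
  obtain ⟨ψ, ht, h1, h2⟩ := hu.exists_approx
  refine ⟨hφ.memD12.memLp_fun.sub hu.memLp_fun, hφ.memD12.memLp_grad.sub hu.memLp_grad,
    fun k => φ - ψ k, fun k => hφ.sub (ht k), ?_, ?_⟩
  · refine h1.congr fun k => ?_
    rw [← eLpNorm_neg]
    congr 1
    ext x
    simp
  · refine h2.congr fun k => ?_
    rw [← eLpNorm_neg, hφ.gradient_sub (ht k)]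
    congr 1
    abel

/-- Completeness of `D^{1,2}`. -/
theorem exists_memD12 (hn : 3 ≤ n) {φ : ℕ → EuclideanSpace ℝ (Fin n) → ℝ}
    (hφ : ∀ k, IsTestFunction Ω (φ k))
    (hc : ∀ ε : ℝ≥0∞, 0 < ε → ∃ K, ∀ k ≥ K, ∀ l ≥ K,
      eLpNorm (gradient (φ k) - gradient (φ l)) 2 volume < ε) :
    ∃ u g, MemD12 Ω u g ∧
      Tendsto (fun k => eLpNorm (gradient (φ k) - g) 2 volume) atTop (𝓝 0) := by
  obtain ⟨C, hC, hS⟩ := exists_sobolev_inequality hn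
  obtain ⟨g, hg, hgl⟩ := exists_tendsto_eLpNorm (by norm_num)
    (fun k => (hφ k).memD12.memLp_grad) hc
  obtain ⟨u, hu, hul⟩ := exists_tendsto_eLpNorm (one_le_sobolevExponent hn)
    (fun k => (hφ k).memD12.memLp_fun) fun ε hε => by
      obtain ⟨K, hK⟩ := hc (ε / (C + 1)) (ENNReal.div_pos hε.ne' (by simpa using hC))
      refine ⟨K, fun k hk l hl => ?_⟩
      have h1 := hK k hk l hl
      rw [ENNReal.lt_div_iff_mul_lt (by simp) (by simp [hC])] at h1
      refine lt_of_le_of_lt ?_ h1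
      have h2 : IsTestFunction Set.univ (φ k - φ l) :=
        ((hφ k).sub (hφ l)).mono (Set.subset_univ _)
      refine (hS _ h2).trans ?_
      rw [(hφ k).gradient_sub (hφ l), mul_comm]
      gcongr
      exact le_self_add
  exact ⟨u, g, ⟨hu, hg, φ, hφ, hul, hgl⟩, hgl⟩

theorem IsTestFunction.gradient_const_mul (hφ : IsTestFunction Ω φ) (c : ℝ)
    (x : EuclideanSpace ℝ (Fin n)) : gradient (fun y => c * φ y) x = c • gradient φ x := by
  refine HasGradientAt.gradient (hasGradientAt_iff_hasFDerivAt.2 ?_)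
  refine ((hφ.differentiable x).hasFDerivAt.const_mul c).congr_fderiv ?_
  ext y
  simp [gradient]

/-- The parallelogram law for both quadratic forms. It turns the lower bound on the energy of a sum
of minimizing functions into smallness of the energy of their difference. -/
theorem IsTestFunction.integral_sub_add (hu : IsTestFunction Ω u) (hv : IsTestFunction Ω v)
    (h0 : 0 ∉ Ω) :
    ((∫ x, ‖gradient (u - v) x‖ ^ 2) + (∫ x, ‖gradient (u + v) x‖ ^ 2) =
      2 * (∫ x, ‖gradient u x‖ ^ 2) + 2 * ∫ x, ‖gradient v x‖ ^ 2) ∧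
    (∫ x, (u - v) x ^ 2 / ‖x‖ ^ 2) + (∫ x, (u + v) x ^ 2 / ‖x‖ ^ 2) =
      2 * (∫ x, u x ^ 2 / ‖x‖ ^ 2) + 2 * ∫ x, v x ^ 2 / ‖x‖ ^ 2 := by
  have hs : ∀ {f}, IsTestFunction Ω f → 0 ∉ tsupport f := fun hf h => h0 (hf.2.2 h)
  have hd : IsTestFunction Ω (u - v) := hu.sub hv
  have ha : IsTestFunction Ω (u + v) := hu.add hv
  constructor
  · rw [← integral_add hd.integrable_norm_gradient_sq ha.integrable_norm_gradient_sq,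
      ← integral_const_mul, ← integral_const_mul,
      ← integral_add (hu.integrable_norm_gradient_sq.const_mul 2)
        (hv.integrable_norm_gradient_sq.const_mul 2)]
    refine integral_congr_ae (Eventually.of_forall fun x => ?_)
    have e1 : gradient (u - v) x = gradient u x - gradient v x := by
      rw [hu.gradient_sub hv]; rfl
    have e2 : gradient (u + v) x = gradient u x + gradient v x :=
      ((hu.hasGradientAt x).fun_add (hv.hasGradientAt x)).gradient
    beta_reduce
    rw [e1, e2]
    have := parallelogram_law_with_norm ℝ (gradient u x) (gradient v x)
    nlinarith
  · rw [← integral_add (hd.integrable_sq_div (hs hd)) (ha.integrable_sq_div (hs ha)),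
      ← integral_const_mul, ← integral_const_mul,
      ← integral_add ((hu.integrable_sq_div (hs hu)).const_mul 2)
        ((hv.integrable_sq_div (hs hv)).const_mul 2)]
    refine integral_congr_ae (Eventually.of_forall fun x => ?_)
    simp only [Pi.sub_apply, Pi.add_apply]
    ring

theorem exists_normalized_minimizing_sequence (hn : 3 ≤ n) (hΩ : IsOpen Ω) (h0 : 0 ∉ Ω) {γ : ℝ}
    (hγ0 : 0 ≤ γ) (hγ : hardyConstant Ω = ENNReal.ofReal γ) :
    ∃ φ : ℕ → EuclideanSpace ℝ (Fin n) → ℝ, ∀ k : ℕ, IsTestFunction Ω (φ k) ∧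
      ∫ x, φ k x ^ 2 / ‖x‖ ^ 2 = 1 ∧ ∫ x, ‖gradient (φ k) x‖ ^ 2 < γ + 1 / ((k : ℝ) + 1) := by
  have : NeZero n := ⟨by omega⟩
  have key : ∀ ε : ℝ, 0 < ε → ∃ φ, IsTestFunction Ω φ ∧ ∫ x, φ x ^ 2 / ‖x‖ ^ 2 = 1 ∧
      ∫ x, ‖gradient φ x‖ ^ 2 < γ + ε := by
    intro ε hε
    obtain ⟨φ, hφ, hlt⟩ := exists_isTestFunction_of_hardyConstant_lt hn hΩ
      (C := ENNReal.ofReal (γ + ε)) ENNReal.ofReal_ne_top (by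
        rw [hγ, ENNReal.ofReal_lt_ofReal_iff (by linarith)]; linarith)
    rw [hφ.dirichletEnergy_lt_iff (fun h => h0 (hφ.2.2 h)) (by linarith)] at hlt
    set H := ∫ x, φ x ^ 2 / ‖x‖ ^ 2 with hH
    have hH0 : 0 < H := by
      have : 0 ≤ ∫ x, ‖gradient φ x‖ ^ 2 := integral_nonneg fun x => by positivity
      by_contra hc
      have : 0 ≤ H := integral_nonneg fun x => by positivity
      have : H = 0 := by linarith
      rw [this, mul_zero] at hlt
      linarith
    -- H is nonzero because the strict inequality would otherwise put the energy below 0; dividing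
    -- by √H normalises the Hardy integral.
    set c := (Real.sqrt H)⁻¹
    have hc : c ^ 2 = H⁻¹ := by rw [inv_pow, Real.sq_sqrt hH0.le]
    refine ⟨_, hφ.const_mul c, ?_, ?_⟩
    · calc ∫ x, (c * φ x) ^ 2 / ‖x‖ ^ 2 = ∫ x, H⁻¹ * (φ x ^ 2 / ‖x‖ ^ 2) := by
            congr 1; ext x; rw [mul_pow, hc, mul_div_assoc]
        _ = 1 := by rw [integral_const_mul, ← hH, inv_mul_cancel₀ hH0.ne']
    · calc ∫ x, ‖gradient (fun y => c * φ y) x‖ ^ 2 = ∫ x, H⁻¹ * ‖gradient φ x‖ ^ 2 := by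
            congr 1; ext x
            rw [hφ.gradient_const_mul, norm_smul, mul_pow, Real.norm_eq_abs, sq_abs, hc]
        _ = H⁻¹ * ∫ x, ‖gradient φ x‖ ^ 2 := integral_const_mul _ _
        _ < H⁻¹ * ((γ + ε) * H) := by gcongr
        _ = γ + ε := by field_simp
  choose φ hφ using fun k : ℕ => key (1 / ((k : ℝ) + 1)) (by positivity)
  exact ⟨φ, hφ⟩

theorem IsTestFunction.integral_sq_le (hφ : IsTestFunction Ω φ) (h0 : 0 ∉ Ω) {R : ℝ}
    (hR : Ω ⊆ Metric.closedBall 0 R) :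
    ∫ x, φ x ^ 2 ≤ R ^ 2 * ∫ x, φ x ^ 2 / ‖x‖ ^ 2 := by
  rw [← integral_const_mul]
  refine integral_mono hφ.integrable_sq
    ((hφ.integrable_sq_div fun h => h0 (hφ.2.2 h)).const_mul _) fun x => ?_
  by_cases hx : x ∈ Ω
  · have hx0 : 0 < ‖x‖ := norm_pos_iff.2 fun h => h0 (h ▸ hx)
    have hxR : ‖x‖ ≤ R := by simpa using hR hx
    rw [mul_div_assoc', le_div_iff₀ (by positivity), mul_comm]
    gcongr
  · simp [hφ.eq_zero_of_notMem hx]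

theorem IsTestFunction.eLpNorm_two_sq_eq (hφ : IsTestFunction Ω φ) :
    eLpNorm φ 2 volume ^ 2 = ENNReal.ofReal (∫ x, φ x ^ 2) := by
  rw [eLpNorm_two_sq, ofReal_integral_eq_lintegral_ofReal hφ.integrable_sq
    (Eventually.of_forall fun x => sq_nonneg _)]
  refine lintegral_congr fun x => ?_
  rw [← ofReal_norm, ← ENNReal.ofReal_pow (norm_nonneg _), Real.norm_eq_abs, sq_abs]

theorem IsTestFunction.eLpNorm_gradient_sq_eq (hφ : IsTestFunction Ω φ) :
    eLpNorm (gradient φ) 2 volume ^ 2 = ENNReal.ofReal (∫ x, ‖gradient φ x‖ ^ 2) := by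
  rw [eLpNorm_two_sq, ← hφ.dirichletEnergy_eq, dirichletEnergy]

/-- A minimizing sequence that converges in the Dirichlet norm produces a minimizer. -/
theorem hardyConstantAttained_of_cauchy (hn : 3 ≤ n) (hΩ : IsOpen Ω) (h0 : 0 ∉ Ω) {γ : ℝ}
    (hγ : hardyConstant Ω = ENNReal.ofReal γ) {φ : ℕ → EuclideanSpace ℝ (Fin n) → ℝ}
    (hφ : ∀ k, IsTestFunction Ω (φ k)) (hH : ∀ k, ∫ x, φ k x ^ 2 / ‖x‖ ^ 2 = 1)
    (hE : Tendsto (fun k => ∫ x, ‖gradient (φ k) x‖ ^ 2) atTop (𝓝 γ))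
    (hc : ∀ ε : ℝ≥0∞, 0 < ε → ∃ K, ∀ k ≥ K, ∀ l ≥ K,
      eLpNorm (gradient (φ k) - gradient (φ l)) 2 volume < ε) : HardyConstantAttained Ω := by
  have : NeZero n := ⟨by omega⟩
  have hn' : (3 : ℝ) ≤ n := by exact_mod_cast hn
  obtain ⟨u, g, hu, hlim⟩ := exists_memD12 hn hφ hc
  set c := ENNReal.ofReal (((n : ℝ) - 2) ^ 2 / 4) with hcdef
  have hc0 : c ≠ 0 := by
    rw [hcdef, Ne, ENNReal.ofReal_eq_zero, not_le]
    have : 0 < (n : ℝ) - 2 := by linarith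
    positivity
  have hct : c ≠ ⊤ := ENNReal.ofReal_ne_top
  -- The Hardy integral is written as a squared L² norm to make the triangle inequality available.
  have hw : ∀ v : EuclideanSpace ℝ (Fin n) → ℝ,
      ∫⁻ x in Ω, ‖v x‖ₑ ^ 2 / ‖x‖ₑ ^ 2 =
        eLpNorm (fun x => ‖x‖⁻¹ * v x) 2 (volume.restrict Ω) ^ 2 := by
    intro v
    rw [eLpNorm_two_sq]
    refine setLIntegral_congr_fun hΩ.measurableSet fun x hx => ?_
    have hx0 : ‖x‖ ≠ 0 := norm_ne_zero_iff.2 fun h => h0 (h ▸ hx)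
    rw [enorm_mul, mul_pow, enorm_inv hx0, enorm_norm, ← ENNReal.inv_pow, div_eq_mul_inv, mul_comm]
  have hm : ∀ {v : EuclideanSpace ℝ (Fin n) → ℝ}, AEStronglyMeasurable v volume →
      AEStronglyMeasurable (fun x => ‖x‖⁻¹ * v x) (volume.restrict Ω) := fun hv =>
    (measurable_norm.inv.aestronglyMeasurable.mul hv).restrict
  have hsq0 : ∀ {f : ℕ → ℝ≥0∞}, Tendsto (fun k => f k ^ 2) atTop (𝓝 0) →
      Tendsto f atTop (𝓝 0) := by
    intro f hf
    have := (ENNReal.continuous_rpow_const (y := (1 : ℝ) / 2)).tendsto 0 |>.comp hf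
    rw [ENNReal.zero_rpow_of_pos (by norm_num)] at this
    refine this.congr fun k => ?_
    simp only [Function.comp_apply]
    rw [← ENNReal.rpow_natCast, ← ENNReal.rpow_mul]
    norm_num
  -- The Hardy inequality applied to φ k - u transfers Dirichlet convergence to the weighted norm.
  -- The normalisation then survives in the limit and keeps u from being zero.
  have hwlim : Tendsto (fun k => eLpNorm (fun x => ‖x‖⁻¹ * (φ k - u) x) 2 (volume.restrict Ω))
      atTop (𝓝 0) := by
    refine hsq0 ?_
    have h1 : Tendsto (fun k => c⁻¹ * eLpNorm (gradient (φ k) - g) 2 volume ^ 2) atTop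
        (𝓝 (c⁻¹ * 0 ^ 2)) :=
      ENNReal.Tendsto.const_mul (((ENNReal.continuous_pow 2).tendsto _).comp hlim)
        (Or.inr (ENNReal.inv_ne_top.2 hc0))
    rw [zero_pow two_ne_zero, mul_zero] at h1
    refine tendsto_of_tendsto_of_tendsto_of_le_of_le tendsto_const_nhds h1 (fun _ => bot_le)
      fun k => ?_
    have h2 := (MemD12.isTestFunction_sub (hφ k) hu).hardy hn hΩ hct
      fun φ hφ => hφ.hardy (by omega)
    rw [hw, ← eLpNorm_two_sq] at h2
    rw [← ENNReal.div_eq_inv_mul, ENNReal.le_div_iff_mul_le (Or.inl hc0) (Or.inl hct), mul_comm]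
    refine h2.trans ?_
    gcongr
    exact Measure.restrict_le_self
  have hH1 : ∀ k, eLpNorm (fun x => ‖x‖⁻¹ * φ k x) 2 (volume.restrict Ω) = 1 := by
    intro k
    have h1 : eLpNorm (fun x => ‖x‖⁻¹ * φ k x) 2 (volume.restrict Ω) ^ 2 = 1 := by
      rw [← hw, (hφ k).setLIntegral_hardy hΩ, (hφ k).hardyEnergy_eq fun h => h0 ((hφ k).2.2 h),
        hH k, ENNReal.ofReal_one]
    exact (ENNReal.pow_right_strictMono two_ne_zero).injective (by simpa using h1)
  have hN : 1 ≤ ∫⁻ x in Ω, ‖u x‖ₑ ^ 2 / ‖x‖ₑ ^ 2 := by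
    rw [hw]
    refine one_le_pow₀ ?_
    have h1 := hwlim.add_const (eLpNorm (fun x => ‖x‖⁻¹ * u x) 2 (volume.restrict Ω))
    rw [zero_add] at h1
    refine ge_of_tendsto' h1 fun k => ?_
    rw [← hH1 k]
    refine le_trans (le_of_eq ?_) (eLpNorm_add_le (hm
      ((hφ k).continuous.aestronglyMeasurable.sub hu.memLp_fun.1)) (hm hu.memLp_fun.1)
      (by norm_num))
    congr 1
    ext x
    simp only [Pi.add_apply, Pi.sub_apply]
    ring
  have hG : ∫⁻ x in Ω, ‖g x‖ₑ ^ 2 ≤ ENNReal.ofReal γ := by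
    refine (setLIntegral_le_lintegral _ _).trans ?_
    rw [← eLpNorm_two_sq]
    have h1 : Tendsto (fun k => eLpNorm (gradient (φ k) - g) 2 volume +
        ENNReal.ofReal (∫ x, ‖gradient (φ k) x‖ ^ 2) ^ (1 / 2 : ℝ)) atTop
        (𝓝 (0 + ENNReal.ofReal γ ^ (1 / 2 : ℝ))) :=
      hlim.add ((ENNReal.continuous_rpow_const.tendsto _).comp (ENNReal.tendsto_ofReal hE))
    rw [zero_add] at h1
    have h2 : eLpNorm g 2 volume ≤ ENNReal.ofReal γ ^ (1 / 2 : ℝ) := by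
      refine ge_of_tendsto' h1 fun k => ?_
      have h3 : eLpNorm (gradient (φ k)) 2 volume =
          ENNReal.ofReal (∫ x, ‖gradient (φ k) x‖ ^ 2) ^ (1 / 2 : ℝ) := by
        rw [← (hφ k).eLpNorm_gradient_sq_eq, ← ENNReal.rpow_natCast, ← ENNReal.rpow_mul]
        norm_num
      rw [← h3, ← eLpNorm_neg (gradient (φ k) - g)]
      refine le_trans (le_of_eq ?_) (eLpNorm_add_le
        ((hφ k).memD12.memLp_grad.1.sub hu.memLp_grad.1).neg (hφ k).memD12.memLp_grad.1
        (by norm_num))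
      congr 1
      abel
    calc eLpNorm g 2 volume ^ 2 ≤ (ENNReal.ofReal γ ^ (1 / 2 : ℝ)) ^ 2 := by gcongr
      _ = ENNReal.ofReal γ := by
        rw [← ENNReal.rpow_natCast, ← ENNReal.rpow_mul]
        norm_num
  have hne : ¬ u =ᵐ[volume] 0 := by
    intro h
    have : ∫⁻ x in Ω, ‖u x‖ₑ ^ 2 / ‖x‖ₑ ^ 2 = 0 := by
      rw [lintegral_congr_ae (g := fun _ => 0), lintegral_zero]
      filter_upwards [ae_restrict_of_ae h] with x hx
      simp [hx]
    rw [this] at hN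
    simp at hN
  refine ⟨u, g, hu, hne, le_antisymm ?_ (sInf_le ⟨u, g, hu, hne, rfl⟩)⟩
  rw [hγ, hardyQuotient]
  calc _ ≤ ENNReal.ofReal γ / 1 := by gcongr
    _ = _ := div_one _

/-- Below the critical level `n² / 4` the Hardy constant of a bounded domain is attained. -/
theorem IsSmoothDomain.hardyConstantAttained [NeZero n] (hn : 3 ≤ n) (hΩ : IsSmoothDomain Ω)
    (hb : Bornology.IsBounded Ω) (h0 : 0 ∈ frontier Ω)
    (hlt : hardyConstant Ω < ENNReal.ofReal ((n : ℝ) ^ 2 / 4)) : HardyConstantAttained Ω := by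
  obtain ⟨R, hR0, hR⟩ : ∃ R, 0 < R ∧ Ω ⊆ Metric.closedBall 0 R := by
    obtain ⟨R, hR⟩ := hb.subset_closedBall 0
    exact ⟨max R 1, by positivity, hR.trans (Metric.closedBall_subset_closedBall (le_max_left _ _))⟩
  have h0Ω : (0 : EuclideanSpace ℝ (Fin n)) ∉ Ω := fun h => by
    rw [hΩ.isOpen.frontier_eq] at h0; exact h0.2 h
  obtain ⟨γ, hγ0, hγ⟩ : ∃ γ : ℝ, 0 ≤ γ ∧ hardyConstant Ω = ENNReal.ofReal γ :=
    ⟨_, ENNReal.toReal_nonneg, (ENNReal.ofReal_toReal hlt.ne_top).symm⟩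
  rw [hγ, ENNReal.ofReal_lt_ofReal_iff_of_nonneg hγ0] at hlt
  obtain ⟨c, hγc, hcn⟩ := exists_between hlt
  obtain ⟨C, hC0, hC⟩ := hΩ.hardy_garding h0 (hγ0.trans hγc.le) hcn
  obtain ⟨φ, hφ⟩ := exists_normalized_minimizing_sequence hn hΩ.isOpen h0Ω hγ0 hγ
  have hEb : ∀ k, ∫ x, ‖gradient (φ k) x‖ ^ 2 ≤ γ + 1 := fun k =>
    (hφ k).2.2.le.trans (by
      have : 1 / ((k : ℝ) + 1) ≤ 1 := by rw [div_le_one (by positivity)]; simp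
      linarith)
  -- This M serves both bounds: the L² norms are at most R, and the energies at most γ + 1 ≤ M².
  obtain ⟨ns, hns, hcau⟩ := exists_subseq_cauchy_eLpNorm (R := R) (M := R + (γ + 1))
    (fun k => (hφ k).1.mono ((hφ k).1.2.2.trans hR)) (fun k => by
      rw [← ENNReal.pow_le_pow_left_iff two_ne_zero, (hφ k).1.eLpNorm_two_sq_eq,
        ← ENNReal.ofReal_pow (by positivity)]
      refine ENNReal.ofReal_le_ofReal (((hφ k).1.integral_sq_le h0Ω hR).trans ?_)
      rw [(hφ k).2.1]
      nlinarith) (fun k => by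
      rw [(hφ k).1.dirichletEnergy_eq, ← ENNReal.ofReal_pow (by positivity)]
      refine ENNReal.ofReal_le_ofReal ((hEb k).trans ?_)
      nlinarith)
  have hψ : ∀ k, IsTestFunction Ω (φ (ns k)) := fun k => (hφ _).1
  have hψE : ∀ k : ℕ, ∫ x, ‖gradient (φ (ns k)) x‖ ^ 2 < γ + 1 / ((k : ℝ) + 1) := fun k =>
    (hφ _).2.2.trans_le (by
      have : (k : ℝ) ≤ ns k := by exact_mod_cast hns.le_apply
      gcongr)
  have hlow : ∀ {f}, IsTestFunction Ω f →
      γ * (∫ x, f x ^ 2 / ‖x‖ ^ 2) ≤ ∫ x, ‖gradient f x‖ ^ 2 := fun hf => by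
    rw [← hf.mul_hardyEnergy_le_iff (fun h => h0Ω (hf.2.2 h)) hγ0]
    exact (le_hardyConstant_iff hn hΩ.isOpen ENNReal.ofReal_ne_top).1 hγ.ge _ hf
  refine hardyConstantAttained_of_cauchy hn hΩ.isOpen h0Ω hγ hψ (fun k => (hφ _).2.1) ?_ ?_
  · refine tendsto_of_tendsto_of_tendsto_of_le_of_le (g := fun _ => γ) tendsto_const_nhds
      (h := fun k : ℕ => γ + 1 / ((k : ℝ) + 1)) ?_ (fun k => ?_) (fun k => (hψE k).le)
    · simpa using tendsto_one_div_add_atTop_nhds_zero_nat.const_add γ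
    · have := hlow (hψ k)
      rwa [(hφ (ns k)).2.1, mul_one] at this
  · intro ε hε
    obtain ⟨e, he0, he⟩ : ∃ e : ℝ, 0 < e ∧ ENNReal.ofReal e < ε := by
      obtain ⟨e, he, he'⟩ := ENNReal.lt_iff_exists_nnreal_btwn.1 hε
      exact ⟨e, by exact_mod_cast he, by simpa using he'⟩
    -- With η = e²/(2A), an L² error below η and energy errors below η/4 lead to a Dirichlet error
    -- of at most 2Aη = e².
    set A := 1 + γ / (c - γ) with hA
    have hcγ : 0 < c - γ := sub_pos.2 hγc
    have hA0 : 0 < A := by positivity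
    set η := e ^ 2 / (2 * A) with hη
    have hη0 : 0 < η := by positivity
    obtain ⟨s, hs0, hs⟩ : ∃ s : ℝ, 0 < s ∧ C * s ^ 2 < η := by
      have h1 : Tendsto (fun s : ℝ => C * s ^ 2) (𝓝[>] 0) (𝓝 (C * 0 ^ 2)) :=
        (((continuous_id.pow 2).const_mul C).tendsto 0).mono_left nhdsWithin_le_nhds
      rw [zero_pow two_ne_zero, mul_zero] at h1
      obtain ⟨s, h1, h2⟩ := ((h1.eventually_lt_const hη0).and self_mem_nhdsWithin).exists
      exact ⟨s, h2, h1⟩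
    obtain ⟨K, hK⟩ := hcau s hs0
    obtain ⟨K', hK'⟩ := exists_nat_one_div_lt (show 0 < η / 4 by positivity)
    refine ⟨max K K', fun k hk l hl => lt_of_le_of_lt ?_ he⟩
    have hd : IsTestFunction Ω (φ (ns k) - φ (ns l)) := (hψ k).sub (hψ l)
    have ha : IsTestFunction Ω (φ (ns k) + φ (ns l)) := (hψ k).add (hψ l)
    rw [← (hψ k).gradient_sub (hψ l), ← ENNReal.pow_le_pow_left_iff two_ne_zero,
      hd.eLpNorm_gradient_sq_eq, ← ENNReal.ofReal_pow he0.le]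
    refine ENNReal.ofReal_le_ofReal ?_
    have hL2 := hK k (le_trans (le_max_left _ _) hk) l (le_trans (le_max_left _ _) hl)
    rw [← ENNReal.pow_le_pow_left_iff two_ne_zero, hd.eLpNorm_two_sq_eq,
      ← ENNReal.ofReal_pow hs0.le, ENNReal.ofReal_le_ofReal_iff (by positivity)] at hL2
    obtain ⟨p1, p2⟩ := (hψ k).integral_sub_add (hψ l) h0Ω
    rw [(hφ (ns k)).2.1, (hφ (ns l)).2.1] at p2
    have hk' : ∀ {j : ℕ}, j ≥ max K K' → 1 / ((j : ℝ) + 1) < η / 4 := fun {j} hj =>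
      lt_of_le_of_lt (by
        have : (K' : ℝ) ≤ j := by exact_mod_cast le_trans (le_max_right _ _) hj
        gcongr) hK'
    have q1 := hlow ha
    have q2 := hC _ hd
    have q3 := hψE k
    have q4 := hψE l
    have q5 := hk' hk
    have q6 := hk' hl
    set Ed := ∫ x, ‖gradient (φ (ns k) - φ (ns l)) x‖ ^ 2
    set Ea := ∫ x, ‖gradient (φ (ns k) + φ (ns l)) x‖ ^ 2
    set Hd := ∫ x, (φ (ns k) - φ (ns l)) x ^ 2 / ‖x‖ ^ 2
    set Ha := ∫ x, (φ (ns k) + φ (ns l)) x ^ 2 / ‖x‖ ^ 2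
    set N := ∫ x, (φ (ns k) - φ (ns l)) x ^ 2
    -- The sum has energy at least γ Ha = 4γ - γ Hd, so the parallelogram law gives Ed ≤ η + γ Hd.
    -- The inequality c Hd ≤ Ed + C N with c > γ then closes the loop and bounds Hd.
    have r0 : γ * Ha = 4 * γ - γ * Hd := by linear_combination γ * p2
    have r1 : Ed ≤ η + γ * Hd := by linarith
    have r2 : C * N ≤ η := (mul_le_mul_of_nonneg_left hL2 hC0).trans hs.le
    have r3 : Hd ≤ 2 * η / (c - γ) := by
      rw [le_div_iff₀ hcγ]
      linarith
    calc Ed ≤ η + γ * (2 * η / (c - γ)) := r1.trans (by gcongr)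
      _ ≤ 2 * (A * η) := by
        have : 2 * (A * η) = η + η + γ * (2 * η / (c - γ)) := by rw [hA]; ring
        linarith
      _ = e ^ 2 := by rw [hη]; field_simp

end Attainment

/-! ### Smooth domains as regular superlevel sets -/

section RegularLevel

variable {n : ℕ} {F : EuclideanSpace ℝ (Fin n) → ℝ}

/-- At a zero with nonzero derivative some direction v has positive slope, so the points p + t v
with small t > 0 lie in the superlevel set and accumulate at p. -/
theorem frontier_superlevel (hF : ContDiff ℝ ∞ F) (hreg : ∀ p, F p = 0 → fderiv ℝ F p ≠ 0) :
    frontier {x | 0 < F x} = {x | F x = 0} := by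
  have ho : IsOpen {x | 0 < F x} := isOpen_lt continuous_const hF.continuous
  refine subset_antisymm ?_ fun p hp => ?_
  · exact (frontier_lt_subset_eq continuous_const hF.continuous).trans fun x hx => Eq.symm hx
  · rw [ho.frontier_eq]
    have hp : F p = 0 := hp
    refine ⟨?_, by simp [hp]⟩
    obtain ⟨v, hv⟩ : ∃ v, 0 < fderiv ℝ F p v := by
      obtain ⟨v, hv⟩ := DFunLike.ne_iff.1 (hreg p hp)
      rcases lt_or_gt_of_ne hv with h | h
      · exact ⟨-v, by simpa using h⟩
      · exact ⟨v, h⟩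
    have h1 : HasDerivAt (fun t : ℝ => F (p + t • v)) (fderiv ℝ F p v) 0 := by
      have h2 : HasDerivAt (fun t : ℝ => p + t • v) v 0 := by
        simpa using ((hasDerivAt_id (0 : ℝ)).smul_const v).const_add p
      have h3 : HasFDerivAt F (fderiv ℝ F p) (p + (0 : ℝ) • v) := by
        simpa using (hF.differentiable (by simp) p).hasFDerivAt
      exact h3.comp_hasDerivAt 0 h2
    have h4 := ((hasDerivAt_iff_tendsto_slope.1 h1).mono_left
      (nhdsGT_le_nhdsNE 0)).eventually_const_lt hv
    rw [mem_closure_iff_frequently]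
    have h5 : Tendsto (fun t : ℝ => p + t • v) (𝓝[>] 0) (𝓝 p) := by
      have : Continuous fun t : ℝ => p + t • v := by fun_prop
      simpa using (this.tendsto 0).mono_left nhdsWithin_le_nhds
    refine h5.frequently (Eventually.frequently ?_)
    filter_upwards [h4, self_mem_nhdsWithin] with t ht ht0
    rw [slope_def_field] at ht
    simp only [zero_smul, add_zero, hp, sub_zero] at ht
    exact (div_pos_iff_of_pos_right ht0).1 ht

/-- A connected superlevel set at a regular value is a smooth domain. -/
theorem isSmoothDomain_superlevel [NeZero n] (hF : ContDiff ℝ ∞ F) (hc : IsConnected {x | 0 < F x})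
    (hreg : ∀ p, F p = 0 → fderiv ℝ F p ≠ 0) : IsSmoothDomain {x | 0 < F x} where
  isOpen := isOpen_lt continuous_const hF.continuous
  isConnected := hc
  exists_chart p hp := by
    rw [frontier_superlevel hF hreg] at hp ⊢
    have hp : F p = 0 := hp
    set ν := gradient F p with hν
    have hFd : HasFDerivAt F (InnerProductSpace.toDual ℝ _ ν) p :=
      hasGradientAt_iff_hasFDerivAt.1 (hF.differentiable (by simp) p).hasGradientAt
    have hν0 : ‖ν‖ ≠ 0 := by
      rw [norm_ne_zero_iff]
      intro h
      rw [h, map_zero] at hFd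
      exact hreg p hp hFd.fderiv
    set e : EuclideanSpace ℝ (Fin n) := EuclideanSpace.single 0 1 with he
    have hin : ∀ x : EuclideanSpace ℝ (Fin n), x 0 = ⟪e, x⟫ := fun x => by
      simp [he, EuclideanSpace.inner_single_left]
    have hee : ⟪e, e⟫ = 1 := by simp [he]
    obtain ⟨L, hL⟩ : ∃ L : EuclideanSpace ℝ (Fin n) ≃ₗᵢ[ℝ] EuclideanSpace ℝ (Fin n),
        L ν = ‖ν‖ • e :=
      ⟨(ℝ ∙ (ν - ‖ν‖ • e))ᗮ.reflection, Submodule.reflection_sub (by simp [norm_smul, he])⟩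
    have hLi : ∀ y, ⟪e, L y⟫ = ‖ν‖⁻¹ * ⟪ν, y⟫ := fun y => by
      rw [← L.inner_map_map ν y, hL, real_inner_smul_left, inv_mul_cancel_left₀ hν0]
    -- L is an isometry sending the gradient ν to ‖ν‖e. The correction along e makes the first
    -- coordinate of Ψ equal to F/‖ν‖ without changing the derivative L at p, so the inverse
    -- function theorem applies.
    let Ψ : EuclideanSpace ℝ (Fin n) → EuclideanSpace ℝ (Fin n) := fun x =>
      L (x - p) + (‖ν‖⁻¹ * (F x - ⟪ν, x - p⟫)) • e
    have hΨ : ContDiff ℝ ∞ Ψ := by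
      have h1 : ContDiff ℝ ∞ fun x => L (x - p) :=
        L.contDiff.comp (contDiff_id.sub contDiff_const)
      have h2 : ContDiff ℝ ∞ fun x => ⟪ν, x - p⟫ :=
        contDiff_const.inner ℝ (contDiff_id.sub contDiff_const)
      exact h1.add ((contDiff_const.mul (hF.sub h2)).smul contDiff_const)
    have hΨ0 : ∀ x, Ψ x 0 = ‖ν‖⁻¹ * F x := fun x => by
      rw [hin, inner_add_right, hLi, real_inner_smul_right, hee]
      ring
    have hΨp : Ψ p = 0 := by simp [Ψ, hp]
    have hΨd : HasFDerivAt Ψ (L.toContinuousLinearEquiv : _ →L[ℝ] _) p := by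
      have h1 : HasFDerivAt (fun x => L (x - p)) (L.toContinuousLinearEquiv : _ →L[ℝ] _) p :=
        (L.toContinuousLinearEquiv.hasFDerivAt).comp p ((hasFDerivAt_id p).sub_const p)
      have h2 : HasFDerivAt (fun x => ⟪ν, x - p⟫) (InnerProductSpace.toDual ℝ _ ν) p :=
        (InnerProductSpace.toDual ℝ _ ν).hasFDerivAt.comp p ((hasFDerivAt_id p).sub_const p)
      refine (h1.add (((hFd.fun_sub h2).const_mul ‖ν‖⁻¹).smul_const e)).congr_fderiv ?_
      ext1 y
      simp
    let Θ := hΨ.contDiffAt.toOpenPartialHomeomorph Ψ hΨd (by simp)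
    have hΘ : (Θ : EuclideanSpace ℝ (Fin n) → EuclideanSpace ℝ (Fin n)) = Ψ := rfl
    have hΘp : p ∈ Θ.source := hΨ.contDiffAt.mem_toOpenPartialHomeomorph_source hΨd (by simp)
    -- Restricting to points where the derivative is invertible makes the inverse smooth on its
    -- whole domain, not just at the image of p.
    set O : Set (EuclideanSpace ℝ (Fin n)) := (fun x => fderiv ℝ Ψ x) ⁻¹'
      Set.range ((↑) : (EuclideanSpace ℝ (Fin n) ≃L[ℝ] EuclideanSpace ℝ (Fin n)) → _) with hO
    have hOo : IsOpen O := ContinuousLinearEquiv.isOpen.preimage (hΨ.continuous_fderiv (by simp))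
    have hpO : p ∈ O := ⟨L.toContinuousLinearEquiv, hΨd.fderiv.symm⟩
    refine ⟨(Θ.restrOpen O hOo).symm, ?_, ?_, ?_, ?_, ?_⟩
    · rw [← hΨp]
      exact (Θ.restrOpen O hOo).map_source ⟨hΘp, hpO⟩
    · rw [← hΨp]
      exact (Θ.restrOpen O hOo).left_inv ⟨hΘp, hpO⟩
    · intro y hy
      have hx := (Θ.restrOpen O hOo).map_target hy
      obtain ⟨T, hT⟩ := hx.2
      refine ((Θ.restrOpen O hOo).contDiffAt_symm hy (f₀' := T) ?_ hΨ.contDiffAt).contDiffWithinAt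
      rw [hT]
      exact (hΨ.differentiable (by simp) _).hasFDerivAt
    · exact hΨ.contDiffOn
    · intro y hy
      have h1 : Ψ ((Θ.restrOpen O hOo).symm y) = y := (Θ.restrOpen O hOo).right_inv hy
      have h2 := hΨ0 ((Θ.restrOpen O hOo).symm y)
      rw [h1] at h2
      have h3 : 0 < ‖ν‖⁻¹ := inv_pos.2 (lt_of_le_of_ne (norm_nonneg _) hν0.symm)
      rw [h2]
      exact ⟨(mul_pos_iff_of_pos_left h3).symm, by simp [hν0]⟩

end RegularLevel

/-! ### Balls with a small ball removed, and the infimum -/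

section PuncturedBall

variable {n : ℕ}

/-- Every point is joined, by a segment on its ray from c, to a sphere about c of radius between r
and R - ‖c‖. That sphere is connected as the dimension is at least 2. -/
theorem isConnected_ball_diff_closedBall (hn : 2 ≤ n) {c : EuclideanSpace ℝ (Fin n)} {r R : ℝ}
    (hr : 0 < r) (hR : ‖c‖ + r < R) :
    IsConnected (Metric.ball (0 : EuclideanSpace ℝ (Fin n)) R \ Metric.closedBall c r) := by
  obtain ⟨s, hrs, hsR⟩ := exists_between (show r < R - ‖c‖ by linarith)
  have hs0 : 0 < s := hr.trans hrs
  have hrank : 1 < Module.rank ℝ (EuclideanSpace ℝ (Fin n)) := by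
    rw [← Module.finrank_eq_rank, finrank_euclideanSpace_fin]
    exact_mod_cast hn
  have hS := isConnected_sphere hrank c hs0.le
  have hsub : Metric.sphere c s ⊆ Metric.ball 0 R \ Metric.closedBall c r := by
    intro x hx
    rw [mem_sphere_iff_norm] at hx
    refine ⟨?_, ?_⟩
    · rw [mem_ball_zero_iff]
      have := norm_add_le (x - c) c
      rw [sub_add_cancel] at this
      linarith
    · rw [mem_closedBall_iff_norm]
      linarith
  obtain ⟨z, hz⟩ := hS.nonempty
  refine ⟨⟨z, hsub hz⟩, isPreconnected_of_forall z fun x hx => ?_⟩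
  have hxc : r < ‖x - c‖ := by
    have := hx.2
    rwa [mem_closedBall_iff_norm, not_le] at this
  have hxc0 : ‖x - c‖ ≠ 0 := by linarith
  set y := c + (s / ‖x - c‖) • (x - c) with hy
  have hyS : y ∈ Metric.sphere c s := by
    rw [mem_sphere_iff_norm, hy, add_sub_cancel_left, norm_smul, Real.norm_eq_abs,
      abs_of_pos (by positivity), div_mul_cancel₀ _ hxc0]
  refine ⟨Metric.sphere c s ∪ segment ℝ y x, Set.union_subset hsub ?_, Or.inl hz,
    Or.inr (right_mem_segment ℝ y x), IsPreconnected.union y hyS (left_mem_segment ℝ y x)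
      hS.isPreconnected (convex_segment y x).isPreconnected⟩
  rintro w hw
  refine ⟨(convex_ball 0 R).segment_subset (hsub hyS).1 hx.1 hw, ?_⟩
  obtain ⟨a, b, ha, hb, hab, rfl⟩ := hw
  rw [mem_closedBall_iff_norm, not_le]
  have e1 : a • y + b • x - c = (a * (s / ‖x - c‖) + b) • (x - c) := by
    have hb' : b = 1 - a := by linarith
    rw [hy, hb']
    module
  rw [e1, norm_smul, Real.norm_eq_abs, abs_of_nonneg (by positivity), add_mul, mul_assoc,
    div_mul_cancel₀ _ hxc0]
  calc r = a * r + b * r := by rw [← add_mul, hab, one_mul]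
    _ < a * s + b * ‖x - c‖ := by
      rcases ha.eq_or_lt with h | h
      · have : b = 1 := by linarith
        subst this; rw [← h]; linarith
      · nlinarith

/-- A ball from which a smaller closed ball through the centre is removed. -/
theorem isSmoothDomain_ball_diff_closedBall [NeZero n] (hn : 2 ≤ n) {r R : ℝ}
    (hr : 0 < r) (hR : 2 * r < R) :
    IsSmoothDomain (Metric.ball (0 : EuclideanSpace ℝ (Fin n)) R \
      Metric.closedBall (EuclideanSpace.single 0 r) r) ∧
    0 ∈ frontier (Metric.ball (0 : EuclideanSpace ℝ (Fin n)) R \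
      Metric.closedBall (EuclideanSpace.single 0 r) r) := by
  set c : EuclideanSpace ℝ (Fin n) := EuclideanSpace.single 0 r with hc
  have hcn : ‖c‖ = r := by simp [hc, abs_of_pos hr]
  have hR0 : 0 < R := by linarith
  set F : EuclideanSpace ℝ (Fin n) → ℝ := fun x => (R ^ 2 - ‖x‖ ^ 2) * (‖x - c‖ ^ 2 - r ^ 2)
    with hF
  have hFs : ContDiff ℝ ∞ F :=
    (contDiff_const.sub (contDiff_norm_sq ℝ)).mul
      (((contDiff_id.sub contDiff_const).norm_sq ℝ).sub contDiff_const)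
  have hset : Metric.ball (0 : EuclideanSpace ℝ (Fin n)) R \ Metric.closedBall c r =
      {x | 0 < F x} := by
    ext x
    simp only [Set.mem_sdiff, mem_ball_zero_iff, mem_closedBall_iff_norm, not_le,
      Set.mem_ofPred_eq, hF]
    constructor
    · rintro ⟨h1, h2⟩
      exact mul_pos (by nlinarith [norm_nonneg x]) (by nlinarith)
    · intro h
      rcases mul_pos_iff.1 h with ⟨h1, h2⟩ | ⟨h1, h2⟩
      · exact ⟨by nlinarith [norm_nonneg x], by nlinarith [norm_nonneg (x - c)]⟩
      -- Both factors negative would mean a point of the small ball outside the large one,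
      -- impossible since 2r < R.
      · exfalso
        have h3 : ‖x - c‖ < r := by nlinarith [norm_nonneg (x - c)]
        have h4 : R < ‖x‖ := by nlinarith [norm_nonneg x]
        have := norm_add_le (x - c) c
        rw [sub_add_cancel] at this
        linarith
  have hd : ∀ x, HasGradientAt F ((R ^ 2 - ‖x‖ ^ 2) • (2 : ℝ) • (x - c) +
      (‖x - c‖ ^ 2 - r ^ 2) • -((2 : ℝ) • x)) x := by
    intro x
    have h1 : HasGradientAt (fun y : EuclideanSpace ℝ (Fin n) => R ^ 2 - ‖y‖ ^ 2)
        (-((2 : ℝ) • x)) x := by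
      simpa using ((hasGradientAt_const x (R ^ 2)).fun_sub (hasGradientAt_norm_sq x))
    have h2 : HasGradientAt (fun y : EuclideanSpace ℝ (Fin n) => ‖y - c‖ ^ 2 - r ^ 2)
        ((2 : ℝ) • (x - c)) x := by
      have h3 : HasGradientAt (fun y : EuclideanSpace ℝ (Fin n) => ‖y - c‖ ^ 2)
          ((2 : ℝ) • (x - c)) x := by
        have := (hasGradientAt_iff_hasFDerivAt.1 (hasGradientAt_norm_sq (x - c))).comp x
          ((hasFDerivAt_id x).sub_const c)
        exact hasGradientAt_iff_hasFDerivAt.2 this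
      simpa using h3.fun_sub (hasGradientAt_const x (r ^ 2))
    exact h1.fun_mul h2
  have hreg : ∀ p, F p = 0 → fderiv ℝ F p ≠ 0 := by
    intro p hp h0
    have h1 : ‖gradient F p‖ = 0 := by rw [norm_gradient_eq, h0, norm_zero]
    rw [norm_eq_zero, (hd p).gradient] at h1
    have htri := norm_add_le (p - c) c
    rw [sub_add_cancel] at htri
    rcases mul_eq_zero.1 hp with h | h
    · have h2 : ‖p‖ = R := by
        have : ‖p‖ ^ 2 = R ^ 2 := by linarith
        exact (sq_eq_sq₀ (norm_nonneg _) hR0.le).1 this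
      have h3 : r < ‖p - c‖ := by linarith
      rw [h, zero_smul, zero_add, smul_neg, neg_eq_zero, smul_eq_zero] at h1
      rcases h1 with h1 | h1
      · nlinarith
      · rw [smul_eq_zero] at h1
        rcases h1 with h1 | h1
        · norm_num at h1
        · rw [h1, norm_zero] at h2; linarith
    · have h2 : ‖p - c‖ = r := by
        have : ‖p - c‖ ^ 2 = r ^ 2 := by linarith
        exact (sq_eq_sq₀ (norm_nonneg _) hr.le).1 this
      have h3 : ‖p‖ < R := by linarith
      rw [h, zero_smul, add_zero, smul_eq_zero] at h1
      rcases h1 with h1 | h1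
      · nlinarith [norm_nonneg p]
      · rw [smul_eq_zero] at h1
        rcases h1 with h1 | h1
        · norm_num at h1
        · rw [h1, norm_zero] at h2; linarith
  rw [hset]
  refine ⟨isSmoothDomain_superlevel hFs ?_ hreg, ?_⟩
  · rw [← hset]
    exact isConnected_ball_diff_closedBall hn hr (by linarith)
  · rw [frontier_superlevel hFs hreg]
    simp [hF, hcn]

/-- A near-optimal function supported away from 0 does not notice the removal of a sufficiently
small ball, while the removal puts the origin on the boundary. -/
theorem exists_isSmoothDomain_hardyConstant_lt [NeZero n] (hn : 3 ≤ n) {ε : ℝ} (hε : 0 < ε) :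
    ∃ Ω : Set (EuclideanSpace ℝ (Fin n)), IsSmoothDomain Ω ∧ Bornology.IsBounded Ω ∧
      0 ∈ frontier Ω ∧ hardyConstant Ω < ENNReal.ofReal (((n : ℝ) - 2) ^ 2 / 4 + ε) := by
  obtain ⟨φ, hφ, hlt⟩ := exists_isTestFunction_ball (n := n) hn hε one_pos
  obtain ⟨d, hd, hdφ⟩ : ∃ d > 0, ∀ x ∈ tsupport φ, d ≤ ‖x‖ := by
    have h0 : (tsupport φ)ᶜ ∈ 𝓝 (0 : EuclideanSpace ℝ (Fin n)) :=
      (isClosed_tsupport φ).isOpen_compl.mem_nhds fun h => (hφ.2.2 h).1 rfl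
    obtain ⟨d, hd, hb⟩ := Metric.mem_nhds_iff.1 h0
    refine ⟨d, hd, fun x hx => ?_⟩
    by_contra! hc
    exact hb (mem_ball_zero_iff.2 hc) hx
  -- The removed ball lies in |x| ≤ 2r. It misses the support since 2r < d and fits into the unit
  -- ball since 2r < 1.
  set r := min d 1 / 3 with hr
  have hr0 : 0 < r := by positivity
  have hrd : 2 * r < d := by have := min_le_left d 1; linarith
  have hr1 : 2 * r < 1 := by have := min_le_right d 1; linarith
  obtain ⟨h1, h2⟩ := isSmoothDomain_ball_diff_closedBall (n := n) (by omega) hr0 hr1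
  refine ⟨_, h1, Metric.isBounded_ball.subset Set.sdiff_subset, h2,
    hardyConstant_lt hn h1.isOpen ENNReal.ofReal_ne_top (hφ.mono fun x hx => ?_) hlt⟩
  refine ⟨(hφ.2.2 hx).2, fun hc => ?_⟩
  rw [mem_closedBall_iff_norm] at hc
  have h3 := norm_add_le (x - EuclideanSpace.single 0 r) (EuclideanSpace.single 0 r)
  have h4 : ‖(EuclideanSpace.single 0 r : EuclideanSpace ℝ (Fin n))‖ = r := by
    simp [abs_of_pos hr0]
  rw [sub_add_cancel, h4] at h3
  linarith [hdφ x hx]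

theorem sInf_hardyConstant_eq [NeZero n] (hn : 3 ≤ n) {P : Set (EuclideanSpace ℝ (Fin n)) → Prop}
    (hP : ∀ Ω, P Ω → IsOpen Ω)
    (hP' : ∀ Ω, IsSmoothDomain Ω → Bornology.IsBounded Ω → 0 ∈ frontier Ω → P Ω) :
    sInf (hardyConstant '' {Ω | P Ω}) = ENNReal.ofReal (((n : ℝ) - 2) ^ 2 / 4) := by
  refine le_antisymm ?_ ?_
  · refine ENNReal.le_ofReal_of_forall_pos_le fun ε hε => ?_
    obtain ⟨Ω, h1, h2, h3, h4⟩ := exists_isSmoothDomain_hardyConstant_lt (n := n) hn hε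
    exact (sInf_le (Set.mem_image_of_mem _ (hP' Ω h1 h2 h3))).trans h4.le
  · refine le_sInf ?_
    rintro _ ⟨Ω, hΩ, rfl⟩
    exact hardyConstant_ge hn (hP Ω hΩ)

end PuncturedBall

/-! ### The deficit form and its polarization -/

section HardyDeficit

variable {n : ℕ} {Ω : Set (EuclideanSpace ℝ (Fin n))} {φ v w f χ : EuclideanSpace ℝ (Fin n) → ℝ}

/-- The quadratic form `∫ |∇φ|² - (n² / 4) ∫ φ² / |x|²`. -/
noncomputable def hardyDeficit (φ : EuclideanSpace ℝ (Fin n) → ℝ) : ℝ :=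
  (∫ x, ‖gradient φ x‖ ^ 2) - (n : ℝ) ^ 2 / 4 * ∫ x, φ x ^ 2 / ‖x‖ ^ 2

/-- The gradient twisted by the weight `|x|^(-n/2)`. -/
noncomputable def twistedGradient (φ : EuclideanSpace ℝ (Fin n) → ℝ)
    (x : EuclideanSpace ℝ (Fin n)) : EuclideanSpace ℝ (Fin n) :=
  gradient φ x + φ x • ((n : ℝ) / 2 / ‖x‖ ^ 2) • x

theorem IsTestFunction.continuousOn_twistedGradient (h : IsTestFunction Ω φ) :
    ContinuousOn (twistedGradient φ) {0}ᶜ := by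
  refine h.continuous_gradient.continuousOn.add (h.continuous.continuousOn.smul
    (ContinuousOn.smul (ContinuousOn.div continuousOn_const
      (continuous_norm.pow 2).continuousOn fun x hx => ?_) continuousOn_id))
  exact pow_ne_zero 2 (norm_ne_zero_iff.2 hx)

theorem twistedGradient_eq_zero {x : EuclideanSpace ℝ (Fin n)} (hx : x ∉ tsupport φ) :
    twistedGradient φ x = 0 := by
  simp [twistedGradient, gradient_eq_zero_of_notMem_tsupport hx,
    image_eq_zero_of_notMem_tsupport hx]

theorem IsTestFunction.integrable_polar (hv : IsTestFunction Ω v) (hw : IsTestFunction Ω w)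
    (h0 : 0 ∉ Ω) : Integrable (fun x => ⟪twistedGradient v x, twistedGradient w x⟫ -
      n * (v x * w x / ‖x‖ ^ 2)) := by
  refine hw.integrable isOpen_compl_singleton (O := {0}ᶜ)
    (fun x hx h => h0 (hw.2.2 (by rwa [Set.mem_singleton_iff.1 h] at hx))) ?_ fun x hx => ?_
  · refine (hv.continuousOn_twistedGradient.inner hw.continuousOn_twistedGradient).sub
      (continuousOn_const.mul (ContinuousOn.div (hv.continuous.mul hw.continuous).continuousOn
        (by fun_prop) fun x hx => ?_))
    exact pow_ne_zero 2 (norm_ne_zero_iff.2 hx)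
  · rw [twistedGradient_eq_zero hx, image_eq_zero_of_notMem_tsupport hx]
    simp

/-- The ground state identity for s = n/2, where s(n-2-s) = n²/4 - n. Twisting by |x|^(-n/2)
prepares the pairing with the half-space ground state, which contains this weight. -/
theorem IsTestFunction.hardyDeficit_eq (h : IsTestFunction Ω φ) (h0 : 0 ∉ Ω) :
    hardyDeficit φ = ∫ x, (⟪twistedGradient φ x, twistedGradient φ x⟫ -
      n * (φ x * φ x / ‖x‖ ^ 2)) := by
  have hs : 0 ∉ tsupport φ := fun hc => h0 (h.2.2 hc)
  have h1 : Integrable fun x => ⟪twistedGradient φ x, twistedGradient φ x⟫ := by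
    refine h.integrable isOpen_compl_singleton (O := {0}ᶜ)
      (fun x hx h' => hs (by rwa [Set.mem_singleton_iff.1 h'] at hx))
      (h.continuousOn_twistedGradient.inner h.continuousOn_twistedGradient) fun x hx => ?_
    rw [twistedGradient_eq_zero hx, inner_zero_left]
  have h2 := h.integrable_sq_div hs
  simp only [← sq]
  rw [integral_sub h1 (h2.const_mul _), integral_const_mul, hardyDeficit,
    h.integral_norm_gradient_sq_power hs ((n : ℝ) / 2)]
  simp only [real_inner_self_eq_norm_sq, twistedGradient]
  ring

theorem IsTestFunction.twistedGradient_add_const_mul (hv : IsTestFunction Ω v)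
    (hw : IsTestFunction Ω w) (s : ℝ) (x : EuclideanSpace ℝ (Fin n)) :
    twistedGradient (fun y => v y + s * w y) x = twistedGradient v x + s • twistedGradient w x := by
  have h1 := ((hv.hasGradientAt x).fun_add ((hw.const_mul s).hasGradientAt x)).gradient
  rw [twistedGradient, h1, hw.gradient_const_mul, twistedGradient, twistedGradient]
  module

theorem IsTestFunction.hardyDeficit_add_const_mul (hv : IsTestFunction Ω v)
    (hw : IsTestFunction Ω w) (h0 : 0 ∉ Ω) (s : ℝ) :
    hardyDeficit (fun x => v x + s * w x) = hardyDeficit v + 2 * s *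
      (∫ x, (⟪twistedGradient v x, twistedGradient w x⟫ - n * (v x * w x / ‖x‖ ^ 2))) +
      s ^ 2 * hardyDeficit w := by
  have h1 := (hv.integrable_polar hv h0).add ((hv.integrable_polar hw h0).const_mul (2 * s))
  simp only [Pi.add_def] at h1
  rw [(hv.add (hw.const_mul s)).hardyDeficit_eq h0, hv.hardyDeficit_eq h0, hw.hardyDeficit_eq h0,
    ← integral_const_mul, ← integral_const_mul,
    ← integral_add (hv.integrable_polar hv h0) ((hv.integrable_polar hw h0).const_mul _),
    ← integral_add h1 ((hw.integrable_polar hw h0).const_mul _)]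
  refine integral_congr_ae (Eventually.of_forall fun x => ?_)
  beta_reduce
  rw [hv.twistedGradient_add_const_mul hw, inner_add_left, inner_add_right, inner_add_right,
    real_inner_smul_left, real_inner_smul_right, real_inner_smul_left, real_inner_smul_right,
    real_inner_comm (twistedGradient v x) (twistedGradient w x)]
  ring

theorem powWeight_mul_powWeight_neg (s : ℝ) {x : EuclideanSpace ℝ (Fin n)} (hx : x ≠ 0) :
    powWeight s x * powWeight (-s) x = 1 := by
  have : 0 < ‖x‖ ^ 2 := by positivity
  rw [powWeight, powWeight, ← Real.rpow_add this]
  simp [← add_div]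

variable {ν : EuclideanSpace ℝ (Fin n)} {m : ℝ}

theorem twistedGradient_powWeight_mul (h : IsTestFunction Ω χ)
    {x : EuclideanSpace ℝ (Fin n)} (hx : x ≠ 0) :
    twistedGradient (fun x => powWeight (-((n : ℝ) / 2)) x * χ x) x =
      powWeight (-((n : ℝ) / 2)) x • (gradient χ x + χ x • ((n : ℝ) / ‖x‖ ^ 2) • x) := by
  have h1 := gradient_powWeight_mul_add h (-((n : ℝ) / 2)) hx
  rw [twistedGradient, smul_add, ← h1]
  module

theorem twistedGradient_halfSpaceState {x : EuclideanSpace ℝ (Fin n)} (hx : x ≠ 0)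
    (hf : f =ᶠ[𝓝 x] fun _ => 1) :
    twistedGradient (halfSpaceState ν m f) x = (powWeight ((n : ℝ) / 2) x *
      (cutoffAbove m ⟪ν, x⟫ + ⟪ν, x⟫ * (m * deriv Real.smoothTransition (m * ⟪ν, x⟫ - 1)))) • ν := by
  have e1 : halfSpaceState ν m f =ᶠ[𝓝 x]
      fun y => powWeight ((n : ℝ) / 2) y * (⟪ν, y⟫ * cutoffAbove m ⟪ν, y⟫) := by
    filter_upwards [hf] with y hy
    rw [halfSpaceState, hy]
    ring
  have h1 := (hasGradientAt_inner_left ν x).fun_mul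
    ((hasDerivAt_cutoffAbove m ⟪ν, x⟫).comp_hasGradientAt (hasGradientAt_inner_left ν x))
  have h2 := (hasGradientAt_powWeight ((n : ℝ) / 2) hx).fun_mul h1
  have h3 : HasGradientAt (halfSpaceState ν m f) _ x :=
    hasGradientAt_iff_hasFDerivAt.2 (h2.hasFDerivAt.congr_of_eventuallyEq e1)
  rw [twistedGradient, h3.gradient, e1.self_of_nhds]
  module

/-- The weights |x|^(-n/2) and |x|^(n/2) of the two functions cancel, and so do the zero-order
terms, except for those with the derivative of the boundary cutoff. As m grows, only ⟨ν, ∇χ⟩ on the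
half-space matters. -/
theorem polar_halfSpaceState (h : IsTestFunction {0}ᶜ χ)
    (hχ : ∀ x ∈ tsupport χ, f =ᶠ[𝓝 x] fun _ => 1)
    (x : EuclideanSpace ℝ (Fin n)) :
    ⟪twistedGradient (halfSpaceState ν m f) x,
      twistedGradient (fun x => powWeight (-((n : ℝ) / 2)) x * χ x) x⟫ -
      n * (halfSpaceState ν m f x * (powWeight (-((n : ℝ) / 2)) x * χ x) / ‖x‖ ^ 2) =
    (cutoffAbove m ⟪ν, x⟫ + ⟪ν, x⟫ * (m * deriv Real.smoothTransition (m * ⟪ν, x⟫ - 1))) *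
      ⟪ν, gradient χ x⟫ +
    n * (⟪ν, x⟫ * (⟪ν, x⟫ * (m * deriv Real.smoothTransition (m * ⟪ν, x⟫ - 1)))) *
      (χ x / ‖x‖ ^ 2) := by
  by_cases hx : x ∈ tsupport χ
  · have hx0 : x ≠ 0 := fun hc => h.2.2 hx hc
    rw [twistedGradient_halfSpaceState hx0 (hχ x hx), twistedGradient_powWeight_mul h hx0,
      halfSpaceState, (hχ x hx).self_of_nhds, real_inner_smul_left, real_inner_smul_right,
      inner_add_right, real_inner_smul_right, real_inner_smul_right]
    have hp := powWeight_mul_powWeight_neg ((n : ℝ) / 2) hx0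
    set p := powWeight ((n : ℝ) / 2) x
    set p' := powWeight (-((n : ℝ) / 2)) x
    set c := cutoffAbove m ⟪ν, x⟫
    set d := m * deriv Real.smoothTransition (m * ⟪ν, x⟫ - 1)
    set t := ⟪ν, x⟫
    linear_combination ((c + t * d) * (⟪ν, gradient χ x⟫ + χ x * (n / ‖x‖ ^ 2 * t)) -
      n * t * c * χ x / ‖x‖ ^ 2) * hp
  · have h1 : x ∉ tsupport fun x => powWeight (-((n : ℝ) / 2)) x * χ x :=
      fun hc => hx (tsupport_mul_subset_right hc)
    rw [twistedGradient_eq_zero h1, gradient_eq_zero_of_notMem_tsupport hx,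
      image_eq_zero_of_notMem_tsupport hx]
    simp

theorem deriv_smoothTransition_nonneg (t : ℝ) : 0 ≤ deriv Real.smoothTransition t :=
  Real.smoothTransition.monotone.deriv_nonneg

end HardyDeficit

/-! ### A bump centred on the boundary hyperplane -/

section RadialBump

variable {n : ℕ}

/-- The bump is a nonincreasing function of |x - q|² with q on the hyperplane. Its normal derivative
is therefore a nonpositive multiple of ⟨ν, x⟩. -/
theorem exists_radial_bump {ν q : EuclideanSpace ℝ (Fin n)} (hν : ‖ν‖ = 1) (hq : ⟪ν, q⟫ = 0) {ρ : ℝ}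
    (hρ : 0 < ρ) : ∃ χ : EuclideanSpace ℝ (Fin n) → ℝ, IsTestFunction (Metric.closedBall q ρ) χ ∧
      (∀ x, 0 ≤ χ x) ∧ (∀ x, 0 ≤ ⟪ν, x⟫ → ⟪ν, gradient χ x⟫ ≤ 0) ∧
      ∃ x, 0 < ⟪ν, x⟫ ∧ ⟪ν, gradient χ x⟫ < 0 := by
  set g : EuclideanSpace ℝ (Fin n) → ℝ := fun x => 1 - (ρ ^ 2)⁻¹ * ‖x - q‖ ^ 2 with hg
  set χ : EuclideanSpace ℝ (Fin n) → ℝ := fun x => Real.smoothTransition (g x) with hχ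
  have hgs : ContDiff ℝ ∞ g :=
    contDiff_const.sub (contDiff_const.mul ((contDiff_id.sub contDiff_const).norm_sq ℝ))
  have hgrad : ∀ x, ⟪ν, gradient χ x⟫ =
      -(2 * (ρ ^ 2)⁻¹ * deriv Real.smoothTransition (g x) * ⟪ν, x⟫) := by
    intro x
    have h1 : HasGradientAt (fun y : EuclideanSpace ℝ (Fin n) => ‖y - q‖ ^ 2)
        ((2 : ℝ) • (x - q)) x := by
      have := (hasGradientAt_iff_hasFDerivAt.1 (hasGradientAt_norm_sq (x - q))).comp x
        ((hasFDerivAt_id x).sub_const q)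
      exact hasGradientAt_iff_hasFDerivAt.2 this
    have h2 : HasDerivAt (fun t : ℝ => 1 - (ρ ^ 2)⁻¹ * t) (-(ρ ^ 2)⁻¹) (‖x - q‖ ^ 2) := by
      simpa using ((hasDerivAt_id (‖x - q‖ ^ 2)).const_mul (ρ ^ 2)⁻¹).const_sub 1
    have h3 := HasDerivAt.comp_hasGradientAt
      (f := fun y : EuclideanSpace ℝ (Fin n) => ‖y - q‖ ^ 2) h2 h1
    have h4 := HasDerivAt.comp_hasGradientAt (f := g) (hasDerivAt_smoothTransition (g x)) h3
    rw [HasGradientAt.gradient h4, real_inner_smul_right, real_inner_smul_right,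
      real_inner_smul_right, inner_sub_right, hq]
    ring
  have hz : ∀ x ∉ Metric.closedBall q ρ, χ x = 0 := by
    intro x hx
    rw [mem_closedBall_iff_norm, not_le] at hx
    refine Real.smoothTransition.zero_of_nonpos ?_
    have : ρ ^ 2 ≤ ‖x - q‖ ^ 2 := by gcongr
    have h2 : 1 ≤ (ρ ^ 2)⁻¹ * ‖x - q‖ ^ 2 := by
      rw [inv_mul_eq_div, le_div_iff₀ (by positivity)]
      linarith
    rw [hg]
    linarith
  refine ⟨χ, IsTestFunction.of_contDiffOn isOpen_univ
    (Real.smoothTransition.contDiff.comp hgs).contDiffOn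
    (isCompact_closedBall q ρ) (Set.subset_univ _) subset_rfl hz,
    fun x => Real.smoothTransition.nonneg _, fun x hx => ?_, ?_⟩
  · rw [hgrad, neg_nonpos]
    have := deriv_smoothTransition_nonneg (g x)
    positivity
  -- The mean value theorem finds an argument where the transition has slope 1; the point q + t ν is
  -- placed so that the profile is evaluated there.
  · obtain ⟨y, hy, hd⟩ := exists_deriv_eq_slope Real.smoothTransition (zero_lt_one' ℝ)
      Real.smoothTransition.continuous.continuousOn
      ((Real.smoothTransition.contDiff (n := 1)).differentiable (by simp)).differentiableOn
    rw [Real.smoothTransition.one, Real.smoothTransition.zero] at hd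
    set t := ρ * Real.sqrt (1 - y) with ht
    have ht0 : 0 < t := mul_pos hρ (Real.sqrt_pos.2 (by linarith [hy.2]))
    have hi : ⟪ν, q + t • ν⟫ = t := by
      rw [inner_add_right, hq, real_inner_smul_right, real_inner_self_eq_norm_sq, hν]
      ring
    have hgy : g (q + t • ν) = y := by
      rw [hg]
      beta_reduce
      rw [add_sub_cancel_left, norm_smul, hν, mul_one, Real.norm_eq_abs, sq_abs, ht, mul_pow,
        Real.sq_sqrt (by linarith [hy.2])]
      field_simp
      ring
    refine ⟨q + t • ν, by rw [hi]; exact ht0, ?_⟩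
    rw [hgrad, hi, hgy, hd, neg_lt_zero]
    positivity

end RadialBump

/-! ### Negative deficit beyond the half-space -/

section StrictDescent

variable {n : ℕ}

/-- Adding a small bump at the boundary of a half-space lowers the Hardy constant. -/
theorem exists_isTestFunction_halfSpace_union (hn : n ≠ 0) {ν q : EuclideanSpace ℝ (Fin n)}
    (hν : ‖ν‖ = 1) (hq : ⟪ν, q⟫ = 0) (hq1 : ‖q‖ = 1) {ρ : ℝ} (hρ : 0 < ρ) (hρ1 : ρ ≤ 1 / 2) :
    ∃ u, IsTestFunction ({x | 0 < ⟪ν, x⟫} ∪ Metric.closedBall q ρ) u ∧ hardyDeficit u < 0 := by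
  obtain ⟨χ, hχ, hχ0, hχd, y, hy0, hyd⟩ := exists_radial_bump hν hq hρ
  obtain ⟨D, hD0, hD⟩ := exists_abs_deriv_smoothTransition_le
  have hball : ∀ x ∈ Metric.closedBall q ρ, 1 / 2 ≤ ‖x‖ ∧ ‖x‖ ≤ 3 / 2 := by
    intro x hx
    rw [mem_closedBall_iff_norm] at hx
    have h1 := norm_sub_norm_le q x
    have h2 := norm_sub_norm_le x q
    rw [norm_sub_rev] at h1
    constructor <;> linarith
  set Ω : Set (EuclideanSpace ℝ (Fin n)) := {x | 0 < ⟪ν, x⟫} ∪ Metric.closedBall q ρ with hΩ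
  have h0Ω : 0 ∉ Ω := by
    rintro (h | h)
    · simp at h
    · have := (hball 0 h).1
      rw [norm_zero] at this
      norm_num at this
  have hχΩ : IsTestFunction {0}ᶜ χ := hχ.mono fun x hx hc =>
    h0Ω (Or.inr (by rw [Set.mem_singleton_iff.1 hc] at hx; exact hχ.2.2 hx))
  have hχs : (0 : EuclideanSpace ℝ (Fin n)) ∉ tsupport χ := fun hc => hχΩ.2.2 hc rfl
  set w : EuclideanSpace ℝ (Fin n) → ℝ := fun x => powWeight (-((n : ℝ) / 2)) x * χ x with hw
  have hwt : IsTestFunction Ω w :=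
    (hχ.mono (hχ.2.2.trans Set.subset_union_right)).powWeight_mul hχs _
  -- A fixed cutoff level, used to bound the first-order gain from below by some β > 0 that does not
  -- depend on the later choice of m.
  obtain ⟨m₀, hm₀, hm₀y⟩ : ∃ m₀ : ℝ, 0 < m₀ ∧ 2 ≤ m₀ * ⟪ν, y⟫ :=
    ⟨2 / ⟪ν, y⟫, by positivity, by rw [div_mul_cancel₀ _ hy0.ne']⟩
  have hic : Continuous fun x : EuclideanSpace ℝ (Fin n) => ⟪ν, x⟫ := by fun_prop
  set κ : EuclideanSpace ℝ (Fin n) → ℝ := fun x => -(cutoffAbove m₀ ⟪ν, x⟫ * ⟪ν, gradient χ x⟫)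
    with hκ
  have hκc : Continuous κ :=
    (((contDiff_cutoffAbove m₀).continuous.comp hic).mul
      (hic.comp hχ.continuous_gradient)).neg
  have hκs : HasCompactSupport κ := HasCompactSupport.intro hχ.2.1 fun x hx => by
    simp only [hκ]
    rw [gradient_eq_zero_of_notMem_tsupport hx, inner_zero_right, mul_zero, neg_zero]
  have hκ0 : 0 ≤ κ := by
    intro x
    simp only [hκ, Pi.zero_apply, Left.nonneg_neg_iff]
    rcases le_or_gt 0 ⟪ν, x⟫ with h | h
    · exact mul_nonpos_of_nonneg_of_nonpos (Real.smoothTransition.nonneg _) (hχd x h)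
    · rw [cutoffAbove_eq_zero (by nlinarith), zero_mul]
  have hβ : 0 < ∫ x, κ x := by
    refine hκc.integral_pos_of_hasCompactSupport_nonneg_nonzero hκs hκ0 (x := y) ?_
    simp only [hκ, cutoffAbove_eq_one hm₀y]
    linarith
  set β := ∫ x, κ x with hβdef
  have hχi : Integrable fun x => χ x / ‖x‖ ^ 2 := by
    refine hχ.integrable isOpen_compl_singleton (O := {0}ᶜ) hχΩ.2.2
      (ContinuousOn.div hχ.continuous.continuousOn (by fun_prop) fun x hx => ?_)
      fun x hx => by simp [image_eq_zero_of_notMem_tsupport hx]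
    exact pow_ne_zero 2 (norm_ne_zero_iff.2 hx)
  set I := ∫ x, χ x / ‖x‖ ^ 2 with hI
  have hI0 : 0 ≤ I := integral_nonneg fun x => div_nonneg (hχ0 x) (by positivity)
  -- Small enough that the second-order term s² · deficit(w) is at most sβ/2. Only then are f and m
  -- chosen, since the deficit of the truncated state must be below sβ/4.
  set s := β / (2 * (|hardyDeficit w| + 1)) with hs
  have hs0 : 0 < s := by positivity
  obtain ⟨f, hf, hf1, hev⟩ := exists_halfSpaceState (n := n) hn hν
    (show 0 < s * β / 4 by positivity) (R := 4) (by norm_num)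
  have hfχ : ∀ x ∈ tsupport χ, f =ᶠ[𝓝 x] fun _ => 1 := by
    intro x hx
    obtain ⟨h1, h2⟩ := hball x (hχ.2.2 hx)
    have h3 : ∀ᶠ z in 𝓝 x, 1 / 4 < ‖z‖ :=
      continuous_norm.continuousAt.eventually_const_lt (by linarith)
    have h4 : ∀ᶠ z in 𝓝 x, ‖z‖ < 4 :=
      continuous_norm.continuousAt.eventually_lt_const (by linarith)
    filter_upwards [h3, h4] with z h3 h4
    exact hf1 z (by linarith) h4.le
  obtain ⟨m, hm, hmm, hmI⟩ := (hev.and ((eventually_ge_atTop m₀).and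
    (eventually_gt_atTop (16 * (n * D * I + 1) / β)))).exists
  have hm0 : 0 < m := hm₀.trans_le hmm
  set v := halfSpaceState ν m f with hv
  have hvt : IsTestFunction Ω v := (hf.halfSpaceState ν hm0).mono
    ((hf.halfSpaceState ν hm0).2.2.trans Set.subset_union_left)
  refine ⟨_, hvt.add (hwt.const_mul s), ?_⟩
  rw [hvt.hardyDeficit_add_const_mul hwt h0Ω]
  have hκi : Integrable fun x => -κ x := (hκc.integrable_of_hasCompactSupport hκs).neg
  have hB : ∫ x, (⟪twistedGradient v x, twistedGradient w x⟫ - n * (v x * w x / ‖x‖ ^ 2)) ≤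
      -β + 4 * n * D / m * I := by
    rw [hβdef, hI, ← integral_neg, ← integral_const_mul,
      ← integral_add hκi (hχi.const_mul _)]
    refine integral_mono (hvt.integrable_polar hwt h0Ω)
      (hκi.add (hχi.const_mul _)) fun x => ?_
    simp only [hv, hw, polar_halfSpaceState hχΩ hfχ x, hκ, neg_neg]
    set t := ⟪ν, x⟫ with ht
    set d := deriv Real.smoothTransition (m * t - 1) with hd
    have hd0 : 0 ≤ d := deriv_smoothTransition_nonneg _
    have hg0 : 0 ≤ χ x / ‖x‖ ^ 2 := div_nonneg (hχ0 x) (by positivity)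
    refine add_le_add ?_ ?_
    · rcases le_or_gt t 0 with h | h
      · rw [cutoffAbove_eq_zero (by nlinarith), cutoffAbove_eq_zero (by nlinarith), hd,
          deriv_smoothTransition_eq_zero (Or.inl (by nlinarith))]
        simp
      · refine mul_le_mul_of_nonpos_right ?_ (hχd x h.le)
        have h1 : cutoffAbove m₀ t ≤ cutoffAbove m t :=
          Real.smoothTransition.monotone (by nlinarith)
        have h2 : 0 ≤ t * (m * d) := by positivity
        linarith
    · refine mul_le_mul_of_nonneg_right ?_ hg0
      have h1 : t * (t * (m * d)) ≤ 4 * D / m := by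
        by_cases hc : m * t - 1 < 0 ∨ 1 < m * t - 1
        · rw [hd, deriv_smoothTransition_eq_zero hc]
          simp only [mul_zero]
          positivity
        · push Not at hc
          have hd1 : d ≤ D := (le_abs_self _).trans (hD _)
          have h3 : 0 ≤ m * t := by linarith
          rw [le_div_iff₀ hm0]
          calc t * (t * (m * d)) * m = (m * t) * (m * t) * d := by ring
            _ ≤ 2 * 2 * D := by
              gcongr
              · linarith
              · linarith
            _ = 4 * D := by ring
      calc (n : ℝ) * (t * (t * (m * d))) ≤ n * (4 * D / m) := by gcongr
        _ = 4 * n * D / m := by ring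
  have h1 : 4 * n * D / m * I ≤ β / 4 := by
    rw [div_lt_iff₀ hβ] at hmI
    rw [div_mul_eq_mul_div, div_le_iff₀ hm0]
    linarith
  have h2 : s ^ 2 * hardyDeficit w ≤ s * (β / 2) := by
    rw [sq, mul_assoc]
    refine mul_le_mul_of_nonneg_left ?_ hs0.le
    calc s * hardyDeficit w ≤ s * (|hardyDeficit w| + 1) := by
          gcongr
          linarith [le_abs_self (hardyDeficit w)]
      _ = β / 2 := by rw [hs]; field_simp
  have h3 : hardyDeficit v < s * β / 4 := hm
  -- In total the deficit is less than sβ/4 + 2s(-β + β/4) + sβ/2 = -3sβ/4.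
  have h4 := mul_le_mul_of_nonneg_left hB (by positivity : 0 ≤ 2 * s)
  have h5 := mul_le_mul_of_nonneg_left h1 (by positivity : 0 ≤ 2 * s)
  have h6 : 0 < s * β := by positivity
  nlinarith

end StrictDescent

/-! ### Domains slightly larger than the half-space -/

section PerturbedHalfSpace

variable {n : ℕ}

/-- A bump about q composed with the orthogonal projection onto the complement of e. The projection
is a contraction fixing q, so the values near 0 and near q are controlled. -/
theorem exists_cylindrical_bump {e q : EuclideanSpace ℝ (Fin n)} (he : ‖e‖ = 1) (hq : ⟪e, q⟫ = 0)
    (hq1 : ‖q‖ = 1) : ∃ h : EuclideanSpace ℝ (Fin n) → ℝ, ContDiff ℝ ∞ h ∧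
      (∀ x (t : ℝ), h (x + t • e) = h x) ∧ (∀ x, 0 ≤ h x) ∧ (∀ x, h x ≤ 1) ∧
      (∀ x, ‖x‖ ≤ 1 / 2 → h x = 0) ∧ (∀ x ∈ Metric.closedBall q (1 / 4), h x = 1) ∧
      ∃ D, 0 ≤ D ∧ ∀ x, ‖fderiv ℝ h x‖ ≤ D := by
  let P : EuclideanSpace ℝ (Fin n) →L[ℝ] EuclideanSpace ℝ (Fin n) :=
    ContinuousLinearMap.id ℝ _ - (innerSL ℝ e).smulRight e
  have hP : ∀ x, P x = x - ⟪e, x⟫ • e := fun x => by simp [P]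
  have hPn : ∀ x, ‖P x‖ ≤ ‖x‖ := fun x => by
    rw [← abs_norm (P x), ← abs_norm x, ← sq_le_sq, hP, norm_sub_sq_real, real_inner_smul_right,
      real_inner_comm, norm_smul, he, mul_one, Real.norm_eq_abs, sq_abs]
    nlinarith [sq_nonneg ⟪e, x⟫]
  have hPq : P q = q := by rw [hP, hq, zero_smul, sub_zero]
  let ψ : ContDiffBump q := ⟨1 / 4, 1 / 2, by norm_num, by norm_num⟩
  have hψ : ContDiff ℝ ∞ ψ := ψ.contDiff
  refine ⟨fun x => ψ (P x), hψ.comp P.contDiff, fun x t => ?_, fun x => ψ.nonneg,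
    fun x => ψ.le_one, fun x hx => ?_, fun x hx => ?_, ?_⟩
  · have : P (x + t • e) = P x := by
      simp only [hP, inner_add_right, real_inner_smul_right, real_inner_self_eq_norm_sq, he]
      module
    beta_reduce
    rw [this]
  · refine ψ.zero_of_le_dist ?_
    rw [dist_comm, dist_eq_norm]
    have h1 := norm_sub_norm_le q (P x)
    have h2 := hPn x
    change (1 : ℝ) / 2 ≤ _
    linarith
  · refine ψ.one_of_mem_closedBall ?_
    rw [mem_closedBall_iff_norm] at hx ⊢
    have h1 := hPn (x - q)
    rw [map_sub, hPq] at h1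
    exact h1.trans hx
  · obtain ⟨C, hC⟩ := (ψ.hasCompactSupport.fderiv (𝕜 := ℝ)).exists_bound_of_continuous
      (hψ.continuous_fderiv (by simp))
    refine ⟨C * ‖P‖, mul_nonneg ((norm_nonneg _).trans (hC 0)) (norm_nonneg _), fun x => ?_⟩
    have h1 : HasFDerivAt (fun x => ψ (P x)) ((fderiv ℝ ψ (P x)).comp P) x :=
      (hψ.differentiable (by simp) (P x)).hasFDerivAt.comp x P.hasFDerivAt
    rw [h1.fderiv]
    exact (ContinuousLinearMap.opNorm_comp_le _ _).trans (by gcongr; exact hC _)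

/-- The shear `x ↦ x - h(x) e` along a direction in which `h` is constant. -/
noncomputable def shearHomeomorph {e : EuclideanSpace ℝ (Fin n)} {h : EuclideanSpace ℝ (Fin n) → ℝ}
    (hc : Continuous h) (hinv : ∀ x (t : ℝ), h (x + t • e) = h x) :
    EuclideanSpace ℝ (Fin n) ≃ₜ EuclideanSpace ℝ (Fin n) where
  toFun x := x - h x • e
  invFun x := x + h x • e
  left_inv x := by
    have := hinv x (-h x)
    rw [neg_smul, ← sub_eq_add_neg] at this
    simp [this]
  right_inv x := by simp [hinv]
  continuous_toFun := by fun_prop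
  continuous_invFun := by fun_prop

/-- Domains slightly larger than a half-space, with Hardy constant close to that of the
half-space. -/
theorem exists_isSmoothDomain_near_halfSpace [NeZero n] (hn : 3 ≤ n) {ε : ℝ} (hε : 0 < ε) :
    ∃ Ω : Set (EuclideanSpace ℝ (Fin n)), IsSmoothDomain Ω ∧ halfSpace n ⊂ Ω ∧ Ω ⊂ Set.univ ∧
      0 ∈ frontier Ω ∧ ENNReal.ofReal ((n : ℝ) ^ 2 / 4 - ε) ≤ hardyConstant Ω ∧
      hardyConstant Ω < ENNReal.ofReal ((n : ℝ) ^ 2 / 4) := by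
  have hn' : (3 : ℝ) ≤ n := by exact_mod_cast hn
  set e : EuclideanSpace ℝ (Fin n) := EuclideanSpace.single 0 1 with he
  have he1 : ‖e‖ = 1 := by simp [he]
  obtain ⟨q, hq, hq1⟩ : ∃ q : EuclideanSpace ℝ (Fin n), ⟪e, q⟫ = 0 ∧ ‖q‖ = 1 := by
    refine ⟨EuclideanSpace.single ⟨1, by omega⟩ 1, ?_, by simp⟩
    simp [he, EuclideanSpace.inner_single_left, Fin.ext_iff]
  obtain ⟨h, hs, hinv, h0, h1, hz, hone, D, hD0, hD⟩ := exists_cylindrical_bump he1 hq hq1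
  set c := max ((n : ℝ) ^ 2 / 4 - ε) 0 with hcdef
  have hc0 : 0 ≤ c := le_max_right _ _
  have hc : c < (n : ℝ) ^ 2 / 4 := max_lt (by linarith) (by positivity)
  obtain ⟨τ, hτ1, hτ⟩ := exists_sq_mul_lt hc
  have hτ0 : 0 < τ := by linarith
  obtain ⟨η, hη, hpull⟩ := exists_pullback_of_near_id (n := n) hτ1
  -- D controls the derivative of the shear. The 2 controls its displacement: h ≤ 1 vanishes for |x|
  -- ≤ 1/2, hence h(x) ≤ 2|x|.
  set δ := η / (D + 2) with hδdef
  have hδ : 0 < δ := by positivity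
  have hδη : δ * (D + 2) = η := div_mul_cancel₀ _ (by positivity)
  set F : EuclideanSpace ℝ (Fin n) → ℝ := fun x => ⟪e, x⟫ + δ * h x with hF
  have hsi : ContDiff ℝ ∞ fun x : EuclideanSpace ℝ (Fin n) => ⟪e, x⟫ := (innerSL ℝ e).contDiff
  have hFs : ContDiff ℝ ∞ F := hsi.add (contDiff_const.mul hs)
  have hFe : ∀ x (t : ℝ), F (x + t • e) = F x + t := fun x t => by
    simp only [hF, hinv, inner_add_right, real_inner_smul_right, real_inner_self_eq_norm_sq, he1]
    ring
  -- F grows with slope 1 along e, so every value is regular.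
  have hreg : ∀ p, F p = 0 → fderiv ℝ F p ≠ 0 := by
    intro p _ hp
    have e1 : HasDerivAt (fun t : ℝ => F (p + t • e)) (fderiv ℝ F p e) 0 := by
      have h2 : HasDerivAt (fun t : ℝ => p + t • e) e 0 := by
        simpa using ((hasDerivAt_id (0 : ℝ)).smul_const e).const_add p
      have h3 : HasFDerivAt F (fderiv ℝ F p) (p + (0 : ℝ) • e) := by
        simpa using (hFs.differentiable (by simp) p).hasFDerivAt
      exact h3.comp_hasDerivAt 0 h2
    have e2 : HasDerivAt (fun t : ℝ => F (p + t • e)) 1 0 := by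
      simp only [hFe]
      simpa using (hasDerivAt_id (0 : ℝ)).const_add (F p)
    have := e1.unique e2
    rw [hp] at this
    simp at this
  have hδs : ContDiff ℝ ∞ fun x => δ * h x := contDiff_const.mul hs
  set Φ := shearHomeomorph (e := e) hδs.continuous (fun x t => by rw [hinv]) with hΦdef
  have hΦ : ∀ x, Φ x = x - (δ * h x) • e := fun x => rfl
  have hFΦ : ∀ x, F (Φ x) = ⟪e, x⟫ := fun x => by
    rw [hΦ, sub_eq_add_neg, ← neg_smul, hFe]
    simp only [hF]
    ring
  have himg : Φ '' {x | 0 < ⟪e, x⟫} = {x | 0 < F x} := by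
    ext y
    constructor
    · rintro ⟨x, hx, rfl⟩
      rwa [Set.mem_ofPred_eq, hFΦ]
    · intro hy
      refine ⟨Φ.symm y, ?_, Φ.apply_symm_apply y⟩
      rw [Set.mem_ofPred_eq, ← hFΦ, Φ.apply_symm_apply]
      exact hy
  have hconn : IsConnected {x | 0 < F x} := by
    rw [← himg]
    refine IsConnected.image ⟨⟨e, by simp [he1]⟩, ?_⟩ _ Φ.continuous.continuousOn
    exact (convex_halfSpace_gt (innerSL ℝ e).isLinear 0).isPreconnected
  have hΩ := isSmoothDomain_superlevel hFs hconn hreg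
  have hF0 : F 0 = 0 := by simp [hF, hz 0 (by simp)]
  refine ⟨{x | 0 < F x}, hΩ, ?_, ?_, ?_, ?_, ?_⟩
  · rw [halfSpace_eq, Set.ssubset_iff_of_subset]
    -- At this point ⟨e, x⟩ = -δ/2 while F = δ/2, because h is 1 on the line through q.
    · refine ⟨q + (-(δ / 2)) • e, ?_, ?_⟩
      · rw [Set.mem_ofPred_eq, hFe]
        simp only [hF, hq, hone q (Metric.mem_closedBall_self (by norm_num))]
        linarith
      · simp only [Set.mem_ofPred_eq, inner_add_right, ← he, hq, real_inner_smul_right,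
          real_inner_self_eq_norm_sq, he1]
        linarith
    · intro x hx
      have hx : 0 < ⟪e, x⟫ := hx
      exact add_pos_of_pos_of_nonneg hx (mul_nonneg hδ.le (h0 x))
  · rw [Set.ssubset_univ_iff, Set.ne_univ_iff_exists_notMem]
    exact ⟨0, by simp [hF0]⟩
  · rw [frontier_superlevel hFs hreg]
    exact hF0
  · refine (ENNReal.ofReal_le_ofReal (le_max_left _ 0)).trans ?_
    rw [← hcdef, le_hardyConstant_iff hn hΩ.isOpen ENNReal.ofReal_ne_top]
    intro φ hφ
    have hnear : ∀ x, ‖fderiv ℝ Φ x - ContinuousLinearMap.id ℝ _‖ ≤ η ∧ ‖Φ x - x‖ ≤ η * ‖x‖ := by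
      intro x
      constructor
      · have e1 : HasFDerivAt Φ (ContinuousLinearMap.id ℝ _ -
            (δ • fderiv ℝ h x).smulRight e) x :=
          (hasFDerivAt_id x).sub
            (((hs.differentiable (by simp) x).hasFDerivAt.const_mul δ).smul_const e)
        have e2 : fderiv ℝ Φ x = _ := e1.fderiv
        rw [e2, sub_sub_cancel_left, norm_neg,
          ContinuousLinearMap.norm_smulRight_apply, he1, mul_one, norm_smul, Real.norm_eq_abs,
          abs_of_pos hδ]
        calc δ * ‖fderiv ℝ h x‖ ≤ δ * (D + 2) := by gcongr; linarith [hD x]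
          _ = η := hδη
      · have e1 : ‖Φ x - x‖ = δ * h x := by
          rw [hΦ, sub_sub_cancel_left, norm_neg, norm_smul, he1, mul_one, Real.norm_eq_abs,
            abs_of_nonneg (mul_nonneg hδ.le (h0 x))]
        have e2 : h x ≤ (D + 2) * ‖x‖ := by
          rcases le_total ‖x‖ (1 / 2) with hx | hx
          · rw [hz x hx]; positivity
          · nlinarith [h1 x]
        rw [e1, ← hδη, mul_assoc]
        gcongr
    obtain ⟨v, hv, hv1, hv2⟩ := hpull Φ.toOpenPartialHomeomorph
      (contDiff_id.sub (hδs.smul contDiff_const)).contDiffOn (fun x _ => hnear x) φ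
      (hφ.mono (Set.subset_univ _))
    have hvH := hv.hardy_halfSpace (ν := e) (hv.2.2.trans fun x hx => by
      have := hφ.2.2 hx.2
      rw [Set.mem_ofPred_eq] at this ⊢
      rwa [← hFΦ])
    have key : ENNReal.ofReal τ * (ENNReal.ofReal c * hardyEnergy φ) ≤
        ENNReal.ofReal τ * dirichletEnergy φ :=
      calc _ ≤ ENNReal.ofReal τ * (ENNReal.ofReal c * (ENNReal.ofReal τ * hardyEnergy v)) := by
            gcongr
        _ = ENNReal.ofReal (τ ^ 2 * c) * hardyEnergy v := by
            rw [← mul_assoc, ← mul_assoc, ← ENNReal.ofReal_mul hτ0.le,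
              ← ENNReal.ofReal_mul (by positivity)]
            congr 2; ring
        _ ≤ ENNReal.ofReal ((n : ℝ) ^ 2 / 4) * hardyEnergy v := by gcongr
        _ ≤ _ := hvH.trans hv1
    rwa [ENNReal.mul_le_mul_iff_right (by simpa using hτ0) ENNReal.ofReal_ne_top] at key
  -- On the ball of radius ρ about q one has h = 1 since ρ ≤ 1/4, and ⟨e, x⟩ ≥ -ρ > -δ, so the ball
  -- lies in the enlarged domain.
  · set ρ := min δ (1 / 4) / 2 with hρdef
    have hρ : 0 < ρ := by positivity
    have hρδ : ρ < δ := by have := min_le_left δ (1 / 4); linarith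
    have hρ4 : ρ ≤ 1 / 4 := by have := min_le_right δ (1 / 4); linarith
    obtain ⟨u, hu, hlt⟩ := exists_isTestFunction_halfSpace_union (n := n) (by omega) he1 hq hq1
      hρ (by linarith)
    have huΩ : IsTestFunction {x | 0 < F x} u := by
      refine hu.mono (hu.2.2.trans ?_)
      rintro x (hx | hx)
      · have hx : 0 < ⟪e, x⟫ := hx
        exact add_pos_of_pos_of_nonneg hx (mul_nonneg hδ.le (h0 x))
      · have h2 : h x = 1 := hone x (Metric.closedBall_subset_closedBall hρ4 hx)
        rw [mem_closedBall_iff_norm] at hx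
        have h3 : |⟪e, x - q⟫| ≤ ρ :=
          (abs_real_inner_le_norm e (x - q)).trans (by rwa [he1, one_mul])
        rw [inner_sub_right, hq, sub_zero] at h3
        rw [Set.mem_ofPred_eq]
        simp only [hF, h2]
        linarith [neg_le_of_abs_le h3]
    refine hardyConstant_lt hn hΩ.isOpen ENNReal.ofReal_ne_top huΩ ?_
    rw [huΩ.dirichletEnergy_lt_iff (fun hc => by have := huΩ.2.2 hc; simp [hF0] at this)
      (by positivity)]
    rw [hardyDeficit] at hlt
    linarith

end PerturbedHalfSpace

theorem mainTheorem11 (n : ℕ) [NeZero n] (hn : 3 ≤ n) :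
    -- (1) the singularity is an interior point
    (∀ Ω : Set (EuclideanSpace ℝ (Fin n)), IsSmoothDomain Ω → 0 ∈ Ω →
      hardyConstant Ω = ENNReal.ofReal (((n : ℝ) - 2) ^ 2 / 4)) ∧
    -- (2) the singularity is a boundary point; the lower bound is strict on bounded domains
    (∀ Ω : Set (EuclideanSpace ℝ (Fin n)), IsSmoothDomain Ω → 0 ∈ frontier Ω →
      ENNReal.ofReal (((n : ℝ) - 2) ^ 2 / 4) ≤ hardyConstant Ω ∧
      hardyConstant Ω ≤ ENNReal.ofReal ((n : ℝ) ^ 2 / 4) ∧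
      (Bornology.IsBounded Ω →
        ENNReal.ofReal (((n : ℝ) - 2) ^ 2 / 4) < hardyConstant Ω)) ∧
    -- (3) domains inside the half-space
    (∀ Ω : Set (EuclideanSpace ℝ (Fin n)), IsSmoothDomain Ω → 0 ∈ frontier Ω →
      Ω ⊆ halfSpace n → hardyConstant Ω = ENNReal.ofReal ((n : ℝ) ^ 2 / 4)) ∧
    -- (4) attainment
    (∀ Ω : Set (EuclideanSpace ℝ (Fin n)), IsSmoothDomain Ω → Bornology.IsBounded Ω →
      0 ∈ frontier Ω → hardyConstant Ω < ENNReal.ofReal ((n : ℝ) ^ 2 / 4) →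
      HardyConstantAttained Ω) ∧
    -- (5) the infimum over all smooth domains, and over the bounded ones
    sInf (hardyConstant '' {Ω : Set (EuclideanSpace ℝ (Fin n)) |
        IsSmoothDomain Ω ∧ 0 ∈ frontier Ω}) = ENNReal.ofReal (((n : ℝ) - 2) ^ 2 / 4) ∧
    sInf (hardyConstant '' {Ω : Set (EuclideanSpace ℝ (Fin n)) |
        IsSmoothDomain Ω ∧ Bornology.IsBounded Ω ∧ 0 ∈ frontier Ω}) =
      ENNReal.ofReal (((n : ℝ) - 2) ^ 2 / 4) ∧
    -- (6) domains slightly larger than the half-space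
    (∀ ε : ℝ, 0 < ε → ∃ Ω : Set (EuclideanSpace ℝ (Fin n)),
      IsSmoothDomain Ω ∧ halfSpace n ⊂ Ω ∧ Ω ⊂ Set.univ ∧ 0 ∈ frontier Ω ∧
      ENNReal.ofReal ((n : ℝ) ^ 2 / 4 - ε) ≤ hardyConstant Ω ∧
      hardyConstant Ω < ENNReal.ofReal ((n : ℝ) ^ 2 / 4)) := by
  refine ⟨fun Ω hΩ h0 => hardyConstant_eq_of_zero_mem hn hΩ.isOpen h0,
    fun Ω hΩ h0 => ⟨hardyConstant_ge hn hΩ.isOpen, hΩ.hardyConstant_le hn h0,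
      fun hb => hΩ.lt_hardyConstant hn hb h0⟩,
    fun Ω hΩ h0 hs => le_antisymm (hΩ.hardyConstant_le hn h0)
      (hardyConstant_ge_of_subset_halfSpace hn hΩ.isOpen hs),
    fun Ω hΩ hb h0 hlt => hΩ.hardyConstantAttained hn hb h0 hlt,
    sInf_hardyConstant_eq hn (fun Ω h => h.1.isOpen) fun Ω h _ h0 => ⟨h, h0⟩,
    sInf_hardyConstant_eq hn (fun Ω h => h.1.isOpen) fun Ω h hb h0 => ⟨h, hb, h0⟩,
    fun ε hε => exists_isSmoothDomain_near_halfSpace hn hε⟩
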